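/- **Set-up.** Let $\tilde\phi(x,\xi)=\phi(x)+\xi x^{r}$ be a generic degree-wise Puiseux series: $\phi=\sum_e a_e x^e$ is a finite sum with $e\in\mathbb Q$, $a_e\in\mathbb C$, all its exponents are larger than $r\in\mathbb Q$, and $\xi$ is an indeterminate. Let $(q_1,p_1),\dots,(q_{l+1},p_{l+1})$ be its formal Puiseux pairs, i.e. $(q_1,p_1),\dots,(q_l,p_l)$ are the Puiseux pairs of $\phi$ (so $p_j\ge 2$, $\gcd(q_j,p_j)=1$, $p_1\cdots p_l$ is the least common denominator of the exponents of $\phi$, and $q_j/(p_1\cdots p_j)$ is the largest exponent of $\phi$ outside $\frac1{p_1\cdots p_{j-1}}\mathbb Z$) and $r=q_{l+1}/(p_1\cdots p_{l+1})$ with $p_{l+1}\ge1$, $\gcd(q_{l+1},p_{l+1})=1$. For $1\le k\le l+1$ let $\phi_k$ be the sum of the terms of $\phi$ with exponent $>q_k/(p_1\cdots p_k)$, and for $0\neq f\in\mathbb C[x,x^{-1},y]$ put $$\delta_k(f)=p_1\cdots p_k\cdot\deg_x f\bigl(x,\phi_k(x)+\xi x^{q_k/(p_1\cdots p_k)}\bigr)\in\mathbb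 Z,\qquad \delta_k(0)=-\infty ;$$ $\delta:=\delta_{l+1}$. The *key forms* of $\delta$ are the elements $g_0=x,\ g_1=y,\ g_2,\dots,g_{n+1}$ of $\mathbb C[x,x^{-1},y]$ such that, with $w_j=\delta(g_j)$ and, for $1\le j\le n$, $\alpha_j=\min\{\alpha\in\mathbb Z_{>0}:\alpha w_j\in\mathbb Zw_0+\dots+\mathbb Zw_{j-1}\}$: (i) for $1\le j\le n$ there are $\theta_j\in\mathbb C^*$, $\beta_{j,0}\in\mathbb Z$ and integers $0\le\beta_{j,i}<\alpha_i$ ($1\le i<j$) with $w_{j+1}<\alpha_jw_j=\sum_{i<j}\beta_{j,i}w_i$ and $g_{j+1}=g_j^{\alpha_j}-\theta_j\prod_{i<j}g_i^{\beta_{j,i}}$; (ii) for every $0\ne h\in\mathbb C[x,x^{-1},y]$, $\delta(h)$ is the minimum of the weighted degrees (weights $w_0$ for $x$ and $w_j$ for $y_j$) of the $G\in\mathbb C[x,x^{-1},y_1,\dots,y_{n+1}]$ with $G(x,g_1,\dots,g_{n+1})=h$. The *essential key forms* $f_0=x,f_1,\dots,f_{l+1}$ are the subsequence formed by $g_0$,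 the $g_j$ with $1\le j\le n$ and $\alpha_j>1$, and $g_{n+1}$. Composing the recursions between consecutive essential key forms gives, for $1\le j\le l$, $f_{j+1}=f_j^{p_j}-\sum_{i=0}^{j_n}c_{j,i}f_0^{\beta^i_{j,0}}\cdots f_j^{\beta^i_{j,j}}$, with $c_{j,i}\in\mathbb C^*$, $\beta^i_{j,t}\in\mathbb Z$, $\beta^i_{j,t}\geq 0$ for $t\ge1$, and $\beta^0_{j,j}=0$, where the terms are listed in decreasing order of their $\delta$-values. Fix $k$ with $1\le k\le l+1$, and put $A_k=\mathbb C[x,y_1,\dots,y_k]$, $\tilde A_k=A_k[z]$, $\omega_j=\delta_k(f_j)$ for $0\le j\le k$. Let $\omega$ be the weighted degree on $\tilde A_k$ with weights $\omega_0$ for $x$, $\omega_j$ for $y_j$ and $1$ for $z$, and $\pi_k:A_k\to\mathbb C[x,x^{-1},y]$ the $\mathbb C$-algebra map with $x\mapsto x$, $y_j\mapsto f_j$. For $1\le j\le k-1$ put $$\tilde F_{j+1}=y_j^{p_j}-\sum_{i=0}^{j_n}c_{j,i}\,x^{\beta^i_{j,0}}y_1^{\beta^i_{j,1}}\cdots y_j^{\beta^i_{j,j}}\,z^{\,p_j\omega_j-\sum_t\beta^i_{j,t}\omega_t},\qquad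 H_{j+1}=y_j^{p_j}-c_{j,0}\,x^{\beta^0_{j,0}}y_1^{\beta^0_{j,1}}\cdots y_{j-1}^{\beta^0_{j,j-1}} .$$ Let $\mathbb C[x,y]^{\delta_k}=\bigoplus_{d\ge0}\{f\in\mathbb C[x,y]:\delta_k(f)\le d\}$, and write $(f)_d$ for the copy of $f$ in degree $d$. Order the monomials of $A_k$ by $\prec_k$: compare $\omega$ first; in case of a tie, the exponent vector that is smaller at the right-most entry where the two differ is the smaller one. **Statement.** Assume $f_j\in\mathbb C[x,y]$ and $\delta_k(f_j)>0$ for all $0\le j\le k$. Then the $\omega_j$ are positive integers, $\omega_{j+1}<p_j\omega_j$, $\beta^i_{j,0}\ge0$ and $\sum_t\beta^i_{j,t}\omega_t\le p_j\omega_j$ for $1\le j\le k-1$ and all $i$ (so that the $\tilde F_{j+1}$ and $H_{j+1}$ are polynomials), and: 1. Let $\tilde J_k\subseteq\tilde A_k$ be the ideal generated by the $y_{j+1}z^{p_j\omega_j-\omega_{j+1}}-\tilde F_{j+1}$, $1\le j\le k-1$. There is an isomorphism of graded $\mathbb C$-algebras $\tilde A_k/\tilde J_k\cong\mathbb C[x,y]^{\delta_k}$,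 given by $z\mapsto(1)_1$, $x\mapsto(x)_{\omega_0}$, $y_j\mapsto(f_j)_{\omega_j}$. Moreover this presents $\operatorname{Proj}\mathbb C[x,y]^{\delta_k}$ as a weighted complete intersection: the $k-1$ generators are weighted homogeneous of positive degree and $\dim\tilde A_k/\tilde J_k=\dim\tilde A_k-(k-1)$. 2. Let $J_k\subseteq A_k$ be the ideal generated by the leading weighted homogeneous forms (with respect to $\omega$) of all $F\in A_k$ with $\delta_k(\pi_k(F))<\omega(F)$. Then $(H_k,\dots,H_2)$ is a Gröbner basis of $J_k$ with respect to $\prec_k$. -/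

import Mathlib

open Polynomial

noncomputable section

namespace KeyFormsAtInfinity

/-- `ℂ[x, x⁻¹][y]`; the outer polynomial variable is `y`. -/
abbrev LaurentXY : Type := Polynomial (LaurentPolynomial ℂ)

/-- `ℂ[x, y] = ℂ[x][y]`; the outer polynomial variable is `y`. -/
abbrev PolyXY : Type := Polynomial (Polynomial ℂ)

/-- The inclusion `ℂ[x, y] → ℂ[x, x⁻¹, y]`. -/
def incl : PolyXY →ₐ[ℂ] LaurentXY :=
  Polynomial.mapAlgHom Polynomial.toLaurentAlg

/-! ### Degree-wise Puiseux polynomials -/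

/-- All exponents of the Puiseux polynomial `φ` lie in `(1/N)ℤ`. -/
def ExponentsIn (N : ℕ) (φ : ℚ →₀ ℂ) : Prop :=
  ∀ e ∈ φ.support, ∃ a : ℤ, e = a / N

/-- A generic degree-wise Puiseux series `φ(x) + ξ x ^ r` (`φ` a finite sum of terms `c x ^ e`,
`e ∈ ℚ`, all with `e > r`) together with its formal Puiseux pairs
`(q 1, p 1), …, (q (l + 1), p (l + 1))`: the first `l` of these are the Puiseux pairs of `φ`, and
the last one is given by `r = q (l + 1) / (p 1 ⋯ p (l + 1))`.
The values of `q`, `p` at other indices play no role. -/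
structure GenericPuiseux where
  φ : ℚ →₀ ℂ
  r : ℚ
  r_lt : ∀ e ∈ φ.support, r < e
  l : ℕ
  q : ℕ → ℤ
  p : ℕ → ℕ
  two_le : ∀ j, 1 ≤ j → j ≤ l → 2 ≤ p j
  last_pos : 1 ≤ p (l + 1)
  coprime : ∀ j, 1 ≤ j → j ≤ l + 1 → IsCoprime (q j) (p j : ℤ)
  /-- the polydromy order of `φ` is `p 1 ⋯ p l` -/
  polydromy : IsLeast {N : ℕ | 0 < N ∧ ExponentsIn N φ} (∏ i ∈ Finset.Icc 1 l, p i)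
  /-- the part of `φ` of degree `> q j / (p 1 ⋯ p j)` has exponents in `(1 / (p 1 ⋯ p (j-1))) ℤ` -/
  pair_above : ∀ j, 1 ≤ j → j ≤ l →
    ExponentsIn (∏ i ∈ Finset.Icc 1 (j - 1), p i)
      (φ.filter fun e => (q j : ℚ) / ((∏ i ∈ Finset.Icc 1 j, p i : ℕ) : ℚ) < e)
  /-- the part of `φ` of degree `≥ q j / (p 1 ⋯ p j)` does not -/
  pair_at : ∀ j, 1 ≤ j → j ≤ l →
    ¬ ExponentsIn (∏ i ∈ Finset.Icc 1 (j - 1), p i)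
      (φ.filter fun e => (q j : ℚ) / ((∏ i ∈ Finset.Icc 1 j, p i : ℕ) : ℚ) ≤ e)
  r_eq : r = (q (l + 1) : ℚ) / ((∏ i ∈ Finset.Icc 1 (l + 1), p i : ℕ) : ℚ)

/-- Finite sums of terms `c(ξ) x ^ e` with `c(ξ) ∈ ℂ[ξ]` and `e ∈ ℚ`. -/
abbrev PuiseuxXi : Type := AddMonoidAlgebra (Polynomial ℂ) ℚ

/-- The degree in `x`, with `deg 0 = ⊥`. -/
def degX (h : PuiseuxXi) : WithBot ℚ := h.supDegree WithBot.some

/-- The inclusion `ℂ[x, x⁻¹] → ⋃ ℂ[ξ][x^{1/N}, x^{-1/N}]`. -/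
def laurentToPuiseux : LaurentPolynomial ℂ →+* PuiseuxXi :=
  (AddMonoidAlgebra.mapDomainRingHom (Polynomial ℂ) (Int.castAddHom ℚ)).comp
    (AddMonoidAlgebra.mapRingHom ℤ (Polynomial.C : ℂ →+* Polynomial ℂ))

namespace GenericPuiseux

variable (D : GenericPuiseux)

/-- `p 1 ⋯ p k` -/
def P (k : ℕ) : ℕ := ∏ i ∈ Finset.Icc 1 k, D.p i

/-- The exponent `q k / (p 1 ⋯ p k)`; for `k = l + 1` this is `r`. -/
def expo (k : ℕ) : ℚ := (D.q k : ℚ) / (D.P k : ℚ)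

/-- `φ_k(x) + ξ x ^ (q k / (p 1 ⋯ p k))`, where `φ_k` consists of the terms of `φ` of degree
larger than `q k / (p 1 ⋯ p k)`. -/
def series (k : ℕ) : PuiseuxXi :=
  AddMonoidAlgebra.ofCoeff
      ((D.φ.filter fun e => D.expo k < e).mapRange Polynomial.C Polynomial.C_0) +
    AddMonoidAlgebra.single (D.expo k) (Polynomial.X : Polynomial ℂ)

/-- The substitution of the `k`-th generic series for `y`. -/
def subst (k : ℕ) : LaurentXY →+* PuiseuxXi :=
  Polynomial.eval₂RingHom laurentToPuiseux (D.series k)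

/-- The semidegree `δ_k`: `δ_k(f) = p 1 ⋯ p k * deg_x (f(x, φ_k(x) + ξ x ^ (q k / (p 1 ⋯ p k))))`,
with the convention `δ_k(0) = ⊥`. For `1 ≤ k ≤ l + 1` its values on `f ≠ 0` are integers. -/
def semidegree (k : ℕ) (f : LaurentXY) : WithBot ℚ :=
  (degX (D.subst k f)).map fun s => (D.P k : ℚ) * s

/-- The semidegree `δ = δ_{l+1}` with generic degree-wise Puiseux series `φ(x) + ξ x ^ r`. -/
def fullSemidegree : LaurentXY → WithBot ℚ := D.semidegree (D.l + 1)

end GenericPuiseux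

/-! ### Key forms and essential key forms -/

/-- The weighted degree on `B = ℂ[x, x⁻¹][y_1, …, y_N]` with weights `ω 0` for `x` and `ω j` for
`y_j` (the variable `y_j` has index `j - 1` in `Fin N`); the value at `0` is `⊥`. -/
def weightedDegB {N : ℕ} (ω : ℕ → ℚ) (G : MvPolynomial (Fin N) (LaurentPolynomial ℂ)) :
    WithBot ℚ :=
  G.support.sup fun m => (MvPolynomial.coeff m G).coeff.support.sup fun a =>
    (((a : ℚ) * ω 0 + ∑ i, (m i : ℚ) * ω (i.val + 1) : ℚ) : WithBot ℚ)

/-- The sequence of key forms `g 0, …, g (n + 1)` of `δ`, with the numbers `α j`, `θ j` and the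
exponents `β₀ j` (of `g 0 = x`) and `β j i` (of `g i`, `1 ≤ i < j`) of its recursion,
`1 ≤ j ≤ n`. Values at other indices play no role. -/
structure KeyForms (δ : LaurentXY → WithBot ℚ) where
  n : ℕ
  g : ℕ → LaurentXY
  α : ℕ → ℕ
  β₀ : ℕ → ℤ
  β : ℕ → ℕ → ℕ
  θ : ℕ → ℂ
  /-- the values `δ (g j)` -/
  ω : ℕ → ℚ
  ω_eq : ∀ j ≤ n + 1, δ (g j) = (ω j : WithBot ℚ)
  g_zero : g 0 = Polynomial.C (LaurentPolynomial.T 1)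
  g_one : g 1 = Polynomial.X
  α_min : ∀ j, 1 ≤ j → j ≤ n →
    IsLeast {a : ℕ | 0 < a ∧ (a : ℚ) * ω j ∈ AddSubgroup.closure (ω '' Set.Iio j)} (α j)
  β_lt : ∀ j i, 1 ≤ i → i < j → j ≤ n → β j i < α i
  ω_rel : ∀ j, 1 ≤ j → j ≤ n →
    (α j : ℚ) * ω j = (β₀ j : ℚ) * ω 0 + ∑ i ∈ Finset.Ico 1 j, (β j i : ℚ) * ω i
  ω_lt : ∀ j, 1 ≤ j → j ≤ n → ω (j + 1) < (α j : ℚ) * ω j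
  θ_ne : ∀ j, 1 ≤ j → j ≤ n → θ j ≠ 0
  g_succ : ∀ j, 1 ≤ j → j ≤ n →
    g (j + 1) = g j ^ α j -
      θ j • (Polynomial.C (LaurentPolynomial.T (β₀ j)) * ∏ i ∈ Finset.Ico 1 j, g i ^ β j i)
  /-- `δ(h)` is the least weighted degree of the polynomials `G` with `G(x, g 1, …, g (n+1)) = h` -/
  generating : ∀ h : LaurentXY, h ≠ 0 →
    IsLeast ((weightedDegB ω) '' {G : MvPolynomial (Fin (n + 1)) (LaurentPolynomial ℂ) |
      MvPolynomial.aeval (fun i : Fin (n + 1) => g (i.val + 1)) G = h}) (δ h)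

namespace KeyForms

variable {δ : LaurentXY → WithBot ℚ} (K : KeyForms δ)

/-- The `s`-th element (counting from `0`) of `{0} ∪ {j : 1 ≤ j ≤ n, α j > 1} ∪ {n + 1}`. -/
def essIdx (s : ℕ) : ℕ :=
  Nat.nth (fun j => j = 0 ∨ (1 ≤ j ∧ j ≤ K.n ∧ 1 < K.α j) ∨ j = K.n + 1) s

/-- The essential key forms `f 0, f 1, …`: the key forms `g j` with `j = 0`, or `1 ≤ j ≤ n` and
`α j > 1`, or `j = n + 1`. -/
def ess (s : ℕ) : LaurentXY := K.g (K.essIdx s)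

/-- The steps of the recursion `g j ↦ g (j + 1)` that lead from `f s` to `f (s + 1)`, so that
`f (s+1) = f s ^ α - ∑ i ∈ steps s, θ i * x ^ (β₀ i) * ∏ t, f t ^ β i (essIdx t)`. The first of
them is `i = essIdx s`. -/
def steps (s : ℕ) : Finset ℕ := Finset.Ico (K.essIdx s) (K.essIdx (s + 1))

/-- The exponents, in `A_k = ℂ[x, y_1, …, y_k]`, of the monomial that is subtracted at step `i`:
variable `0` is `x`, variable `t ≥ 1` is `y_t`. The exponent `β₀ i` of `x` has to be nonnegative
for this to be meaningful. -/
def expoA (k i : ℕ) : Fin (k + 1) →₀ ℕ :=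
  Finsupp.equivFunOnFinite.symm fun t =>
    if t.val = 0 then (K.β₀ i).toNat
    else if K.essIdx t.val < i then K.β i (K.essIdx t.val) else 0

end KeyForms

/-! ### The polynomial rings `A_k`, `A_k[z]`, the ideals, and the forms -/

/-- `A_k = ℂ[x, y_1, …, y_k]`; variable `0` is `x` and variable `t ≥ 1` is `y_t`. -/
abbrev A (k : ℕ) : Type := MvPolynomial (Fin (k + 1)) ℂ

/-- `A_k[z]`; variable `none` is `z`. -/
abbrev Az (k : ℕ) : Type := MvPolynomial (Option (Fin (k + 1))) ℂ

section Setup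

variable (D : GenericPuiseux) (K : KeyForms D.fullSemidegree) (k : ℕ)

/-- The weights `ω_j = δ_k(f_j)`, for positive values; `ω_0` is the weight of `x`. -/
def weight (j : ℕ) : ℕ := ⌊(D.semidegree k (K.ess j)).unbotD 0⌋₊

/-- The weights on `A_k`. -/
def weightA (t : Fin (k + 1)) : ℕ := weight D K k t.val

/-- The weights on `A_k[z]`; `z` has weight `1`. -/
def weightAz : Option (Fin (k + 1)) → ℕ
  | none => 1
  | some t => weightA D K k t

/-- `π_k : A_k → ℂ[x, x⁻¹, y]`, `x ↦ x`, `y_j ↦ f_j`. -/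
def piA : A k →ₐ[ℂ] LaurentXY :=
  MvPolynomial.aeval fun t : Fin (k + 1) => K.ess t.val

/-- `F ↦ π_k(F|_{z = 1})` on `A_k[z]`. -/
def piAz : Az k →ₐ[ℂ] LaurentXY :=
  MvPolynomial.aeval fun v : Option (Fin (k + 1)) =>
    match v with
    | none => 1
    | some t => K.ess t.val

/-- The variable `y_j` as an index in `Fin (k + 1)`, for `j ≤ k`. -/
def yIdx (j : ℕ) : Fin (k + 1) := Fin.ofNat (k + 1) j

/-- The homogenization `F̃_{j+1} ∈ A_k[z]`, `1 ≤ j ≤ k - 1`, of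
`F_{j+1} = y_j ^ p_j - ∑ i, c_{j,i} x ^ β^i_{j,0} y_1 ^ β^i_{j,1} ⋯ y_j ^ β^i_{j,j}`. -/
def homF (j : ℕ) : Az k :=
  MvPolynomial.X (some (yIdx k j)) ^ D.p j -
    ∑ i ∈ K.steps j,
      MvPolynomial.rename some (MvPolynomial.monomial (K.expoA k i) (K.θ i)) *
        MvPolynomial.X none ^
          (D.p j * weight D K k j - Finsupp.weight (weightA D K k) (K.expoA k i))

/-- The generators `y_{j+1} z ^ (p_j ω_j - ω_{j+1}) - F̃_{j+1}`, `1 ≤ j ≤ k - 1`. -/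
def relGen (j : ℕ) : Az k :=
  MvPolynomial.X (some (yIdx k (j + 1))) *
      MvPolynomial.X none ^ (D.p j * weight D K k j - weight D K k (j + 1)) -
    homF D K k j

/-- The family of the `k - 1` generators. -/
def relFamily (i : Fin (k - 1)) : Az k := relGen D K k (i.val + 1)

/-- The ideal `J̃_k`. -/
def idealJz : Ideal (Az k) := Ideal.span (Set.range (relFamily D K k))

/-- The leading form `H_{j+1} = y_j ^ p_j - c_{j,0} x ^ β^0_{j,0} y_1 ^ β^0_{j,1} ⋯`. -/
def leadH (j : ℕ) : A k :=
  MvPolynomial.X (yIdx k j) ^ D.p j -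
    MvPolynomial.monomial (K.expoA k (K.essIdx j)) (K.θ (K.essIdx j))

/-- The ideal `J_k` generated by the leading weighted homogeneous forms of all `F ∈ A_k` with
`δ_k(π_k(F)) < ω(F)`. -/
def idealJ : Ideal (A k) :=
  Ideal.span {L | ∃ F : A k,
    D.semidegree k (piA D K k F) <
        (((MvPolynomial.weightedTotalDegree (weightA D K k) F : ℕ) : ℚ) : WithBot ℚ) ∧
    L = MvPolynomial.weightedHomogeneousComponent (weightA D K k)
        (MvPolynomial.weightedTotalDegree (weightA D K k) F) F}

end Setup

/-! ### The graded ring of a semidegree -/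

namespace GenericPuiseux

variable (D : GenericPuiseux)

lemma semidegree_le_coe_iff (k : ℕ) (f : LaurentXY) (b : ℚ) :
    D.semidegree k f ≤ (b : WithBot ℚ) ↔
      ∀ e ∈ (D.subst k f).coeff.support, (D.P k : ℚ) * e ≤ b := by
  have hmono : Monotone fun s : ℚ => (D.P k : ℚ) * s := fun a b h =>
    mul_le_mul_of_nonneg_left h (Nat.cast_nonneg _)
  have hmap : D.semidegree k f =
      (D.subst k f).coeff.support.sup fun e => (((D.P k : ℚ) * e : ℚ) : WithBot ℚ) := by
    unfold semidegree degX AddMonoidAlgebra.supDegree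
    exact Finset.apply_sup_eq_sup_comp_of_linearOrder _ (WithBot.monotone_map_iff.2 hmono) rfl
  rw [hmap, Finset.sup_le_iff]
  simp only [WithBot.coe_le_coe]

lemma semidegree_mul_le {k : ℕ} {f f' : LaurentXY} {a b : ℚ}
    (h : D.semidegree k f ≤ (a : WithBot ℚ)) (h' : D.semidegree k f' ≤ (b : WithBot ℚ)) :
    D.semidegree k (f * f') ≤ ((a + b : ℚ) : WithBot ℚ) := by
  classical
  rw [semidegree_le_coe_iff] at *
  intro e he
  rw [map_mul] at he
  obtain ⟨u, hu, v, hv, rfl⟩ := Finset.mem_add.1 (AddMonoidAlgebra.support_coeff_mul_subset _ _ he)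
  rw [mul_add]
  exact add_le_add (h u hu) (h' v hv)

lemma semidegree_algebraMap_le (k : ℕ) (c : ℂ) :
    D.semidegree k (incl (algebraMap ℂ PolyXY c)) ≤ ((0 : ℚ) : WithBot ℚ) := by
  rw [semidegree_le_coe_iff]
  intro e he
  have h1 : D.subst k (incl (algebraMap ℂ PolyXY c)) =
      AddMonoidAlgebra.single (0 : ℚ) (Polynomial.C c) := by
    rw [AlgHom.commutes]
    simp only [subst, laurentToPuiseux, Polynomial.algebraMap_apply, RingHom.comp_apply,
      Polynomial.coe_eval₂RingHom, Polynomial.eval₂_C]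
    rw [LaurentPolynomial.algebraMap_apply, ← LaurentPolynomial.single_eq_C,
      AddMonoidAlgebra.mapRingHom_single, AddMonoidAlgebra.mapDomainRingHom_apply,
      AddMonoidAlgebra.mapDomain_single, map_zero, Algebra.algebraMap_self, RingHom.id_apply]
  rw [h1] at he
  have : e = 0 := by
    by_contra hne
    simp [AddMonoidAlgebra.coeff_single, Ne.symm hne] at he
  simp [this]

/-- `{f ∈ ℂ[x, y] : δ_k(f) ≤ d}` (with `0` included). -/
def filtration (k d : ℕ) : Submodule ℂ PolyXY where
  carrier := {f | D.semidegree k (incl f) ≤ ((d : ℚ) : WithBot ℚ)}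
  zero_mem' := by
    change D.semidegree k (incl 0) ≤ _
    rw [semidegree_le_coe_iff]
    simp
  add_mem' := by
    classical
    intro f f' h h'
    change D.semidegree k (incl (f + f')) ≤ _
    change D.semidegree k (incl f) ≤ _ at h
    change D.semidegree k (incl f') ≤ _ at h'
    rw [semidegree_le_coe_iff] at *
    intro e he
    rw [map_add, map_add, AddMonoidAlgebra.coeff_add] at he
    rcases Finset.mem_union.1 (Finsupp.support_add he) with h1 | h1
    · exact h e h1
    · exact h' e h1
  smul_mem' := by
    intro c f h
    change D.semidegree k (incl f) ≤ _ at h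
    change D.semidegree k (incl (c • f)) ≤ _
    rw [Algebra.smul_def, map_mul]
    simpa using D.semidegree_mul_le (D.semidegree_algebraMap_le k c) h

instance (k : ℕ) : SetLike.GradedMonoid (D.filtration k) where
  one_mem := by
    have := D.semidegree_algebraMap_le k 1
    rw [map_one] at this
    change D.semidegree k (incl 1) ≤ _
    simpa using this
  mul_mem := by
    intro i j f f' h h'
    change D.semidegree k (incl (f * f')) ≤ _
    rw [map_mul]
    simpa using D.semidegree_mul_le h h'

/-- The graded ring `ℂ[x, y]^{δ_k} = ⨁_{d ≥ 0} {f : δ_k(f) ≤ d}`. -/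
abbrev gradedRing (k : ℕ) : Type := DirectSum ℕ fun d => D.filtration k d

end GenericPuiseux

/-! ### Monomial order, Gröbner bases, weighted complete intersections -/

/-- Exponent vectors, ordered first by weight and then by the right-most differing entry. -/
def WeightColex {N : ℕ} (_w : Fin N → ℕ) : Type := Fin N →₀ ℕ

namespace WeightColex

variable {N : ℕ} (w : Fin N → ℕ)

instance : AddCommMonoid (WeightColex w) := inferInstanceAs (AddCommMonoid (Fin N →₀ ℕ))

/-- The identity map. -/
def of : (Fin N →₀ ℕ) ≃+ WeightColex w := AddEquiv.refl (Fin N →₀ ℕ)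

/-- The order is pulled back along this map. -/
def key (a : WeightColex w) : ℕ ×ₗ Colex (Fin N →₀ ℕ) :=
  toLex (Finsupp.weight w ((of w).symm a), toColex ((of w).symm a))

lemma key_injective : Function.Injective (key w) := by
  intro a b h
  have h2 := congrArg (fun z => (ofLex z).2) h
  exact h2

lemma key_add (a b : WeightColex w) : key w (a + b) = key w a + key w b := by
  unfold key
  rw [map_add, map_add]
  rfl

instance : LinearOrder (WeightColex w) := LinearOrder.lift' (key w) (key_injective w)

lemma key_le_key {a b : WeightColex w} : key w a ≤ key w b ↔ a ≤ b := Iff.rfl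

instance : IsOrderedAddMonoid (WeightColex w) where
  add_le_add_left a b h c := by
    rw [← key_le_key, key_add, key_add]
    exact add_le_add_left ((key_le_key w).2 h) _

instance : WellFoundedLT (WeightColex w) :=
  ⟨InvImage.wf (key w) (inferInstance : WellFoundedLT (ℕ ×ₗ Colex (Fin N →₀ ℕ))).wf⟩

end WeightColex

/-- The monomial order `≺`: compare weights first, then the right-most entry that differs. -/
def weightOrder {N : ℕ} (w : Fin N → ℕ) : MonomialOrder (Fin N) where
  syn := WeightColex w
  toSyn := WeightColex.of w
  toSyn_monotone := by
    intro a b h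
    rw [← WeightColex.key_le_key]
    obtain ⟨c, rfl⟩ := exists_add_of_le h
    rw [map_add, WeightColex.key_add]
    refine le_add_of_nonneg_right ?_
    rw [Prod.Lex.le_iff]
    rcases Nat.eq_zero_or_pos (Finsupp.weight w c) with h0 | h0
    · right
      exact ⟨h0.symm, Finsupp.toColex_monotone (zero_le)⟩
    · left
      exact h0

lemma weightOrder_lt_iff {N : ℕ} (w : Fin N → ℕ) (a b : Fin N →₀ ℕ) :
    (weightOrder w).toSyn a < (weightOrder w).toSyn b ↔
      Finsupp.weight w a < Finsupp.weight w b ∨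
        (Finsupp.weight w a = Finsupp.weight w b ∧
          ∃ i, (∀ j, i < j → a j = b j) ∧ a i < b i) := by
  change toLex (Finsupp.weight w a, toColex a) < toLex (Finsupp.weight w b, toColex b) ↔ _
  rw [Prod.Lex.toLex_lt_toLex]
  rfl

/-- `G` is a Gröbner basis of the ideal `I`: `G ⊆ I` is finite and the leading terms of the
elements of `G` generate the ideal generated by the leading terms of the elements of `I`. -/
def IsGroebnerBasis {σ : Type} (m : MonomialOrder σ) (G : Set (MvPolynomial σ ℂ))
    (I : Ideal (MvPolynomial σ ℂ)) : Prop :=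
  G.Finite ∧ G ⊆ I ∧
    Ideal.span (m.leadingTerm '' G) = Ideal.span (m.leadingTerm '' (I : Set (MvPolynomial σ ℂ)))

/-- The polynomials `r_1, …, r_c` define a weighted complete intersection in the weighted
projective space with the positive weights `w`: they are weighted homogeneous, of positive degree,
and the dimension of their common zero locus is smaller by exactly `c`. -/
def IsWeightedCompleteIntersection {σ : Type} (w : σ → ℕ) {c : ℕ}
    (rel : Fin c → MvPolynomial σ ℂ) : Prop :=
  (∀ v, 0 < w v) ∧
  (∀ i, ∃ d, 0 < d ∧ MvPolynomial.IsWeightedHomogeneous w (rel i) d) ∧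
  ringKrullDim (MvPolynomial σ ℂ ⧸ Ideal.span (Set.range rel)) + (c : WithBot ℕ∞) =
    ringKrullDim (MvPolynomial σ ℂ)

end KeyFormsAtInfinity

end

noncomputable section

namespace KeyFormsAtInfinity

section


/-! ### Top terms of Puiseux polynomials -/

/-! Everything rests on top coefficients: substituting the `k`-th generic series into `f` gives a
finite sum of terms `c(ξ) x ^ e`, and the coefficient at the largest `e` is a polynomial in `ξ`. The
decisive question is whether it is constant (`ConstTop`).

Passing from `δ_k` to a later `δ_{k'}` is a specialization of `ξ` to a series with constant term `φ
(expo k)`, so constant top coefficients persist (`isTop_persist`). For the full semidegree, all key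
forms but the last have a constant top coefficient, because the prescribed drop of degree forces a
power of it to be constant (`constTop_last`). The last one does not, for otherwise minimal-degree
expressions in the key forms would give every polynomial a constant top coefficient
(`not_constTop_last`). Let `idx k` be the first key form with nonconstant top coefficient for `δ_k`.
Polynomials of smaller `y`-degree have constant ones; applied to the `y`-derivative this makes the
top coefficient linear in `ξ` (`exists_linear_top`). A congruence between the powers of `x` and of
`ξ` (`isGraded_subst`) kills its constant term for `k ≤ l`, and the degree of `g (idx k)` is then
`expo k` modulo `(1 / P (k - 1)) ℤ`. Hence `α (idx k) = p k`, all other `α` are `1`, and the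
essential key forms are the `g (idx k)` (`essIdx_eq_idx`).

For the algebra, call a monomial standard if its `y_t`-exponents, `1 ≤ t < k`, are below `p t`. The
weight together with the `y_k`-exponent, which is the `ξ`-degree of the top coefficient, determines
a standard monomial (`std_injective`). So top coefficients of standard polynomials never cancel
(`eq_zero_of_std`), and `δ_k` of such a polynomial in the `f_j` is its weighted degree. For the
Gröbner basis, division by the `H_{j+1}` leaves a standard remainder in `J_k`, which must vanish.
For the presentation, the relations reduce every element to standard monomials, which are
independent in the graded ring; homogenizing standard representatives with `z` gives surjectivity.
Finally the quotient is finite over `ℂ[z, x, y_k]`, so its dimension is `3 = (k + 2) - (k - 1)`. -/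

/-- All exponents of `H` are at most `v`, and `c` is the (possibly zero) coefficient at `v`. -/
def IsTop (H : PuiseuxXi) (v : ℚ) (c : ℂ[X]) : Prop :=
  (∀ e, v < e → H.coeff e = 0) ∧ H.coeff v = c

namespace IsTop

variable {H H' : PuiseuxXi} {v v' : ℚ} {c c' : ℂ[X]}

lemma add (h : IsTop H v c) (h' : IsTop H' v c') : IsTop (H + H') v (c + c') :=
  ⟨fun e he => by simp [h.1 e he, h'.1 e he], by simp [h.2, h'.2]⟩

lemma neg (h : IsTop H v c) : IsTop (-H) v (-c) :=
  ⟨fun e he => by simp [h.1 e he], by simp [h.2]⟩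

lemma sub (h : IsTop H v c) (h' : IsTop H' v c') : IsTop (H - H') v (c - c') := by
  simpa only [sub_eq_add_neg] using h.add h'.neg

lemma zero (v : ℚ) : IsTop 0 v 0 := ⟨fun e _ => by simp, by simp⟩

lemma raise (h : IsTop H v c) (hv : v < v') : IsTop H v' 0 :=
  ⟨fun e he => h.1 e (hv.trans he), h.1 v' hv⟩

lemma single (v : ℚ) (c : ℂ[X]) : IsTop (AddMonoidAlgebra.single v c) v c :=
  ⟨fun e he => by simp [he.ne], by simp⟩

lemma one : IsTop 1 0 1 := by
  rw [AddMonoidAlgebra.one_def]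
  exact single 0 1

lemma mul (h : IsTop H v c) (h' : IsTop H' v' c') : IsTop (H * H') (v + v') (c * c') := by
  have hle : ∀ e ∈ H.coeff.support, e ≤ v := fun e he => by
    by_contra hlt
    exact Finsupp.mem_support_iff.1 he (h.1 e (not_le.1 hlt))
  have hle' : ∀ e ∈ H'.coeff.support, e ≤ v' := fun e he => by
    by_contra hlt
    exact Finsupp.mem_support_iff.1 he (h'.1 e (not_le.1 hlt))
  constructor
  · intro e he
    rw [AddMonoidAlgebra.coeff_mul]
    refine Finset.sum_eq_zero fun a ha => Finset.sum_eq_zero fun b hb => if_neg fun hab => ?_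
    have := hle a ha
    have := hle' b hb
    linarith
  · rw [AddMonoidAlgebra.coeff_mul, Finsupp.sum, Finset.sum_eq_single v]
    · rw [Finsupp.sum, Finset.sum_eq_single v']
      · simp [h.2, h'.2]
      · intro b hb hne
        exact if_neg fun hab => hne (by linarith)
      · intro hv'
        simp [Finsupp.notMem_support_iff.1 hv']
    · intro a ha hne
      refine Finset.sum_eq_zero fun b hb => if_neg fun hab => hne ?_
      have := hle a ha
      have := hle' b hb
      linarith
    · intro hv
      simp [Finsupp.notMem_support_iff.1 hv]

lemma pow (h : IsTop H v c) (n : ℕ) : IsTop (H ^ n) (n * v) (c ^ n) := by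
  induction n with
  | zero => simpa using one
  | succ n ih =>
    have := ih.mul h
    rw [pow_succ, pow_succ]
    convert this using 1
    push_cast
    ring

lemma prod {ι : Type*} (s : Finset ι) {H : ι → PuiseuxXi} {v : ι → ℚ} {c : ι → ℂ[X]}
    (h : ∀ i ∈ s, IsTop (H i) (v i) (c i)) :
    IsTop (∏ i ∈ s, H i) (∑ i ∈ s, v i) (∏ i ∈ s, c i) := by
  classical
  induction s using Finset.induction_on with
  | empty => simpa using one
  | insert a s ha ih =>
    rw [Finset.prod_insert ha, Finset.prod_insert ha, Finset.sum_insert ha]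
    exact (h a (by simp)).mul (ih fun i hi => h i (by simp [hi]))

lemma sum {ι : Type*} (s : Finset ι) {H : ι → PuiseuxXi} {v : ℚ} {c : ι → ℂ[X]}
    (h : ∀ i ∈ s, IsTop (H i) v (c i)) :
    IsTop (∑ i ∈ s, H i) v (∑ i ∈ s, c i) :=
  ⟨fun e he => by
    rw [AddMonoidAlgebra.coeff_sum, Finsupp.finsetSum_apply]
    exact Finset.sum_eq_zero fun i hi => (h i hi).1 e he, by
    rw [AddMonoidAlgebra.coeff_sum, Finsupp.finsetSum_apply]
    exact Finset.sum_congr rfl fun i hi => (h i hi).2⟩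

lemma unique (h : IsTop H v c) (h' : IsTop H v' c') (hc : c ≠ 0) (hc' : c' ≠ 0) :
    v = v' ∧ c = c' := by
  have hv : v = v' := by
    rcases lt_trichotomy v v' with hlt | heq | hlt
    · exact absurd (h'.2.symm.trans (h.1 v' hlt)) hc'
    · exact heq
    · exact absurd (h.2.symm.trans (h'.1 v hlt)) hc
  exact ⟨hv, by rw [← h.2, hv, h'.2]⟩

lemma le_of_ne_zero (h : IsTop H v c) (h' : IsTop H v' c') (hc : c ≠ 0) : v ≤ v' := by
  by_contra hlt
  exact hc (h.2.symm.trans (h'.1 v (not_le.1 hlt)))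

end IsTop

lemma exists_isTop {H : PuiseuxXi} (hH : H ≠ 0) : ∃ v c, c ≠ 0 ∧ IsTop H v c := by
  have hs : H.coeff.support.Nonempty := by
    rw [Finset.nonempty_iff_ne_empty]
    intro h
    exact hH (AddMonoidAlgebra.coeff_eq_zero.1 (Finsupp.support_eq_empty.1 h))
  obtain ⟨v, hv, hmax⟩ := H.coeff.support.exists_max_image id hs
  refine ⟨v, H.coeff v, Finsupp.mem_support_iff.1 hv, fun e he => ?_, rfl⟩
  by_contra hne
  exact absurd (hmax e (Finsupp.mem_support_iff.2 hne)) (not_le.2 he)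

lemma degX_eq_of_isTop {H : PuiseuxXi} {v : ℚ} {c : ℂ[X]} (h : IsTop H v c) (hc : c ≠ 0) :
    degX H = (v : WithBot ℚ) := by
  unfold degX AddMonoidAlgebra.supDegree
  apply le_antisymm
  · refine Finset.sup_le fun e he => WithBot.coe_le_coe.2 ?_
    by_contra hlt
    exact Finsupp.mem_support_iff.1 he (h.1 e (not_le.1 hlt))
  · exact Finset.le_sup (f := WithBot.some) (Finsupp.mem_support_iff.2 (by rwa [h.2]))

lemma laurentToPuiseux_single (a : ℤ) (c : ℂ) :
    laurentToPuiseux (AddMonoidAlgebra.single a c) = AddMonoidAlgebra.single (a : ℚ) (C c) := by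
  simp only [laurentToPuiseux, RingHom.comp_apply]
  rw [AddMonoidAlgebra.mapRingHom_single, AddMonoidAlgebra.mapDomainRingHom_apply,
    AddMonoidAlgebra.mapDomain_single]
  rfl

lemma laurentToPuiseux_T (a : ℤ) :
    laurentToPuiseux (LaurentPolynomial.T a) = AddMonoidAlgebra.single (a : ℚ) 1 := by
  simpa using laurentToPuiseux_single a 1

/-! ### Denominators of the generic series and top terms under substitution -/

namespace GenericPuiseux

variable (D : GenericPuiseux)

lemma P_zero : D.P 0 = 1 := by simp [P]

lemma P_succ (k : ℕ) : D.P (k + 1) = D.P k * D.p (k + 1) := by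
  unfold P
  rw [Finset.prod_Icc_succ_top (by lia)]

lemma p_pos {j : ℕ} (h1 : 1 ≤ j) (h2 : j ≤ D.l + 1) : 0 < D.p j := by
  rcases Nat.lt_or_ge D.l j with h | h
  · obtain rfl : j = D.l + 1 := by lia
    exact D.last_pos
  · exact lt_of_lt_of_le two_pos (D.two_le j h1 h)

lemma P_pos {k : ℕ} (hk : k ≤ D.l + 1) : 0 < D.P k :=
  Finset.prod_pos fun i hi => by
    rw [Finset.mem_Icc] at hi
    exact D.p_pos hi.1 (hi.2.trans hk)

lemma P_pos_rat {k : ℕ} (hk : k ≤ D.l + 1) : (0 : ℚ) < D.P k := by exact_mod_cast D.P_pos hk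

lemma semidegree_eq_of_isTop {k : ℕ} {f : LaurentXY} {v : ℚ} {c : ℂ[X]}
    (h : IsTop (D.subst k f) v c) (hc : c ≠ 0) :
    D.semidegree k f = ((D.P k * v : ℚ) : WithBot ℚ) := by
  unfold semidegree
  rw [degX_eq_of_isTop h hc]
  rfl

lemma isTop_of_semidegree_eq {k : ℕ} (hk : k ≤ D.l + 1) {f : LaurentXY} {w : ℚ}
    (h : D.semidegree k f = (w : WithBot ℚ)) :
    ∃ c, c ≠ 0 ∧ IsTop (D.subst k f) (w / D.P k) c := by
  by_cases h0 : D.subst k f = 0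
  · simp [semidegree, degX, h0] at h
  · obtain ⟨v, c, hc, hv⟩ := exists_isTop h0
    rw [D.semidegree_eq_of_isTop hv hc, WithBot.coe_inj] at h
    refine ⟨c, hc, ?_⟩
    rwa [← h, mul_div_cancel_left₀ _ (D.P_pos_rat hk).ne']

@[simp] lemma subst_C (k : ℕ) (a : LaurentPolynomial ℂ) :
    D.subst k (C a) = laurentToPuiseux a := by
  simp [subst]

@[simp] lemma subst_X (k : ℕ) : D.subst k X = D.series k := by
  simp [subst]

lemma subst_smul (k : ℕ) (c : ℂ) (f : LaurentXY) :
    D.subst k (c • f) = AddMonoidAlgebra.single 0 (C c) * D.subst k f := by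
  rw [Algebra.smul_def, map_mul, Polynomial.algebraMap_apply, subst_C]
  congr 1
  rw [LaurentPolynomial.algebraMap_apply, ← LaurentPolynomial.single_eq_C, laurentToPuiseux_single]
  simp

lemma isTop_smul {k : ℕ} {f : LaurentXY} {v : ℚ} {c : ℂ[X]} (a : ℂ)
    (h : IsTop (D.subst k f) v c) : IsTop (D.subst k (a • f)) v (C a * c) := by
  rw [subst_smul]
  simpa using (IsTop.single 0 (C a)).mul h

lemma isTop_subst_T (k : ℕ) (a : ℤ) :
    IsTop (D.subst k (C (LaurentPolynomial.T a))) a 1 := by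
  rw [subst_C, laurentToPuiseux_T]
  exact IsTop.single _ _

lemma series_coeff (k : ℕ) (e : ℚ) :
    (D.series k).coeff e =
      (if D.expo k < e then C (D.φ e) else 0) + if D.expo k = e then X else 0 := by
  classical
  simp only [series, AddMonoidAlgebra.coeff_add, AddMonoidAlgebra.coeff_single,
    Finsupp.add_apply, Finsupp.mapRange_apply,
    Finsupp.filter_apply, Finsupp.single_apply]
  congr 1
  split_ifs <;> simp

end GenericPuiseux

/-! ### Exponents with bounded denominator, and the order of the exponents `expo k` -/

/-- The group `(1 / N) ℤ`. -/
def fracGroup (N : ℕ) : AddSubgroup ℚ := AddSubgroup.zmultiples (1 / (N : ℚ))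

lemma mem_fracGroup {N : ℕ} {e : ℚ} : e ∈ fracGroup N ↔ ∃ a : ℤ, e = a / N := by
  rw [fracGroup, AddSubgroup.mem_zmultiples_iff]
  refine exists_congr fun a => ?_
  rw [zsmul_eq_mul, mul_one_div]
  exact eq_comm

namespace GenericPuiseux

variable (D : GenericPuiseux)

/-- Coprimality of `q` and `p`: in the quotient by `(1 / P k) ℤ` the exponent has order exactly `p
(k + 1)`. -/
lemma mul_expo_mem_iff {k : ℕ} (hk : k + 1 ≤ D.l + 1) (a : ℤ) :
    a * D.expo (k + 1) ∈ fracGroup (D.P k) ↔ (D.p (k + 1) : ℤ) ∣ a := by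
  have hP := D.P_pos_rat (k := k) (by lia)
  have hp : (0 : ℚ) < D.p (k + 1) := by exact_mod_cast D.p_pos (by lia) hk
  have hcop := D.coprime (k + 1) (by lia) hk
  rw [mem_fracGroup]
  constructor
  · rintro ⟨b, hb⟩
    have h1 : (a : ℚ) * D.q (k + 1) = b * D.p (k + 1) := by
      rw [expo, P_succ] at hb
      push_cast at hb
      field_simp at hb
      rw [hb, mul_comm]
    have h2 : a * D.q (k + 1) = b * D.p (k + 1) := by exact_mod_cast h1
    exact hcop.symm.dvd_of_dvd_mul_right ⟨b, by rw [h2]; ring⟩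
  · rintro ⟨b, rfl⟩
    refine ⟨b * D.q (k + 1), ?_⟩
    rw [expo, P_succ]
    push_cast
    field_simp

lemma fracGroup_le {k k' : ℕ} (h : k ≤ k') (hk' : k' ≤ D.l + 1) :
    fracGroup (D.P k) ≤ fracGroup (D.P k') := by
  induction k', h using Nat.le_induction with
  | base => exact le_rfl
  | succ k' h ih =>
    refine (ih (by lia)).trans fun e he => ?_
    obtain ⟨a, rfl⟩ := mem_fracGroup.1 he
    refine mem_fracGroup.2 ⟨a * D.p (k' + 1), ?_⟩
    have hP := D.P_pos_rat (k := k') (by lia)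
    have hp : (0 : ℚ) < D.p (k' + 1) := by exact_mod_cast D.p_pos (by lia) hk'
    rw [P_succ]
    push_cast
    field_simp

lemma expo_mem {k : ℕ} : D.expo k ∈ fracGroup (D.P k) := mem_fracGroup.2 ⟨D.q k, rfl⟩

lemma expo_last : D.expo (D.l + 1) = D.r := D.r_eq.symm

lemma above_mem {k : ℕ} (hk : k + 1 ≤ D.l + 1) {e : ℚ} (he : D.φ e ≠ 0)
    (hlt : D.expo (k + 1) < e) : e ∈ fracGroup (D.P k) := by
  rcases Nat.lt_or_ge D.l (k + 1) with h | h
  · obtain rfl : k = D.l := by lia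
    exact mem_fracGroup.2 (D.polydromy.1.2 e (Finsupp.mem_support_iff.2 he))
  · refine mem_fracGroup.2 (D.pair_above (k + 1) (by lia) h e ?_)
    rw [Finsupp.support_filter, Finset.mem_filter]
    exact ⟨Finsupp.mem_support_iff.2 he, hlt⟩

/-- The ranges in `pair_above` and `pair_at` differ only at `expo (k + 1)`, so the offending
exponent can only be this one. -/
lemma φ_expo_ne_zero {k : ℕ} (hk : k + 1 ≤ D.l) : D.φ (D.expo (k + 1)) ≠ 0 := by
  have h := D.pair_at (k + 1) (by lia) hk
  simp only [ExponentsIn, not_forall] at h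
  obtain ⟨e, he, hne⟩ := h
  rw [Finsupp.support_filter, Finset.mem_filter, Finsupp.mem_support_iff] at he
  rcases he.2.lt_or_eq with hlt | heq
  · exact absurd (mem_fracGroup.1 (D.above_mem (by lia) he.1 hlt)) hne
  · have : D.expo (k + 1) = e := heq
    rw [this]
    exact he.1

/-- The next exponent occurs in `φ` and needs a new denominator, whereas exponents of `φ` from `expo
k` upwards have denominator `P k`. At the last step the bound `r_lt` takes over. -/
lemma expo_succ_lt {k : ℕ} (hk1 : 1 ≤ k) (hk : k ≤ D.l) : D.expo (k + 1) < D.expo k := by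
  obtain ⟨k, rfl⟩ : ∃ m, k = m + 1 := ⟨k - 1, by lia⟩
  rcases Nat.lt_or_ge D.l (k + 1 + 1) with h | h
  · have hl : D.l = k + 1 := by lia
    rw [show k + 1 + 1 = D.l + 1 by lia, D.expo_last]
    exact D.r_lt _ (Finsupp.mem_support_iff.2 (D.φ_expo_ne_zero hk))
  · have hne := D.φ_expo_ne_zero (k := k + 1) h
    have hnot : D.expo (k + 1 + 1) ∉ fracGroup (D.P (k + 1)) := by
      intro hm
      have h1 := (D.mul_expo_mem_iff (k := k + 1) (by lia) 1).1 (by simpa using hm)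
      have h2 := D.two_le (k + 1 + 1) (by lia) h
      have h3 := Int.le_of_dvd one_pos h1
      lia
    rcases lt_trichotomy (D.expo (k + 1 + 1)) (D.expo (k + 1)) with hlt | heq | hlt
    · exact hlt
    · exact absurd (heq ▸ D.expo_mem) hnot
    · exact absurd (D.fracGroup_le (Nat.le_succ k) (by lia) (D.above_mem (by lia) hne hlt)) hnot

lemma expo_lt {k k' : ℕ} (hk1 : 1 ≤ k) (h : k < k') (hk' : k' ≤ D.l + 1) :
    D.expo k' < D.expo k := by
  induction k', h using Nat.le_induction with
  | base => exact D.expo_succ_lt hk1 (by lia)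
  | succ m h ih => exact (D.expo_succ_lt (by lia) (by lia)).trans (ih (by lia))

end GenericPuiseux

end

section


/-! ### Specialization of `ξ` -/

/-- The substitution `ξ ↦ τ` on Puiseux polynomials with coefficients in `ℂ[ξ]`. -/
def specialize (τ : PuiseuxXi) : PuiseuxXi →+* PuiseuxXi :=
  AddMonoidAlgebra.liftNCRingHom (Polynomial.aeval τ : ℂ[X] →ₐ[ℂ] PuiseuxXi).toRingHom
    (AddMonoidAlgebra.of ℂ[X] ℚ) fun _ _ => Commute.all _ _

lemma specialize_single (τ : PuiseuxXi) (e : ℚ) (c : ℂ[X]) :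
    specialize τ (AddMonoidAlgebra.single e c) =
      Polynomial.aeval τ c * AddMonoidAlgebra.single e 1 := by
  rw [specialize, AddMonoidAlgebra.liftNCRingHom_single]
  rfl

lemma algebraMap_puiseux (c : ℂ) :
    algebraMap ℂ PuiseuxXi c = AddMonoidAlgebra.single 0 (C c) := rfl

lemma isTop_aeval {τ : PuiseuxXi} {a : ℂ} (hτ : IsTop τ 0 (C a)) (c : ℂ[X]) :
    IsTop (Polynomial.aeval τ c) 0 (C (c.eval a)) := by
  induction c using Polynomial.induction_on' with
  | add p q hp hq => simpa using hp.add hq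
  | monomial n b =>
    rw [Polynomial.aeval_monomial, algebraMap_puiseux]
    simpa using (IsTop.single 0 (C b)).mul (hτ.pow n)

/-- Since `τ` has no positive exponents, substituting it for `ξ` raises no exponent, and at the top
exponent only its constant term matters. -/
lemma isTop_specialize {τ : PuiseuxXi} {a : ℂ} (hτ : IsTop τ 0 (C a)) {H : PuiseuxXi} {v : ℚ}
    {c : ℂ[X]} (h : IsTop H v c) : IsTop (specialize τ H) v (C (c.eval a)) := by
  have hH : H = ∑ e ∈ H.coeff.support, AddMonoidAlgebra.single e (H.coeff e) := by
    apply AddMonoidAlgebra.coeff_injective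
    rw [AddMonoidAlgebra.coeff_sum]
    exact (Finsupp.sum_single H.coeff).symm
  have hterm : ∀ e ∈ H.coeff.support, IsTop (specialize τ (AddMonoidAlgebra.single e (H.coeff e)))
      v (if e = v then C (c.eval a) else 0) := by
    intro e he
    have h1 : IsTop (specialize τ (AddMonoidAlgebra.single e (H.coeff e))) e
        (C ((H.coeff e).eval a)) := by
      rw [specialize_single]
      simpa using (isTop_aeval hτ (H.coeff e)).mul (IsTop.single e 1)
    split_ifs with hev
    · subst hev
      rwa [h.2] at h1 ⊢
    · refine h1.raise (lt_of_le_of_ne ?_ hev)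
      by_contra hlt
      exact Finsupp.mem_support_iff.1 he (h.1 e (not_le.1 hlt))
  have hsum := IsTop.sum _ hterm
  rw [← map_sum, ← hH, Finset.sum_ite_eq' H.coeff.support v] at hsum
  convert hsum using 1
  split_ifs with hv
  · rfl
  · rw [← h.2, Finsupp.notMem_support_iff.1 hv]
    simp

namespace GenericPuiseux

variable (D : GenericPuiseux)

/-- The value of `ξ` that turns the `k`-th generic series into the `k'`-th one. -/
def tail (k k' : ℕ) : PuiseuxXi :=
  (D.series k' - (D.series k - AddMonoidAlgebra.single (D.expo k) X)) *
    AddMonoidAlgebra.single (-D.expo k) 1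

/-- The two series agree above `expo k`; at `expo k` the later one has the true coefficient of `φ`
where the earlier one has `ξ`. -/
lemma isTop_tail {k k' : ℕ} (hk1 : 1 ≤ k) (h : k < k') (hk' : k' ≤ D.l + 1) :
    IsTop (D.tail k k') 0 (C (D.φ (D.expo k))) := by
  have hlt := D.expo_lt hk1 h hk'
  have h1 : IsTop (D.series k' - (D.series k - AddMonoidAlgebra.single (D.expo k) X))
      (D.expo k) (C (D.φ (D.expo k))) := by
    constructor
    · intro e he
      simp [series_coeff, he, he.ne, hlt.trans he, (hlt.trans he).ne]
    · simp [series_coeff, hlt, hlt.ne]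
  simpa [tail] using h1.mul (IsTop.single (-D.expo k) 1)

lemma specialize_laurent (τ : PuiseuxXi) (a : LaurentPolynomial ℂ) :
    specialize τ (laurentToPuiseux a) = laurentToPuiseux a := by
  induction a using AddMonoidAlgebra.induction_linear with
  | zero => simp
  | add p q hp hq => simp [hp, hq]
  | single e c =>
    rw [laurentToPuiseux_single, specialize_single, aeval_C, algebraMap_puiseux,
      AddMonoidAlgebra.single_mul_single]
    simp

/-- A Puiseux polynomial that does not involve `ξ` is fixed by specialization. -/
lemma specialize_of_const (τ : PuiseuxXi) {H : PuiseuxXi}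
    (h : ∀ e, ∃ c : ℂ, H.coeff e = C c) : specialize τ H = H := by
  have hH : H = ∑ e ∈ H.coeff.support, AddMonoidAlgebra.single e (H.coeff e) := by
    apply AddMonoidAlgebra.coeff_injective
    rw [AddMonoidAlgebra.coeff_sum]
    exact (Finsupp.sum_single H.coeff).symm
  conv_rhs => rw [hH]
  conv_lhs => rw [hH]
  rw [map_sum]
  refine Finset.sum_congr rfl fun e _ => ?_
  obtain ⟨c, hc⟩ := h e
  rw [hc, specialize_single, aeval_C, algebraMap_puiseux, AddMonoidAlgebra.single_mul_single]
  simp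

lemma series_sub_const (k : ℕ) (e : ℚ) : ∃ c : ℂ,
    (D.series k - AddMonoidAlgebra.single (D.expo k) X).coeff e = C c := by
  by_cases h : D.expo k < e
  · exact ⟨D.φ e, by simp [series_coeff, h, h.ne]⟩
  · refine ⟨0, ?_⟩
    by_cases h' : D.expo k = e
    · simp [series_coeff, h']
    · simp [series_coeff, h, h']

lemma specialize_series (k k' : ℕ) : specialize (D.tail k k') (D.series k) = D.series k' := by
  have h1 : D.series k = (D.series k - AddMonoidAlgebra.single (D.expo k) X) +
      AddMonoidAlgebra.single (D.expo k) X := by ring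
  conv_lhs => rw [h1]
  rw [map_add, specialize_of_const _ (D.series_sub_const k), specialize_single, aeval_X, tail,
    mul_assoc, AddMonoidAlgebra.single_mul_single]
  simp [← AddMonoidAlgebra.one_def]

lemma specialize_subst (k k' : ℕ) (f : LaurentXY) :
    specialize (D.tail k k') (D.subst k f) = D.subst k' f := by
  have : (specialize (D.tail k k')).comp (D.subst k) = D.subst k' := by
    refine Polynomial.ringHom_ext (fun a => ?_) ?_
    · simp [specialize_laurent]
    · simp [specialize_series]
  exact RingHom.congr_fun this f

/-- The comparison between different `δ_k`. The new coefficient may be zero, which is why `IsTop`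
allows zero coefficients. -/
lemma isTop_persist {k k' : ℕ} (hk1 : 1 ≤ k) (h : k < k') (hk' : k' ≤ D.l + 1) {f : LaurentXY}
    {v : ℚ} {c : ℂ[X]} (hf : IsTop (D.subst k f) v c) :
    IsTop (D.subst k' f) v (C (c.eval (D.φ (D.expo k)))) := by
  rw [← D.specialize_subst k k' f]
  exact isTop_specialize (D.isTop_tail hk1 h hk') hf

/-! ### The exponents that accompany a power of `ξ` -/

/-- The terms `ξ ^ m x ^ E` of `H` satisfy `E ∈ m e + Γ`. -/
def IsGraded (e : ℚ) (Γ : AddSubgroup ℚ) (H : PuiseuxXi) : Prop :=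
  ∀ E m, (H.coeff E).coeff m ≠ 0 → E - m * e ∈ Γ

lemma IsGraded.add {e : ℚ} {Γ : AddSubgroup ℚ} {H H' : PuiseuxXi} (h : IsGraded e Γ H)
    (h' : IsGraded e Γ H') : IsGraded e Γ (H + H') := by
  intro E m hne
  by_cases h0 : (H.coeff E).coeff m = 0
  · exact h' E m (by simpa [h0] using hne)
  · exact h E m h0

lemma IsGraded.mul {e : ℚ} {Γ : AddSubgroup ℚ} {H H' : PuiseuxXi} (h : IsGraded e Γ H)
    (h' : IsGraded e Γ H') : IsGraded e Γ (H * H') := by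
  intro E m hne
  rw [AddMonoidAlgebra.coeff_mul, Finsupp.sum, finsetSum_coeff] at hne
  obtain ⟨a, -, ha⟩ := Finset.exists_ne_zero_of_sum_ne_zero hne
  rw [Finsupp.sum, finsetSum_coeff] at ha
  obtain ⟨b, -, hb⟩ := Finset.exists_ne_zero_of_sum_ne_zero ha
  split_ifs at hb with hab
  · rw [coeff_mul] at hb
    obtain ⟨⟨i, j⟩, hij, hne⟩ := Finset.exists_ne_zero_of_sum_ne_zero hb
    have h1 := h a i (left_ne_zero_of_mul hne)
    have h2 := h' b j (right_ne_zero_of_mul hne)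
    have hm : i + j = m := Finset.HasAntidiagonal.mem_antidiagonal.1 hij
    have := Γ.add_mem h1 h2
    rw [← hm, ← hab]
    push_cast
    convert this using 1
    ring
  · simp at hb

lemma IsGraded.pow {e : ℚ} {Γ : AddSubgroup ℚ} {H : PuiseuxXi} (h : IsGraded e Γ H) (n : ℕ) :
    IsGraded e Γ (H ^ n) := by
  induction n with
  | zero =>
    intro E m hne
    rw [pow_zero, AddMonoidAlgebra.one_def, AddMonoidAlgebra.coeff_single,
      Finsupp.single_apply] at hne
    split_ifs at hne with h0
    · rw [coeff_one] at hne
      split_ifs at hne with hm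
      · simp [← h0, hm, Γ.zero_mem]
      · exact absurd rfl hne
    · simp at hne
  | succ n ih =>
    rw [pow_succ]
    exact ih.mul h

/-- Integral powers of `x` and the terms of `φ` above `expo (k + 1)` have exponents in the group,
and each `ξ` comes with one factor `x ^ expo (k + 1)`; the property is stable under sums and
products. -/
lemma isGraded_subst {k : ℕ} (hk : k + 1 ≤ D.l + 1) (f : LaurentXY) :
    IsGraded (D.expo (k + 1)) (fracGroup (D.P k)) (D.subst (k + 1) f) := by
  have hintegral : ∀ a : ℤ, (a : ℚ) ∈ fracGroup (D.P k) := fun a =>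
    D.fracGroup_le (Nat.zero_le k) (by lia) (mem_fracGroup.2 ⟨a, by simp [P_zero]⟩)
  have hlaurent : ∀ a : LaurentPolynomial ℂ,
      IsGraded (D.expo (k + 1)) (fracGroup (D.P k)) (laurentToPuiseux a) := by
    intro a
    induction a using AddMonoidAlgebra.induction_linear with
    | zero => intro E m hne; simp at hne
    | add p q hp hq => rw [map_add]; exact hp.add hq
    | single e c =>
      intro E m hne
      rw [laurentToPuiseux_single, AddMonoidAlgebra.coeff_single, Finsupp.single_apply] at hne
      split_ifs at hne with h0
      · rw [coeff_C] at hne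
        split_ifs at hne with hm
        · rw [← h0, hm]
          simpa using hintegral e
        · exact absurd rfl hne
      · simp at hne
  have hser : IsGraded (D.expo (k + 1)) (fracGroup (D.P k)) (D.series (k + 1)) := by
    intro E m hne
    rw [series_coeff] at hne
    by_cases h1 : D.expo (k + 1) < E
    · rw [if_pos h1, if_neg h1.ne, add_zero, coeff_C] at hne
      split_ifs at hne with hm
      · rw [hm]
        simpa using D.above_mem hk hne h1
      · exact absurd rfl hne
    · by_cases h2 : D.expo (k + 1) = E
      · rw [if_neg h1, if_pos h2, zero_add, coeff_X] at hne
        split_ifs at hne with hm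
        · rw [← hm, h2]
          simp
        · exact absurd rfl hne
      · simp [h1, h2] at hne
  induction f using Polynomial.induction_on' with
  | add p q hp hq => rw [map_add]; exact hp.add hq
  | monomial n a =>
    rw [← C_mul_X_pow_eq_monomial, map_mul, map_pow, subst_C, subst_X]
    exact (hlaurent a).mul (hser.pow n)

/-! ### The derivative with respect to `ξ` -/

/-- The derivative with respect to `ξ`. -/
def derivXi : PuiseuxXi →+ PuiseuxXi where
  toFun H := AddMonoidAlgebra.map (Polynomial.derivative (R := ℂ)).toAddMonoidHom H
  map_zero' := AddMonoidAlgebra.map_zero _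
  map_add' := AddMonoidAlgebra.map_add _

lemma derivXi_coeff (H : PuiseuxXi) (e : ℚ) :
    (derivXi H).coeff e = derivative (H.coeff e) := rfl

lemma derivXi_single (e : ℚ) (c : ℂ[X]) :
    derivXi (AddMonoidAlgebra.single e c) = AddMonoidAlgebra.single e (derivative c) :=
  AddMonoidAlgebra.map_single _ _ _

lemma derivXi_mul (H H' : PuiseuxXi) :
    derivXi (H * H') = derivXi H * H' + H * derivXi H' := by
  induction H using AddMonoidAlgebra.induction_linear with
  | zero => simp
  | add p q hp hq =>
    rw [add_mul, map_add, hp, hq, map_add]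
    ring
  | single e c =>
    induction H' using AddMonoidAlgebra.induction_linear with
    | zero => simp
    | add p q hp hq =>
      rw [mul_add, map_add, hp, hq, map_add]
      ring
    | single e' c' =>
      simp only [AddMonoidAlgebra.single_mul_single, derivXi_single, derivative_mul]
      rw [AddMonoidAlgebra.single_add]

lemma derivXi_laurent (a : LaurentPolynomial ℂ) : derivXi (laurentToPuiseux a) = 0 := by
  induction a using AddMonoidAlgebra.induction_linear with
  | zero => simp
  | add p q hp hq => rw [map_add, map_add, hp, hq, add_zero]
  | single e c =>
    rw [laurentToPuiseux_single, derivXi_single, derivative_C, AddMonoidAlgebra.single_zero]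

lemma derivXi_series (k : ℕ) :
    derivXi (D.series k) = AddMonoidAlgebra.single (D.expo k) 1 := by
  apply AddMonoidAlgebra.coeff_injective
  ext1 e
  rw [derivXi_coeff, series_coeff, AddMonoidAlgebra.coeff_single, Finsupp.single_apply]
  split_ifs <;> simp

/-- The chain rule: `ξ` enters only through the term `ξ x ^ expo k` of the series. -/
lemma derivXi_subst (k : ℕ) (f : LaurentXY) :
    derivXi (D.subst k f) =
      D.subst k (derivative f) * AddMonoidAlgebra.single (D.expo k) 1 := by
  induction f using Polynomial.induction_on with
  | C a => simp [derivXi_laurent]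
  | add p q hp hq => rw [map_add, map_add, hp, hq, derivative_add, map_add, add_mul]
  | monomial n a ih =>
    rw [pow_succ, ← mul_assoc, map_mul, derivXi_mul, ih, derivative_mul (f := C a * X ^ n),
      subst_X, derivXi_series, map_add, map_mul _ (derivative (C a * X ^ n)) X, subst_X,
      derivative_X, mul_one]
    ring

/-- If `∂f/∂y` has a constant top coefficient, then that of `f` is at most linear in `ξ`. -/
lemma natDegree_eq_one_of_derivative {k : ℕ} {f : LaurentXY} {v v' : ℚ} {c : ℂ[X]} {b : ℂ}
    (h : IsTop (D.subst k f) v c) (hc : c.natDegree ≠ 0)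
    (h' : IsTop (D.subst k (derivative f)) v' (C b)) (hb : b ≠ 0) : c.natDegree = 1 := by
  have h1 : IsTop (derivXi (D.subst k f)) v (derivative c) :=
    ⟨fun e he => by rw [derivXi_coeff, h.1 e he, derivative_zero], by rw [derivXi_coeff, h.2]⟩
  have h2 := h'.mul (IsTop.single (D.expo k) 1)
  rw [← derivXi_subst, mul_one] at h2
  -- Characteristic zero: the derivative of `c` survives as the top coefficient of the
  -- `ξ`-derivative, so it has to be the constant `b`.
  have hne : derivative c ≠ 0 := fun h0 => hc (derivative_eq_zero.1 h0)
  have h3 := (h1.unique h2 hne (by simpa using hb)).2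
  have h4 := congrArg natDegree h3
  rw [natDegree_derivative, natDegree_C] at h4
  lia

/-! ### A polynomial whose top coefficient involves `ξ` -/

/-- Its `N`-th power is a Laurent monomial. -/
lemma isIntegralElem_single {N : ℕ} (hN : 0 < N) (a : ℤ) (c : ℂ) :
    laurentToPuiseux.IsIntegralElem (AddMonoidAlgebra.single ((a : ℚ) / N) (C c)) := by
  let := laurentToPuiseux.toAlgebra
  refine IsIntegral.of_pow (R := LaurentPolynomial ℂ) (B := PuiseuxXi) (n := N) hN ?_
  rw [AddMonoidAlgebra.single_pow, nsmul_eq_mul,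
    mul_div_cancel₀ _ (by exact_mod_cast hN.ne' : (N : ℚ) ≠ 0), ← C_pow,
    ← laurentToPuiseux_single]
  exact laurentToPuiseux.isIntegralElem_map

/-- A monic polynomial that vanishes at `φ`, so that substituting the generic series gives a
multiple of `ξ`. -/
lemma exists_monic_vanishing : ∃ h : LaurentXY, h.Monic ∧
    ∀ e, ((D.subst (D.l + 1) h).coeff e).coeff 0 = 0 := by
  set φ' : PuiseuxXi := ∑ e ∈ D.φ.support, AddMonoidAlgebra.single e (C (D.φ e)) with hφ'
  have hintegral : laurentToPuiseux.IsIntegralElem φ' := by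
    obtain ⟨hN, hexp⟩ := D.polydromy.1
    let := laurentToPuiseux.toAlgebra
    refine IsIntegral.sum (R := LaurentPolynomial ℂ) (A := PuiseuxXi) _ fun e he => ?_
    obtain ⟨a, ha⟩ := hexp e he
    rw [ha]
    exact isIntegralElem_single hN a _
  obtain ⟨h, hmonic, hroot⟩ := hintegral
  refine ⟨h, hmonic, fun e => ?_⟩
  -- All exponents of `φ` exceed `r`, so nothing of `φ` is truncated in the last series and `ξ = 0`
  -- gives back `φ`.
  have hser : specialize 0 (D.series (D.l + 1)) = φ' := by
    have h1 : D.series (D.l + 1) = φ' + AddMonoidAlgebra.single (D.expo (D.l + 1)) X := by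
      apply AddMonoidAlgebra.coeff_injective
      ext1 e
      rw [series_coeff, AddMonoidAlgebra.coeff_add, hφ', AddMonoidAlgebra.coeff_sum,
        Finsupp.add_apply, Finsupp.finsetSum_apply, AddMonoidAlgebra.coeff_single,
        Finsupp.single_apply]
      congr 1
      simp only [AddMonoidAlgebra.coeff_single, Finsupp.single_apply]
      rw [Finset.sum_ite_eq' D.φ.support e]
      by_cases he : e ∈ D.φ.support
      · rw [if_pos he, if_pos]
        rw [D.expo_last]
        exact D.r_lt e he
      · rw [if_neg he, Finsupp.notMem_support_iff.1 he]
        simp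
    rw [h1, map_add, specialize_single, aeval_X, zero_mul, add_zero, hφ', map_sum]
    refine Finset.sum_congr rfl fun e _ => ?_
    rw [specialize_single, aeval_C, algebraMap_puiseux, AddMonoidAlgebra.single_mul_single]
    simp
  have hzero : specialize 0 (D.subst (D.l + 1) h) = 0 := by
    have : (specialize 0).comp (D.subst (D.l + 1)) = eval₂RingHom laurentToPuiseux φ' := by
      refine Polynomial.ringHom_ext (fun a => ?_) ?_
      · simp [specialize_laurent]
      · simp [hser]
    have h2 := RingHom.congr_fun this h
    rw [RingHom.comp_apply, coe_eval₂RingHom, hroot] at h2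
    exact h2
  have hcoeff : ∀ H : PuiseuxXi, (specialize 0 H).coeff e = C ((H.coeff e).coeff 0) := by
    intro H
    induction H using AddMonoidAlgebra.induction_linear with
    | zero => simp
    | add p q hp hq => simp [hp, hq]
    | single e' c =>
      rw [specialize_single, ← coeff_zero_eq_aeval_zero', algebraMap_puiseux,
        AddMonoidAlgebra.single_mul_single]
      simp only [zero_add, mul_one, AddMonoidAlgebra.coeff_single, Finsupp.single_apply]
      split_ifs <;> simp
  have h3 := hcoeff (D.subst (D.l + 1) h)
  rw [hzero] at h3
  exact (C_eq_zero.1 (by simpa using h3.symm))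

end GenericPuiseux

end

section


/-! ### Mixed radix expansions -/

/-- The place values `a 1 ⋯ a (j - 1)` of the mixed radix system with digits below `a 1, a 2, …`. -/
def radix (a : ℕ → ℕ) (j : ℕ) : ℕ := ∏ i ∈ Finset.Ico 1 j, a i

lemma radix_succ (a : ℕ → ℕ) {j : ℕ} (hj : 1 ≤ j) : radix a (j + 1) = radix a j * a j := by
  rw [radix, Finset.prod_Ico_succ_top hj, radix]

lemma sum_mul_radix_lt {a b : ℕ → ℕ} {j : ℕ} (h : ∀ i, 1 ≤ i → i < j → b i < a i) :
    ∑ i ∈ Finset.Ico 1 j, b i * radix a i < radix a j := by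
  induction j with
  | zero => simp [radix]
  | succ j ih =>
    rcases Nat.eq_zero_or_pos j with rfl | hj
    · simp [radix]
    · rw [Finset.sum_Ico_succ_top hj, radix_succ a hj]
      have h1 := ih fun i h1 h2 => h i h1 (by lia)
      have h2 := h j hj (by lia)
      nlinarith

lemma sum_mul_radix_injective {a b b' : ℕ → ℕ} {j : ℕ} (h : ∀ i, 1 ≤ i → i < j → b i < a i)
    (h' : ∀ i, 1 ≤ i → i < j → b' i < a i)
    (heq : ∑ i ∈ Finset.Ico 1 j, b i * radix a i = ∑ i ∈ Finset.Ico 1 j, b' i * radix a i) :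
    ∀ i, 1 ≤ i → i < j → b i = b' i := by
  induction j with
  | zero => intro i _ hi; lia
  | succ j ih =>
    rcases Nat.eq_zero_or_pos j with rfl | hj
    · intro i _ hi; lia
    · have h1 := sum_mul_radix_lt (j := j) fun i h1 h2 => h i h1 (by lia)
      have h1' := sum_mul_radix_lt (j := j) fun i h1 h2 => h' i h1 (by lia)
      rw [Finset.sum_Ico_succ_top hj, Finset.sum_Ico_succ_top hj] at heq
      have hbj : b j = b' j := by
        rcases lt_trichotomy (b j) (b' j) with hlt | h0 | hlt
        · have := Nat.mul_le_mul_right (radix a j) hlt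
          rw [Nat.succ_mul] at this
          lia
        · exact h0
        · have := Nat.mul_le_mul_right (radix a j) hlt
          rw [Nat.succ_mul] at this
          lia
      have hrest := ih (fun i h1 h2 => h i h1 (by lia)) (fun i h1 h2 => h' i h1 (by lia))
        (by rw [hbj] at heq; exact Nat.add_right_cancel heq)
      intro i hi1 hi2
      rcases Nat.lt_or_ge i j with hlt | hge
      · exact hrest i hi1 hlt
      · obtain rfl : i = j := by lia
        exact hbj

/-! ### Constant top coefficients -/

lemma exists_isTop_laurentToPuiseux {a : LaurentPolynomial ℂ} (ha : a ≠ 0) :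
    ∃ (d : ℤ) (b : ℂ), b ≠ 0 ∧ IsTop (laurentToPuiseux a) d (C b) := by
  have hs : a.coeff.support.Nonempty := by
    rw [Finset.nonempty_iff_ne_empty]
    intro h
    exact ha (AddMonoidAlgebra.coeff_eq_zero.1 (Finsupp.support_eq_empty.1 h))
  obtain ⟨d, hd, hmax⟩ := a.coeff.support.exists_max_image id hs
  refine ⟨d, a.coeff d, Finsupp.mem_support_iff.1 hd, ?_⟩
  have hexp : a = ∑ e ∈ a.coeff.support, AddMonoidAlgebra.single e (a.coeff e) := by
    apply AddMonoidAlgebra.coeff_injective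
    rw [AddMonoidAlgebra.coeff_sum]
    exact (Finsupp.sum_single _).symm
  have hterm : ∀ e ∈ a.coeff.support,
      IsTop (laurentToPuiseux (AddMonoidAlgebra.single e (a.coeff e))) d
        (if e = d then C (a.coeff d) else 0) := by
    intro e he
    rw [laurentToPuiseux_single]
    split_ifs with hed
    · rw [hed]
      exact IsTop.single _ _
    · refine (IsTop.single _ _).raise ?_
      exact_mod_cast lt_of_le_of_ne (hmax e he) hed
  have hsum := IsTop.sum _ hterm
  rwa [← map_sum, ← hexp, Finset.sum_ite_eq' a.coeff.support d, if_pos hd] at hsum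

namespace GenericPuiseux

variable (D : GenericPuiseux)

/-- The top coefficient of `f` for `δ_k` is a nonzero constant, at the exponent `v`. -/
def ConstTop (k : ℕ) (f : LaurentXY) (v : ℚ) : Prop :=
  ∃ a : ℂ, a ≠ 0 ∧ IsTop (D.subst k f) v (C a)

variable {D}

lemma ConstTop.mul {k : ℕ} {f f' : LaurentXY} {v v' : ℚ} (h : D.ConstTop k f v)
    (h' : D.ConstTop k f' v') : D.ConstTop k (f * f') (v + v') := by
  obtain ⟨a, ha, h⟩ := h
  obtain ⟨a', ha', h'⟩ := h'
  exact ⟨a * a', mul_ne_zero ha ha', by simpa using h.mul h'⟩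

lemma ConstTop.pow {k : ℕ} {f : LaurentXY} {v : ℚ} (h : D.ConstTop k f v) (n : ℕ) :
    D.ConstTop k (f ^ n) (n * v) := by
  obtain ⟨a, ha, h⟩ := h
  exact ⟨a ^ n, pow_ne_zero n ha, by simpa using h.pow n⟩

lemma ConstTop.smul {k : ℕ} {f : LaurentXY} {v : ℚ} (h : D.ConstTop k f v) {b : ℂ} (hb : b ≠ 0) :
    D.ConstTop k (b • f) v := by
  obtain ⟨a, ha, h⟩ := h
  exact ⟨b * a, mul_ne_zero hb ha, by simpa using D.isTop_smul b h⟩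

lemma constTop_T (k : ℕ) (a : ℤ) : D.ConstTop k (C (LaurentPolynomial.T a)) a :=
  ⟨1, one_ne_zero, by simpa using D.isTop_subst_T k a⟩

lemma ConstTop.prod {ι : Type*} {k : ℕ} (s : Finset ι) {f : ι → LaurentXY} {v : ι → ℚ}
    (h : ∀ i ∈ s, D.ConstTop k (f i) (v i)) :
    D.ConstTop k (∏ i ∈ s, f i) (∑ i ∈ s, v i) := by
  classical
  induction s using Finset.induction_on with
  | empty => simpa using constTop_T (D := D) k 0
  | insert a s ha ih =>
    rw [Finset.prod_insert ha, Finset.sum_insert ha]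
    exact (h a (by simp)).mul (ih fun i hi => h i (by simp [hi]))

lemma ConstTop.add_of_lt {k : ℕ} {f f' : LaurentXY} {v v' : ℚ} (h : D.ConstTop k f v)
    (h' : D.ConstTop k f' v') (hv : v' < v) : D.ConstTop k (f + f') v := by
  obtain ⟨a, ha, h⟩ := h
  obtain ⟨a', ha', h'⟩ := h'
  exact ⟨a, ha, by simpa using h.add (h'.raise hv)⟩

lemma ConstTop.unique {k : ℕ} {f : LaurentXY} {v v' : ℚ} {c : ℂ[X]} (h : D.ConstTop k f v)
    (h' : IsTop (D.subst k f) v' c) (hc : c ≠ 0) : v = v' := by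
  obtain ⟨a, ha, h⟩ := h
  exact (h.unique h' (by simpa using ha) hc).1

lemma ConstTop.persist {k k' : ℕ} (hk1 : 1 ≤ k) (hkk' : k ≤ k') (hk' : k' ≤ D.l + 1)
    {f : LaurentXY} {v : ℚ} (h : D.ConstTop k f v) : D.ConstTop k' f v := by
  rcases hkk'.lt_or_eq with hlt | rfl
  · obtain ⟨a, ha, h⟩ := h
    exact ⟨a, ha, by simpa using D.isTop_persist hk1 hlt hk' h⟩
  · exact h

/-- The case `m = 0` of the congruence between exponents of `x` and `ξ`. -/
lemma ConstTop.mem_fracGroup {k : ℕ} (hk : k + 1 ≤ D.l + 1) {f : LaurentXY} {v : ℚ}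
    (h : D.ConstTop (k + 1) f v) : v ∈ fracGroup (D.P k) := by
  obtain ⟨a, ha, h⟩ := h
  have := D.isGraded_subst hk f v 0 (by rw [h.2]; simpa using ha)
  simpa using this

end GenericPuiseux

/-! ### Top terms of the key forms -/

namespace KeyForms

variable {D : GenericPuiseux} (K : KeyForms D.fullSemidegree)

/-- The degree in `x` of the key form `g j` after substitution of the generic series. -/
def u (j : ℕ) : ℚ := K.ω j / D.P (D.l + 1)

/-- The monomial in the key forms that is subtracted at step `j`. -/
def stepTerm (j : ℕ) : LaurentXY :=
  K.θ j • (C (LaurentPolynomial.T (K.β₀ j)) * ∏ i ∈ Finset.Ico 1 j, K.g i ^ K.β j i)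

lemma g_succ' {j : ℕ} (h1 : 1 ≤ j) (h2 : j ≤ K.n) :
    K.g (j + 1) = K.g j ^ K.α j - K.stepTerm j := K.g_succ j h1 h2

lemma exists_top {j : ℕ} (hj : j ≤ K.n + 1) :
    ∃ c, c ≠ 0 ∧ IsTop (D.subst (D.l + 1) (K.g j)) (K.u j) c :=
  D.isTop_of_semidegree_eq le_rfl (K.ω_eq j hj)

lemma constTop_zero (k : ℕ) : D.ConstTop k (K.g 0) 1 := by
  rw [K.g_zero]
  simpa using GenericPuiseux.constTop_T (D := D) k 1

lemma u_zero : K.u 0 = 1 := by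
  obtain ⟨c, hc, h⟩ := K.exists_top (Nat.zero_le _)
  exact ((K.constTop_zero (D.l + 1)).unique h hc).symm

lemma ω_eq_mul_u (j : ℕ) : K.ω j = D.P (D.l + 1) * K.u j := by
  rw [u, mul_div_cancel₀ _ (D.P_pos_rat le_rfl).ne']

lemma u_rel {j : ℕ} (h1 : 1 ≤ j) (h2 : j ≤ K.n) :
    (K.α j : ℚ) * K.u j = K.β₀ j + ∑ i ∈ Finset.Ico 1 j, (K.β j i : ℚ) * K.u i := by
  have h := K.ω_rel j h1 h2
  have hP := (D.P_pos_rat (le_refl (D.l + 1))).ne'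
  simp only [ω_eq_mul_u, u_zero] at h
  apply mul_left_cancel₀ hP
  rw [mul_add, Finset.mul_sum]
  calc _ = (K.α j : ℚ) * (D.P (D.l + 1) * K.u j) := by ring
    _ = _ := h
    _ = _ := by
      congr 1
      · ring
      · exact Finset.sum_congr rfl fun i _ => by ring

lemma u_lt {j : ℕ} (h1 : 1 ≤ j) (h2 : j ≤ K.n) : K.u (j + 1) < K.α j * K.u j := by
  have h := K.ω_lt j h1 h2
  simp only [ω_eq_mul_u] at h
  have hP := D.P_pos_rat (le_refl (D.l + 1))
  refine lt_of_mul_lt_mul_left (a := (D.P (D.l + 1) : ℚ)) ?_ hP.le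
  linarith

/-- The group generated by the degrees of `g 0, …, g (j - 1)`. -/
def valueGroup (j : ℕ) : AddSubgroup ℚ := AddSubgroup.closure (K.u '' Set.Iio j)

lemma u_mem_valueGroup {i j : ℕ} (h : i < j) : K.u i ∈ K.valueGroup j :=
  AddSubgroup.subset_closure ⟨i, h, rfl⟩

lemma valueGroup_mono {i j : ℕ} (h : i ≤ j) : K.valueGroup i ≤ K.valueGroup j :=
  AddSubgroup.closure_mono (Set.image_mono (Set.Iio_subset_Iio h))

lemma mul_ω_mem_iff (a : ℚ) (i j : ℕ) :
    a * K.ω i ∈ AddSubgroup.closure (K.ω '' Set.Iio j) ↔ a * K.u i ∈ K.valueGroup j := by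
  have hP := (D.P_pos_rat (le_refl (D.l + 1))).ne'
  have hmap : AddSubgroup.closure (K.ω '' Set.Iio j) =
      (K.valueGroup j).map (AddMonoidHom.mulLeft (D.P (D.l + 1) : ℚ)) := by
    rw [valueGroup, AddMonoidHom.map_closure, Set.image_image]
    congr 1
    exact Set.image_congr fun i _ => K.ω_eq_mul_u i
  rw [hmap, AddSubgroup.mem_map]
  constructor
  · rintro ⟨x, hx, he⟩
    have : x = a * K.u i := by
      apply mul_left_cancel₀ hP
      rw [ω_eq_mul_u] at he
      simp only [AddMonoidHom.coe_mulLeft] at he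
      rw [he]
      ring
    rwa [← this]
  · intro h
    refine ⟨_, h, ?_⟩
    simp only [AddMonoidHom.coe_mulLeft]
    rw [ω_eq_mul_u]
    ring

lemma α_isLeast {j : ℕ} (h1 : 1 ≤ j) (h2 : j ≤ K.n) :
    IsLeast {a : ℕ | 0 < a ∧ (a : ℚ) * K.u j ∈ K.valueGroup j} (K.α j) := by
  have h := K.α_min j h1 h2
  simp only [mul_ω_mem_iff] at h
  exact h

lemma α_pos {j : ℕ} (h1 : 1 ≤ j) (h2 : j ≤ K.n) : 0 < K.α j := (K.α_isLeast h1 h2).1.1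

lemma constTop_stepTerm {k j : ℕ} (h1 : 1 ≤ j) (h2 : j ≤ K.n)
    (h : ∀ i, i < j → D.ConstTop k (K.g i) (K.u i)) :
    D.ConstTop k (K.stepTerm j) (K.α j * K.u j) := by
  rw [K.u_rel h1 h2]
  refine ((GenericPuiseux.constTop_T k _).mul (GenericPuiseux.ConstTop.prod _ fun i hi => ?_)).smul
    (K.θ_ne j h1 h2)
  exact (h i (Finset.mem_Ico.1 hi).2).pow _

/-- By induction the subtracted monomial has a constant top coefficient. The strict drop of degree
at the next key form makes it cancel `c ^ α j`, so `c` has degree `0` in `ξ`. -/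
lemma constTop_last {j : ℕ} (hj : j ≤ K.n) : D.ConstTop (D.l + 1) (K.g j) (K.u j) := by
  induction j using Nat.strong_induction_on with
  | _ j ih =>
    rcases Nat.eq_zero_or_pos j with rfl | h1
    · rw [u_zero]
      exact K.constTop_zero _
    · obtain ⟨c, hc, htop⟩ := K.exists_top (j := j) (by lia)
      obtain ⟨c', -, htop'⟩ := K.exists_top (j := j + 1) (by lia)
      obtain ⟨b, hb, hstep⟩ := K.constTop_stepTerm h1 hj fun i hi => ih i hi (by lia)
      have hsub := (htop.pow (K.α j)).sub hstep
      rw [← map_pow, ← map_sub, ← K.g_succ' h1 hj] at hsub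
      have h0 : c ^ K.α j - C b = 0 := by
        rw [← hsub.2, (htop'.raise (K.u_lt h1 hj)).2]
      have hdeg := congrArg natDegree (sub_eq_zero.1 h0)
      rw [natDegree_pow, natDegree_C] at hdeg
      have hc0 : c.natDegree = 0 :=
        (Nat.mul_eq_zero.1 hdeg).resolve_left (K.α_pos h1 hj).ne'
      obtain ⟨a, rfl⟩ := natDegree_eq_zero.1 hc0
      exact ⟨a, by simpa using hc, htop⟩

lemma le_weightedDegB {N : ℕ} {w : ℕ → ℚ} {G : MvPolynomial (Fin N) (LaurentPolynomial ℂ)}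
    {m : Fin N →₀ ℕ} {a : ℤ} (ha : (MvPolynomial.coeff m G).coeff a ≠ 0) :
    (((a : ℚ) * w 0 + ∑ i, (m i : ℚ) * w (i.val + 1) : ℚ) : WithBot ℚ) ≤ weightedDegB w G := by
  have hm : m ∈ G.support := by
    rw [MvPolynomial.mem_support_iff]
    intro h0
    simp [h0] at ha
  unfold weightedDegB
  refine le_trans ?_ (Finset.le_sup hm)
  exact Finset.le_sup (f := fun a : ℤ =>
    (((a : ℚ) * w 0 + ∑ i, (m i : ℚ) * w (i.val + 1) : ℚ) : WithBot ℚ))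
    (Finsupp.mem_support_iff.2 ha)

/-- Apply the generating property of the key forms to a monic `h` vanishing at `φ`. An expression of
weighted degree `δ(h)` would have a constant top coefficient, while all coefficients of the
substituted `h` are multiples of `ξ`. -/
lemma not_constTop_last : ¬ D.ConstTop (D.l + 1) (K.g (K.n + 1)) (K.u (K.n + 1)) := by
  intro hlast
  have hall : ∀ j ≤ K.n + 1, D.ConstTop (D.l + 1) (K.g j) (K.u j) := fun j hj => by
    rcases hj.lt_or_eq with h | rfl
    · exact K.constTop_last (by lia)
    · exact hlast
  obtain ⟨h, hmonic, hvan⟩ := D.exists_monic_vanishing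
  obtain ⟨G, hG, hδ⟩ := (K.generating h hmonic.ne_zero).1
  have hGne : G ≠ 0 := by
    rintro rfl
    exact hmonic.ne_zero (by simpa using hG.symm)
  obtain ⟨w, hw⟩ : ∃ w : ℚ, weightedDegB K.ω G = (w : WithBot ℚ) := by
    simp only [eq_comm (b := ((_ : ℚ) : WithBot ℚ))]
    rw [← WithBot.ne_bot_iff_exists]
    obtain ⟨m, hm⟩ := MvPolynomial.ne_zero_iff.1 hGne
    obtain ⟨a, ha⟩ : ∃ a, (MvPolynomial.coeff m G).coeff a ≠ 0 := by
      by_contra hall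
      push Not at hall
      exact hm (AddMonoidAlgebra.coeff_eq_zero.1 (Finsupp.ext hall))
    exact ((WithBot.bot_lt_coe _).trans_le (le_weightedDegB ha)).ne'
  rw [hw] at hδ
  obtain ⟨c, hc, htop⟩ := D.isTop_of_semidegree_eq le_rfl hδ.symm
  have hP := D.P_pos_rat (le_refl (D.l + 1))
  -- Each term of `G` has weighted degree at most `w`, so at this exponent it contributes a constant
  -- or nothing.
  have hconst : ∃ b : ℂ, (D.subst (D.l + 1) h).coeff (w / D.P (D.l + 1)) = C b := by
    have hmem : (D.subst (D.l + 1) h).coeff (w / D.P (D.l + 1)) ∈ (C : ℂ →+* ℂ[X]).range := by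
      rw [← hG, MvPolynomial.aeval_def, MvPolynomial.eval₂_eq, map_sum,
        AddMonoidAlgebra.coeff_sum, Finsupp.finsetSum_apply]
      refine sum_mem fun m _ => ?_
      have hexp : MvPolynomial.coeff m G = ∑ a ∈ (MvPolynomial.coeff m G).coeff.support,
          AddMonoidAlgebra.single a ((MvPolynomial.coeff m G).coeff a) := by
        apply AddMonoidAlgebra.coeff_injective
        rw [AddMonoidAlgebra.coeff_sum]
        exact (Finsupp.sum_single _).symm
      rw [hexp, map_sum, Finset.sum_mul, map_sum, AddMonoidAlgebra.coeff_sum,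
        Finsupp.finsetSum_apply]
      refine sum_mem fun a ha => ?_
      have ha' := Finsupp.mem_support_iff.1 ha
      have hle := le_weightedDegB (w := K.ω) ha'
      rw [hw, WithBot.coe_le_coe] at hle
      have hterm : D.ConstTop (D.l + 1) ((algebraMap (LaurentPolynomial ℂ) LaurentXY)
          (AddMonoidAlgebra.single a ((MvPolynomial.coeff m G).coeff a)) *
            ∏ i ∈ m.support, K.g (i.val + 1) ^ m i)
          (a + ∑ i ∈ m.support, (m i : ℚ) * K.u (i.val + 1)) := by
        refine GenericPuiseux.ConstTop.mul ⟨_, ha', ?_⟩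
          (GenericPuiseux.ConstTop.prod _ fun i _ => (hall _ (by have := i.2; lia)).pow _)
        rw [Polynomial.algebraMap_eq, D.subst_C, laurentToPuiseux_single]
        exact IsTop.single _ _
      obtain ⟨b, -, hb⟩ := hterm
      have hv : (a : ℚ) + ∑ i ∈ m.support, (m i : ℚ) * K.u (i.val + 1) =
          ((a : ℚ) * K.ω 0 + ∑ i, (m i : ℚ) * K.ω (i.val + 1)) / D.P (D.l + 1) := by
        rw [eq_div_iff hP.ne', add_mul, Finset.sum_mul, K.ω_eq_mul_u 0, K.u_zero, mul_one]
        congr 1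
        rw [Finset.sum_subset (Finset.subset_univ m.support)]
        · exact Finset.sum_congr rfl fun i _ => by rw [K.ω_eq_mul_u]; ring
        · intro i _ hi
          rw [Finsupp.notMem_support_iff.1 hi]
          simp
      have hle' : (a : ℚ) + ∑ i ∈ m.support, (m i : ℚ) * K.u (i.val + 1) ≤
          w / D.P (D.l + 1) := by
        rw [hv]
        gcongr
      rcases hle'.lt_or_eq with hlt | heq
      · rw [hb.1 _ hlt]
        exact zero_mem _
      · rw [← heq, hb.2]
        exact ⟨b, rfl⟩
    obtain ⟨b, hb⟩ := hmem
    exact ⟨b, hb.symm⟩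
  obtain ⟨b, hb⟩ := hconst
  have h0 := hvan (w / D.P (D.l + 1))
  rw [hb, coeff_C_zero] at h0
  apply hc
  rw [← htop.2, hb, h0, C_0]

/-! ### The degrees in `y` of the key forms -/

lemma radix_α_pos {j : ℕ} (hj : j ≤ K.n + 1) : 0 < radix K.α j :=
  Finset.prod_pos fun i hi => by
    rw [Finset.mem_Ico] at hi
    exact K.α_pos hi.1 (by lia)

/-- The bounds `β j i < α i` are those of mixed radix digits, so the subtracted monomial has smaller
`y`-degree than `g j` itself. -/
lemma g_monic_natDegree {j : ℕ} (h1 : 1 ≤ j) (hj : j ≤ K.n + 1) :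
    (K.g j).Monic ∧ (K.g j).natDegree = radix K.α j := by
  induction j using Nat.strong_induction_on with
  | _ j ih =>
    rcases h1.lt_or_eq with hlt | rfl
    · obtain ⟨j, rfl⟩ : ∃ i, j = i + 1 := ⟨j - 1, by lia⟩
      obtain ⟨hmon, hdeg⟩ := ih j (by lia) (by lia) (by lia)
      have hpos := K.α_pos (j := j) (by lia) (by lia)
      have hmonic : (K.g j ^ K.α j).Monic := hmon.pow _
      have hdegpow : (K.g j ^ K.α j).natDegree = radix K.α (j + 1) := by
        rw [hmon.natDegree_pow, hdeg, radix_succ _ (by lia), mul_comm]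
      have hstep : (K.stepTerm j).natDegree < radix K.α j := by
        refine lt_of_le_of_lt ?_ (sum_mul_radix_lt (a := K.α) (b := K.β j)
          fun i h1 h2 => K.β_lt j i h1 h2 (by lia))
        refine (natDegree_smul_le _ _).trans (natDegree_C_mul_le _ _ |>.trans ?_)
        refine (natDegree_prod_le _ _).trans (Finset.sum_le_sum fun i hi => ?_)
        rw [Finset.mem_Ico] at hi
        rw [← (ih i (by lia) hi.1 (by lia)).2]
        exact natDegree_pow_le
      have hlt' : (K.stepTerm j).degree < (K.g j ^ K.α j).degree := by
        refine degree_lt_degree (hstep.trans_le ?_)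
        rw [hdegpow, radix_succ _ (by lia)]
        exact Nat.le_mul_of_pos_right _ hpos
      rw [K.g_succ' (by lia) (by lia)]
      exact ⟨hmonic.sub_of_left hlt', by
        rw [natDegree_eq_of_degree_eq (degree_sub_eq_left_of_degree_lt hlt'), hdegpow]⟩
    · rw [K.g_one]
      exact ⟨monic_X, by simp [radix]⟩

/-- Polynomials of smaller degree in `y` than `g J` have constant top coefficients if the key forms
before `g J` have. -/
lemma exists_constTop_of_natDegree_lt {k J : ℕ} (hJ1 : 1 ≤ J) (hJ : J ≤ K.n + 1)
    (hconst : ∀ j, j < J → D.ConstTop k (K.g j) (K.u j)) {h : LaurentXY} (hne : h ≠ 0)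
    (hdeg : h.natDegree < radix K.α J) : ∃ v ∈ K.valueGroup J, D.ConstTop k h v := by
  induction J, hJ1 using Nat.le_induction generalizing h with
  | base =>
    have h0 : h.natDegree = 0 := by simpa [radix] using hdeg
    obtain ⟨a, rfl⟩ := natDegree_eq_zero.1 h0
    have ha : a ≠ 0 := by simpa using hne
    obtain ⟨d, b, hb, htop⟩ := exists_isTop_laurentToPuiseux ha
    refine ⟨d, ?_, b, hb, by rwa [D.subst_C]⟩
    have h1 := K.u_mem_valueGroup zero_lt_one
    rw [u_zero] at h1
    simpa using zsmul_mem h1 d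
  | succ J hJ1 ih =>
    obtain ⟨hmon, hg⟩ := K.g_monic_natDegree hJ1 (by lia)
    have hrpos := K.radix_α_pos (j := J) (by lia)
    have hg1 : K.g J ≠ 1 := fun h1 => by simp [h1] at hg; lia
    -- Induction along the `g J`-adic expansion, of length `m`. The degrees of its terms lie in the
    -- classes of `i * u J`, `i < α J`, modulo `valueGroup J`; these are distinct, so the terms
    -- cannot cancel.
    have key : ∀ m ≤ K.α J, ∀ h : LaurentXY, h ≠ 0 → h.natDegree < m * radix K.α J →
        ∃ i < m, ∃ v ∈ K.valueGroup J, D.ConstTop k h (v + i * K.u J) := by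
      intro m
      induction m with
      | zero => intro _ h _ hlt; simp at hlt
      | succ m ihm =>
        intro hm h hne hlt
        have hdiv := modByMonic_add_div h (K.g J)
        have hr : h %ₘ K.g J ≠ 0 →
            ∃ v ∈ K.valueGroup J, D.ConstTop k (h %ₘ K.g J) v := fun h0 =>
          ih (by lia) (fun j hj => hconst j (by lia)) h0
            (by rw [← hg]; exact natDegree_modByMonic_lt _ hmon hg1)
        by_cases hq0 : h /ₘ K.g J = 0
        · rw [hq0, mul_zero, add_zero] at hdiv
          rw [hdiv] at hr
          obtain ⟨v, hv, hc⟩ := hr hne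
          exact ⟨0, by lia, v, hv, by simpa using hc⟩
        · have hqdeg : (h /ₘ K.g J).natDegree < m * radix K.α J := by
            have hle : radix K.α J ≤ h.natDegree := by
              by_contra hcon
              exact hq0 ((divByMonic_eq_zero_iff hmon).2
                (degree_lt_degree (by rw [hg]; lia)))
            rw [natDegree_divByMonic _ hmon, hg]
            rw [add_mul, one_mul] at hlt
            lia
          obtain ⟨i, hi, v, hv, hcq⟩ := ihm (by lia) _ hq0 hqdeg
          have hcq' : D.ConstTop k (K.g J * (h /ₘ K.g J)) (v + (i + 1 : ℕ) * K.u J) := by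
            convert (hconst J (by lia)).mul hcq using 1
            push_cast
            ring
          by_cases hr0 : h %ₘ K.g J = 0
          · rw [hr0, zero_add] at hdiv
            exact ⟨i + 1, by lia, v, hv, by rwa [hdiv] at hcq'⟩
          · obtain ⟨v', hv', hcr⟩ := hr hr0
            rcases lt_trichotomy v' (v + (i + 1 : ℕ) * K.u J) with hlt' | heq | hlt'
            · refine ⟨i + 1, by lia, v, hv, ?_⟩
              rw [← hdiv, add_comm]
              exact hcq'.add_of_lt hcr hlt'
            -- Equal degrees would contradict the minimality of `α J`, as `0 < i + 1 < α J`.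
            · have hmem : ((i + 1 : ℕ) : ℚ) * K.u J ∈ K.valueGroup J := by
                have := (K.valueGroup J).sub_mem hv' hv
                rwa [heq, add_sub_cancel_left] at this
              have := (K.α_isLeast hJ1 (by lia)).2 ⟨Nat.succ_pos i, hmem⟩
              lia
            · refine ⟨0, by lia, v', hv', ?_⟩
              rw [← hdiv]
              simpa using hcr.add_of_lt hcq' hlt'
    obtain ⟨i, -, v, hv, hc⟩ := key (K.α J) le_rfl h hne
      (by rwa [radix_succ _ hJ1, mul_comm] at hdeg)
    refine ⟨_, add_mem (K.valueGroup_mono (Nat.le_succ J) hv) ?_, hc⟩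
    rw [← nsmul_eq_mul]
    exact nsmul_mem (K.u_mem_valueGroup (Nat.lt_succ_self J)) i

end KeyForms

end

section


/-! ### The positions of the essential key forms -/

namespace KeyForms

variable {D : GenericPuiseux} (K : KeyForms D.fullSemidegree)

/-- The first key form whose top coefficient for `δ_k` involves `ξ`; `0` for `k = 0`. -/
def idx (k : ℕ) : ℕ :=
  if k = 0 then 0 else sInf {j | ¬ D.ConstTop k (K.g j) (K.u j)}

lemma idx_zero : K.idx 0 = 0 := rfl

lemma idx_of_pos {k : ℕ} (hk1 : 1 ≤ k) :
    K.idx k = sInf {j | ¬ D.ConstTop k (K.g j) (K.u j)} := if_neg (by lia)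

lemma not_constTop_succ_n {k : ℕ} (hk1 : 1 ≤ k) (hk : k ≤ D.l + 1) :
    ¬ D.ConstTop k (K.g (K.n + 1)) (K.u (K.n + 1)) := fun h =>
  K.not_constTop_last (h.persist hk1 hk le_rfl)

lemma idx_le {k : ℕ} (hk : k ≤ D.l + 1) : K.idx k ≤ K.n + 1 := by
  rcases Nat.eq_zero_or_pos k with rfl | hk1
  · simp [idx_zero]
  · rw [K.idx_of_pos hk1]
    exact Nat.sInf_le (K.not_constTop_succ_n hk1 hk)

lemma not_constTop_idx {k : ℕ} (hk1 : 1 ≤ k) (hk : k ≤ D.l + 1) :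
    ¬ D.ConstTop k (K.g (K.idx k)) (K.u (K.idx k)) := by
  have h := Nat.sInf_mem (s := {j | ¬ D.ConstTop k (K.g j) (K.u j)})
    ⟨_, K.not_constTop_succ_n hk1 hk⟩
  rw [← K.idx_of_pos hk1] at h
  exact h

lemma constTop_of_lt_idx {k j : ℕ} (hk1 : 1 ≤ k) (hj : j < K.idx k) :
    D.ConstTop k (K.g j) (K.u j) := by
  rw [K.idx_of_pos hk1] at hj
  by_contra h
  exact Nat.notMem_of_lt_sInf hj h

lemma one_le_idx {k : ℕ} (hk1 : 1 ≤ k) (hk : k ≤ D.l + 1) : 1 ≤ K.idx k := by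
  by_contra h
  have h0 : K.idx k = 0 := by lia
  apply K.not_constTop_idx hk1 hk
  rw [h0, K.u_zero]
  exact K.constTop_zero k

lemma idx_last : K.idx (D.l + 1) = K.n + 1 := by
  refine le_antisymm (K.idx_le le_rfl) ?_
  by_contra h
  exact K.not_constTop_idx (by lia) le_rfl (K.constTop_last (by lia))

/-- The top coefficient for `δ_k` of the `k`-th essential key form is linear in `ξ`. -/
lemma exists_linear_top {k : ℕ} (hk1 : 1 ≤ k) (hk : k ≤ D.l + 1) :
    ∃ V c, IsTop (D.subst k (K.g (K.idx k))) V c ∧ c.natDegree = 1 := by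
  have hI1 := K.one_le_idx hk1 hk
  have hIn := K.idx_le hk
  obtain ⟨c₁, hc₁, htop₁⟩ := K.exists_top hIn
  have hne : D.subst k (K.g (K.idx k)) ≠ 0 := by
    intro h0
    rcases hk.lt_or_eq with hlt | rfl
    · have := D.isTop_persist hk1 hlt le_rfl (h0 ▸ IsTop.zero (K.u (K.idx k)))
      rw [eval_zero, C_0] at this
      exact hc₁ (htop₁.2.symm.trans this.2)
    · rw [h0] at htop₁
      exact hc₁ (by simpa using htop₁.2.symm)
  obtain ⟨V, c, hc, htop⟩ := exists_isTop hne
  refine ⟨V, c, htop, ?_⟩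
  -- A constant would persist to `δ`, which identifies `V` with `u (idx k)` and contradicts the
  -- choice of `idx k`.
  have hnc : c.natDegree ≠ 0 := by
    intro h0
    obtain ⟨a, rfl⟩ := natDegree_eq_zero.1 h0
    have hct : D.ConstTop k (K.g (K.idx k)) V := ⟨a, by simpa using hc, htop⟩
    have hV := (hct.persist hk1 hk le_rfl).unique htop₁ hc₁
    exact K.not_constTop_idx hk1 hk (hV ▸ hct)
  obtain ⟨hmon, hdeg⟩ := K.g_monic_natDegree hI1 hIn
  have hdpos : (K.g (K.idx k)).natDegree ≠ 0 := by
    rw [hdeg]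
    exact (K.radix_α_pos hIn).ne'
  have hder : derivative (K.g (K.idx k)) ≠ 0 := by
    intro h0
    have h1 := congrArg (fun f => f.coeff ((K.g (K.idx k)).natDegree - 1)) h0
    simp only [coeff_derivative, coeff_zero] at h1
    rw [Nat.sub_add_cancel (Nat.pos_of_ne_zero hdpos), hmon.coeff_natDegree, one_mul] at h1
    have h2 : (((K.g (K.idx k)).natDegree : ℕ) : LaurentPolynomial ℂ) = 0 := by
      have h3 : (((K.g (K.idx k)).natDegree - 1 + 1 : ℕ) : LaurentPolynomial ℂ) = 0 := by
        exact_mod_cast h1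
      rwa [Nat.sub_add_cancel (Nat.pos_of_ne_zero hdpos)] at h3
    have h4 := congrArg (fun f : LaurentPolynomial ℂ => f.coeff 0) h2
    rw [← map_natCast LaurentPolynomial.C] at h4
    simp only [LaurentPolynomial.C_apply] at h4
    exact hdpos (by simpa using h4)
  -- The `y`-derivative has smaller `y`-degree, hence a constant top coefficient; this bounds the
  -- `ξ`-degree of `c`.
  obtain ⟨v, -, b, hb, hv⟩ := K.exists_constTop_of_natDegree_lt (k := k) hI1 hIn
    (fun j hj => K.constTop_of_lt_idx hk1 hj) hder
    (by rw [← hdeg]; exact natDegree_derivative_lt hdpos)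
  exact D.natDegree_eq_one_of_derivative htop hnc hv hb

/-- In the linear top coefficient `c₁ ξ + c₀`, a nonzero `c₀` would put `expo (k + 1)` into `(1 / P
k) ℤ`, impossible as `p (k + 1) ≥ 2`. So it is `c₁ ξ`, and its value at the nonzero coefficient of
`φ` does not vanish: later semidegrees see the same degree with a constant coefficient. -/
lemma u_idx_sub_mem_and_constTop {k : ℕ} (hk : k + 1 ≤ D.l) :
    K.u (K.idx (k + 1)) - D.expo (k + 1) ∈ fracGroup (D.P k) ∧
    ∀ k', k + 1 < k' → k' ≤ D.l + 1 →
      D.ConstTop k' (K.g (K.idx (k + 1))) (K.u (K.idx (k + 1))) := by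
  obtain ⟨V, c, htop, hdeg⟩ := K.exists_linear_top (k := k + 1) (by lia) (by lia)
  have hgr := D.isGraded_subst (k := k) (by lia) (K.g (K.idx (k + 1))) V
  rw [htop.2] at hgr
  have hc1 : c.coeff 1 ≠ 0 := by
    rw [← hdeg]
    exact leadingCoeff_ne_zero.2 fun h0 => by simp [h0] at hdeg
  have hV := hgr 1 hc1
  have hc0 : c.coeff 0 = 0 := by
    by_contra hne
    have h0 := hgr 0 hne
    have hmem : (1 : ℤ) * D.expo (k + 1) ∈ fracGroup (D.P k) := by
      have := (fracGroup (D.P k)).sub_mem h0 hV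
      simpa using this
    have hdvd := (D.mul_expo_mem_iff (k := k) (by lia) 1).1 hmem
    have h2 := D.two_le (k + 1) (by lia) hk
    have h3 := Int.le_of_dvd one_pos hdvd
    lia
  have hval : c.eval (D.φ (D.expo (k + 1))) ≠ 0 := by
    rw [eval_eq_sum_range, hdeg, Finset.sum_range_succ, Finset.sum_range_one, hc0]
    simpa using ⟨hc1, D.φ_expo_ne_zero hk⟩
  have hct : ∀ k', k + 1 < k' → k' ≤ D.l + 1 →
      D.ConstTop k' (K.g (K.idx (k + 1))) V := fun k' h h' =>
    ⟨_, hval, D.isTop_persist (by lia) h h' htop⟩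
  obtain ⟨c₁, hc₁, htop₁⟩ := K.exists_top (K.idx_le (k := k + 1) (by lia))
  obtain rfl := (hct (D.l + 1) (by lia) le_rfl).unique htop₁ hc₁
  exact ⟨by simpa using hV, hct⟩

/-- For `δ_{k+1}` the key forms up to and including `g (idx k)` have constant top coefficients. -/
lemma idx_lt_idx_succ {k : ℕ} (hk : k ≤ D.l) : K.idx k < K.idx (k + 1) := by
  rcases Nat.eq_zero_or_pos k with rfl | hk1
  · exact K.one_le_idx le_rfl (by lia)
  · by_contra hle
    apply K.not_constTop_idx (k := k + 1) (by lia) (by lia)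
    obtain ⟨k, rfl⟩ : ∃ m, k = m + 1 := ⟨k - 1, by lia⟩
    rcases (not_lt.1 hle).lt_or_eq with hlt | heq
    · exact (K.constTop_of_lt_idx hk1 hlt).persist hk1 (by lia) (by lia)
    · rw [heq]
      exact (K.u_idx_sub_mem_and_constTop hk).2 _ (by lia) (by lia)

lemma idx_lt_idx {k k' : ℕ} (h : k < k') (hk' : k' ≤ D.l + 1) : K.idx k < K.idx k' := by
  induction k', h using Nat.le_induction with
  | base => exact K.idx_lt_idx_succ (by lia)
  | succ m h ih => exact (ih (by lia)).trans (K.idx_lt_idx_succ (by lia))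

lemma idx_le_n {k : ℕ} (hk : k ≤ D.l) : K.idx k ≤ K.n := by
  have := K.idx_lt_idx_succ hk
  have := K.idx_le (k := k + 1) (by lia)
  lia

/-- The degree of `g (idx (k + 1))` contributes `expo (k + 1)` modulo the previous group, and a
Bézout relation for `q` and `p` then produces `1 / P (k + 1)`. -/
lemma fracGroup_le_valueGroup {k j : ℕ} (hk : k ≤ D.l) (hj : K.idx k < j) :
    fracGroup (D.P k) ≤ K.valueGroup j := by
  induction k generalizing j with
  | zero =>
    rw [fracGroup, AddSubgroup.zmultiples_le, D.P_zero, Nat.cast_one, div_one, ← K.u_zero]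
    exact K.u_mem_valueGroup (by lia)
  | succ k ih =>
    have h0 := ih (by lia) ((K.idx_lt_idx_succ (k := k) (by lia)).trans hj)
    have hexpo : D.expo (k + 1) ∈ K.valueGroup j := by
      have := (K.valueGroup j).sub_mem (K.u_mem_valueGroup hj)
        (h0 (K.u_idx_sub_mem_and_constTop hk).1)
      simpa using this
    obtain ⟨s, t, hst⟩ := D.coprime (k + 1) (by lia) (by lia)
    have hP := D.P_pos_rat (k := k) (by lia)
    have hp : (0 : ℚ) < D.p (k + 1) := by exact_mod_cast D.p_pos (j := k + 1) (by lia) (by lia)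
    have hst' : (s : ℚ) * D.q (k + 1) + t * D.p (k + 1) = 1 := by exact_mod_cast hst
    have heq : 1 / (D.P (k + 1) : ℚ) = s • D.expo (k + 1) + (t : ℚ) / D.P k := by
      rw [zsmul_eq_mul, GenericPuiseux.expo, D.P_succ]
      push_cast
      field_simp
      linarith
    rw [fracGroup, AddSubgroup.zmultiples_le, heq]
    exact add_mem (zsmul_mem hexpo s) (h0 (mem_fracGroup.2 ⟨t, rfl⟩))

lemma u_mem_fracGroup {k j : ℕ} (hk : k + 1 ≤ D.l + 1) (hj : j < K.idx (k + 1)) :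
    K.u j ∈ fracGroup (D.P k) :=
  (K.constTop_of_lt_idx (by lia) hj).mem_fracGroup hk

lemma valueGroup_idx {k : ℕ} (hk : k + 1 ≤ D.l + 1) :
    K.valueGroup (K.idx (k + 1)) = fracGroup (D.P k) := by
  refine le_antisymm ?_ (K.fracGroup_le_valueGroup (by lia) (K.idx_lt_idx_succ (by lia)))
  rw [valueGroup, AddSubgroup.closure_le]
  rintro _ ⟨j, hj, rfl⟩
  exact K.u_mem_fracGroup hk hj

lemma natCast_mul_u_idx_mem_iff {k : ℕ} (hk : k + 1 ≤ D.l) (a : ℤ) :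
    a * K.u (K.idx (k + 1)) ∈ fracGroup (D.P k) ↔ (D.p (k + 1) : ℤ) ∣ a := by
  rw [← D.mul_expo_mem_iff (by lia)]
  have h := zsmul_mem (K.u_idx_sub_mem_and_constTop hk).1 a
  rw [zsmul_eq_mul, mul_sub] at h
  constructor
  · intro h'
    have := sub_mem h' h
    simpa using this
  · intro h'
    have := add_mem h h'
    simpa using this

/-- The earlier degrees generate `(1 / P (k - 1)) ℤ`, and modulo it `u (idx k)` agrees with `expo
k`, which has order `p k`. -/
lemma α_idx {k : ℕ} (hk1 : 1 ≤ k) (hk : k ≤ D.l) : K.α (K.idx k) = D.p k := by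
  obtain ⟨k, rfl⟩ : ∃ m, k = m + 1 := ⟨k - 1, by lia⟩
  have h := K.α_isLeast (K.one_le_idx hk1 (by lia)) (K.idx_le_n hk)
  refine h.unique ⟨⟨D.p_pos hk1 (by lia), ?_⟩, ?_⟩
  · rw [K.valueGroup_idx (by lia)]
    exact_mod_cast (K.natCast_mul_u_idx_mem_iff hk (D.p (k + 1))).2 dvd_rfl
  · rintro a ⟨ha, hmem⟩
    rw [K.valueGroup_idx (by lia)] at hmem
    have := (K.natCast_mul_u_idx_mem_iff hk a).1 (by exact_mod_cast hmem)
    exact Nat.le_of_dvd ha (by exact_mod_cast this)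

/-- Before `idx (k + 1)` all degrees lie in `(1 / P k) ℤ`, which is already generated by those up to
`idx k`. -/
lemma α_eq_one {k j : ℕ} (hk : k ≤ D.l) (h1 : K.idx k < j) (h2 : j < K.idx (k + 1)) :
    K.α j = 1 := by
  have hn := K.idx_le (k := k + 1) (by lia)
  refine (K.α_isLeast (j := j) (by lia) (by lia)).unique ⟨⟨one_pos, ?_⟩, fun a ha => ha.1⟩
  rw [Nat.cast_one, one_mul]
  exact K.fracGroup_le_valueGroup hk h1 (K.u_mem_fracGroup (by lia) h2)

lemma exists_idx_le_lt {j : ℕ} (hj : j ≤ K.n) : ∃ k ≤ D.l, K.idx k ≤ j ∧ j < K.idx (k + 1) := by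
  have h : ∃ k, j < K.idx (k + 1) := ⟨D.l, by rw [K.idx_last]; lia⟩
  classical
  refine ⟨Nat.find h, Nat.find_min' h (by rw [K.idx_last]; lia), ?_, Nat.find_spec h⟩
  rcases Nat.eq_zero_or_pos (Nat.find h) with h0 | h0
  · rw [h0, idx_zero]
    exact Nat.zero_le j
  · have := Nat.find_min h (Nat.sub_lt h0 one_pos)
    rw [Nat.sub_add_cancel (by lia : 1 ≤ Nat.find h)] at this
    exact not_lt.1 this

/-- The index `j` belongs to an essential key form. -/
def IsEssIdx (j : ℕ) : Prop := j = 0 ∨ (1 ≤ j ∧ j ≤ K.n ∧ 1 < K.α j) ∨ j = K.n + 1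

lemma isEssIdx_idx {k : ℕ} (hk : k ≤ D.l + 1) : K.IsEssIdx (K.idx k) := by
  rcases Nat.eq_zero_or_pos k with rfl | hk1
  · exact Or.inl rfl
  · rcases hk.lt_or_eq with hlt | rfl
    · refine Or.inr (Or.inl ⟨K.one_le_idx hk1 hk, K.idx_le_n (by lia), ?_⟩)
      rw [K.α_idx hk1 (by lia)]
      exact D.two_le k hk1 (by lia)
    · exact Or.inr (Or.inr K.idx_last)

lemma not_isEssIdx {k j : ℕ} (hk : k ≤ D.l) (h1 : K.idx k < j) (h2 : j < K.idx (k + 1)) :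
    ¬ K.IsEssIdx j := by
  have hn := K.idx_le (k := k + 1) (by lia)
  rintro (h | h | h)
  · lia
  · rw [K.α_eq_one hk h1 h2] at h
    lia
  · lia

/-- Every `idx k` is essential and no index strictly between two consecutive ones is, so exactly `k`
essential indices precede `idx k`. -/
lemma essIdx_eq_idx {k : ℕ} (hk : k ≤ D.l + 1) : K.essIdx k = K.idx k := by
  classical
  have hcount : Nat.count K.IsEssIdx (K.idx k) = k := by
    induction k with
    | zero => simp [idx_zero]
    | succ k ih =>
      have hlt := K.idx_lt_idx_succ (k := k) (by lia)
      obtain ⟨d, hd⟩ : ∃ d, K.idx (k + 1) = K.idx k + 1 + d := ⟨_, (Nat.add_sub_of_le hlt).symm⟩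
      rw [hd, Nat.count_add, Nat.count_succ, ih (by lia), if_pos (K.isEssIdx_idx (by lia))]
      have : Nat.count (fun i => K.IsEssIdx (K.idx k + 1 + i)) d = 0 := by
        rw [Nat.count_iff_forall_not]
        intro i hi
        exact K.not_isEssIdx (k := k) (by lia) (by lia) (by lia)
      rw [this]
  have := Nat.nth_count (K.isEssIdx_idx hk)
  rw [hcount] at this
  exact this

lemma ess_eq {k : ℕ} (hk : k ≤ D.l + 1) : K.ess k = K.g (K.idx k) := by
  rw [ess, K.essIdx_eq_idx hk]

/-! ### The recursion between consecutive essential key forms -/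

lemma mem_steps {j i : ℕ} (hj : j ≤ D.l) : i ∈ K.steps j ↔ K.idx j ≤ i ∧ i < K.idx (j + 1) := by
  rw [steps, Finset.mem_Ico, K.essIdx_eq_idx (by lia), K.essIdx_eq_idx (by lia)]

lemma ess_succ {j : ℕ} (hj1 : 1 ≤ j) (hj : j ≤ D.l) :
    K.ess (j + 1) = K.ess j ^ D.p j - ∑ i ∈ K.steps j, K.stepTerm i := by
  have hn := K.idx_le (k := j + 1) (by lia)
  have h1 := K.one_le_idx hj1 (by lia)
  have key : ∀ i, K.idx j < i → i ≤ K.idx (j + 1) →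
      K.g i = K.g (K.idx j) ^ D.p j - ∑ m ∈ Finset.Ico (K.idx j) i, K.stepTerm m := by
    intro i hi
    induction i, hi using Nat.le_induction with
    | base =>
      intro _
      rw [K.g_succ' h1 (K.idx_le_n hj), K.α_idx hj1 hj]
      simp
    | succ i hi ih =>
      intro hi'
      rw [K.g_succ' (by lia) (by lia), K.α_eq_one hj hi (by lia), pow_one, ih (by lia),
        Finset.sum_Ico_succ_top (by lia : K.idx j ≤ i)]
      ring
  rw [K.ess_eq (by lia), K.ess_eq (by lia), steps, K.essIdx_eq_idx (by lia),
    K.essIdx_eq_idx (by lia)]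
  exact key _ (K.idx_lt_idx_succ hj) le_rfl

/-- The degrees of the terms subtracted between two consecutive essential key forms. -/
lemma α_mul_u_strictAnti {j i i' : ℕ} (hj1 : 1 ≤ j) (hj : j ≤ D.l) (hi : K.idx j ≤ i)
    (hii' : i < i') (hi' : i' < K.idx (j + 1)) : K.α i' * K.u i' < K.α i * K.u i := by
  have hn := K.idx_le (k := j + 1) (by lia)
  have h1 := K.one_le_idx hj1 (by lia)
  induction i', hii' using Nat.le_induction with
  | base =>
    rw [K.α_eq_one hj (by lia) hi', Nat.cast_one, one_mul]
    exact K.u_lt (by lia) (by lia)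
  | succ i' hlt ih =>
    refine lt_trans ?_ (ih (by lia))
    rw [K.α_eq_one hj (by lia) hi', Nat.cast_one, one_mul]
    exact K.u_lt (by lia) (by lia)

lemma α_mul_u_le {j i : ℕ} (hj1 : 1 ≤ j) (hj : j ≤ D.l) (hi : K.idx j ≤ i)
    (hi' : i < K.idx (j + 1)) : K.α i * K.u i ≤ D.p j * K.u (K.idx j) := by
  rw [← K.α_idx hj1 hj]
  rcases hi.lt_or_eq with hlt | rfl
  · exact (K.α_mul_u_strictAnti hj1 hj le_rfl hlt hi').le
  · exact le_rfl

/-- The exponent of the `t`-th essential key form in the term subtracted at step `i`. -/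
def digit (i t : ℕ) : ℕ := if K.idx t < i then K.β i (K.idx t) else 0

lemma digit_lt {j i t : ℕ} (hj : j ≤ D.l)
    (hi' : i < K.idx (j + 1)) (ht1 : 1 ≤ t) (ht : t ≤ j) : K.digit i t < D.p t := by
  have hn := K.idx_le (k := j + 1) (by lia)
  rw [digit]
  split_ifs with h
  · rw [← K.α_idx ht1 (by lia)]
    exact K.β_lt i _ (K.one_le_idx ht1 (by lia)) h (by lia)
  · exact D.p_pos ht1 (by lia)

/-- A key form with `α = 1` can only occur with exponent `0`. -/
lemma prod_eq_prod_ess {j i : ℕ} (hj : j ≤ D.l)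
    (hi' : i < K.idx (j + 1)) :
    ∏ m ∈ Finset.Ico 1 i, K.g m ^ K.β i m = ∏ t ∈ Finset.Ico 1 (j + 1), K.ess t ^ K.digit i t := by
  classical
  have hn := K.idx_le (k := j + 1) (by lia)
  have hinj : Set.InjOn K.idx (((Finset.Ico 1 (j + 1)).filter fun t => K.idx t < i : Finset ℕ) :
      Set ℕ) := by
    intro t ht t' ht' heq
    simp only [Finset.coe_filter, Finset.mem_Ico, Set.mem_ofPred_eq] at ht ht'
    rcases lt_trichotomy t t' with h | h | h
    · exact absurd heq (K.idx_lt_idx h (by lia)).ne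
    · exact h
    · exact absurd heq (K.idx_lt_idx h (by lia)).ne'
  have h1 : ∏ t ∈ Finset.Ico 1 (j + 1), K.ess t ^ K.digit i t =
      ∏ t ∈ (Finset.Ico 1 (j + 1)).filter (fun t => K.idx t < i),
        K.g (K.idx t) ^ K.β i (K.idx t) := by
    rw [Finset.prod_filter]
    refine Finset.prod_congr rfl fun t ht => ?_
    rw [Finset.mem_Ico] at ht
    rw [K.ess_eq (by lia), digit]
    split_ifs <;> simp
  rw [h1, ← Finset.prod_image (f := fun m => K.g m ^ K.β i m) hinj]
  symm
  apply Finset.prod_subset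
  · intro m hm
    simp only [Finset.mem_image, Finset.mem_filter, Finset.mem_Ico] at hm ⊢
    obtain ⟨t, ⟨⟨ht1, ht2⟩, ht3⟩, rfl⟩ := hm
    exact ⟨K.one_le_idx ht1 (by lia), ht3⟩
  · intro m hm hnot
    rw [Finset.mem_Ico] at hm
    obtain ⟨t, ht, ht1, ht2⟩ := K.exists_idx_le_lt (j := m) (by lia)
    rcases ht1.lt_or_eq with hlt | heq
    · have := K.β_lt i m hm.1 hm.2 (by lia)
      rw [K.α_eq_one ht hlt ht2, Nat.lt_one_iff] at this
      rw [this, pow_zero]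
    · exfalso
      apply hnot
      simp only [Finset.mem_image, Finset.mem_filter, Finset.mem_Ico]
      refine ⟨t, ⟨⟨?_, ?_⟩, by lia⟩, heq⟩
      · by_contra h0
        obtain rfl : t = 0 := by lia
        rw [idx_zero] at heq
        lia
      · by_contra h0
        rcases (show j + 1 ≤ t by lia).lt_or_eq with h | h
        · have := K.idx_lt_idx h (by lia)
          lia
        · rw [h] at hi'
          lia

lemma stepTerm_eq {j i : ℕ} (hj : j ≤ D.l)
    (hi' : i < K.idx (j + 1)) :
    K.stepTerm i = K.θ i • (C (LaurentPolynomial.T (K.β₀ i)) *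
      ∏ t ∈ Finset.Ico 1 (j + 1), K.ess t ^ K.digit i t) := by
  rw [stepTerm, K.prod_eq_prod_ess hj hi']

lemma ess_monic_natDegree {j : ℕ} (hj1 : 1 ≤ j) (hj : j ≤ D.l + 1) :
    (K.ess j).Monic ∧ (K.ess j).natDegree = radix D.p j := by
  rw [K.ess_eq hj]
  refine ⟨(K.g_monic_natDegree (K.one_le_idx hj1 hj) (K.idx_le hj)).1, ?_⟩
  rw [(K.g_monic_natDegree (K.one_le_idx hj1 hj) (K.idx_le hj)).2]
  -- Steps with `α = 1` leave the place value unchanged.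
  have hone : ∀ k ≤ D.l, ∀ i, K.idx k < i → i ≤ K.idx (k + 1) →
      radix K.α i = radix K.α (K.idx k + 1) := by
    intro k hk i hi
    induction i, hi using Nat.le_induction with
    | base => intro _; rfl
    | succ i hi ih =>
      intro hi'
      rw [radix_succ _ (by lia), ih (by lia), K.α_eq_one hk hi (by lia), mul_one]
  induction j, hj1 using Nat.le_induction with
  | base =>
    rw [hone 0 (by lia) _ (K.idx_lt_idx_succ (by lia)) le_rfl, idx_zero]
    simp [radix]
  | succ j hj1 ih =>
    rw [hone j (by lia) _ (K.idx_lt_idx_succ (by lia)) le_rfl,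
      radix_succ _ (K.one_le_idx hj1 (by lia)), ih (by lia), K.α_idx hj1 (by lia),
      radix_succ _ hj1]

end KeyForms

end

section


/-! ### The weights -/

namespace KeyForms

variable {D : GenericPuiseux} (K : KeyForms D.fullSemidegree)

lemma ess_zero : K.ess 0 = C (LaurentPolynomial.T 1) := by
  rw [K.ess_eq (Nat.zero_le _), idx_zero, K.g_zero]

lemma constTop_ess {k t : ℕ} (hk : k ≤ D.l + 1) (ht : t < k) :
    D.ConstTop k (K.ess t) (K.u (K.idx t)) := by
  rw [K.ess_eq (by lia)]
  exact K.constTop_of_lt_idx (by lia) (K.idx_lt_idx ht hk)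

/-- For `i < idx k`, the top terms cancel in the recursion for `g (i + 1)`. -/
lemma isTop_g_succ {k i : ℕ} (hk1 : 1 ≤ k) (hk : k ≤ D.l + 1) (hi1 : 1 ≤ i) (hi : i < K.idx k) :
    IsTop (D.subst k (K.g (i + 1))) (K.α i * K.u i) 0 := by
  have hn := K.idx_le hk
  rcases (show i + 1 ≤ K.idx k from hi).lt_or_eq with hlt | heq
  · obtain ⟨a, -, h⟩ := K.constTop_of_lt_idx hk1 hlt
    exact h.raise (K.u_lt hi1 (by lia))
  -- At `i + 1 = idx k` the recursion only gives the drop for `δ`, not for `δ_k`. Without a drop for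
  -- `δ_k` the top coefficient would be the constant `a - b`, whereas it is linear in `ξ`.
  · obtain ⟨V, c, htop, hdeg⟩ := K.exists_linear_top hk1 hk
    rw [← heq] at htop
    have hc : c ≠ 0 := fun h0 => by simp [h0] at hdeg
    obtain ⟨a, -, h1⟩ := (K.constTop_of_lt_idx hk1 hi).pow (K.α i)
    obtain ⟨b, -, h2⟩ := K.constTop_stepTerm hi1 (by lia)
      fun m hm => K.constTop_of_lt_idx hk1 (hm.trans hi)
    have h3 := h1.sub h2
    rw [← map_sub, ← K.g_succ' hi1 (by lia), ← C_sub] at h3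
    refine htop.raise (lt_of_le_of_ne (htop.le_of_ne_zero h3 hc) ?_)
    rintro rfl
    have := htop.2.symm.trans h3.2
    rw [this, natDegree_C] at hdeg
    lia

/-- Membership of `V` in `(1 / P k) ℤ` is the integrality of `δ_k`; for `t = k` it comes from the
coefficient of `ξ`. -/
lemma exists_top_ess {k t : ℕ} (hk1 : 1 ≤ k) (hk : k ≤ D.l + 1) (ht : t ≤ k) :
    ∃ V ∈ fracGroup (D.P k), ∃ c, c ≠ 0 ∧ IsTop (D.subst k (K.ess t)) V c ∧
      (t < k → V = K.u (K.idx t) ∧ c.natDegree = 0) ∧ (t = k → c.natDegree = 1) := by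
  obtain ⟨k, rfl⟩ : ∃ m, k = m + 1 := ⟨k - 1, by lia⟩
  rcases ht.lt_or_eq with hlt | rfl
  · obtain ⟨a, ha, h⟩ := K.constTop_ess hk hlt
    exact ⟨_, D.fracGroup_le (Nat.le_succ k) hk (K.u_mem_fracGroup hk (K.idx_lt_idx hlt hk)),
      C a, by simpa using ha, h, fun _ => ⟨rfl, natDegree_C a⟩, fun h => by lia⟩
  · obtain ⟨V, c, htop, hdeg⟩ := K.exists_linear_top hk1 hk
    have hc : c ≠ 0 := fun h0 => by simp [h0] at hdeg
    rw [← K.ess_eq hk] at htop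
    refine ⟨V, ?_, c, hc, htop, fun h => by lia, fun _ => hdeg⟩
    have h1 := D.isGraded_subst hk (K.ess (k + 1)) V 1 (by
      rw [htop.2, ← hdeg]
      exact leadingCoeff_ne_zero.2 hc)
    have h2 := add_mem (D.fracGroup_le (Nat.le_succ k) hk h1) (D.expo_mem (k := k + 1))
    simpa using h2

lemma semidegree_ess {k t : ℕ} (hk1 : 1 ≤ k) (hk : k ≤ D.l + 1) (ht : t ≤ k)
    (hpos : 0 < D.semidegree k (K.ess t)) :
    D.semidegree k (K.ess t) = ((weight D K k t : ℚ) : WithBot ℚ) := by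
  obtain ⟨V, hV, c, hc, htop, -⟩ := K.exists_top_ess hk1 hk ht
  have h := D.semidegree_eq_of_isTop htop hc
  obtain ⟨a, ha⟩ := mem_fracGroup.1 hV
  rw [ha, mul_div_cancel₀ _ (D.P_pos_rat hk).ne'] at h
  rw [h] at hpos ⊢
  have ha0 : 0 < a := by exact_mod_cast hpos
  have : weight D K k t = a.toNat := by
    rw [weight, h]
    simp only [WithBot.unbotD_coe]
    rw [Nat.floor_eq_iff (by exact_mod_cast ha0.le)]
    have : ((a.toNat : ℤ) : ℚ) = a := by rw [Int.toNat_of_nonneg ha0.le]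
    constructor
    · exact_mod_cast this.le
    · have h2 : (a.toNat : ℚ) = a := by exact_mod_cast this
      rw [h2]
      linarith
  rw [this]
  have h2 : ((a.toNat : ℤ) : ℚ) = a := by rw [Int.toNat_of_nonneg ha0.le]
  rw [← h2]
  norm_cast

end KeyForms

section TopData

variable (D : GenericPuiseux) (K : KeyForms D.fullSemidegree) (k : ℕ)

/-- The top terms for `δ_k` of the first essential key forms. -/
structure TopData where
  c : Fin (k + 1) → ℂ[X]
  c_ne : ∀ t, c t ≠ 0
  top : ∀ t : Fin (k + 1), IsTop (D.subst k (K.ess t)) ((weightA D K k t : ℚ) / D.P k) (c t)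
  weight_eq : ∀ t : Fin (k + 1), t.val < k → (weightA D K k t : ℚ) / D.P k = K.u (K.idx t)
  natDegree_of_lt : ∀ t : Fin (k + 1), t.val < k → (c t).natDegree = 0
  natDegree_last : (c (Fin.last k)).natDegree = 1
  weight_pos : ∀ t, 0 < weightA D K k t

variable {D K k}

lemma nonempty_topData (hk1 : 1 ≤ k) (hk : k ≤ D.l + 1)
    (hpos : ∀ j ≤ k, 0 < D.semidegree k (K.ess j)) : Nonempty (TopData D K k) := by
  have h : ∀ t : Fin (k + 1), ∃ c, c ≠ 0 ∧
      IsTop (D.subst k (K.ess t)) ((weightA D K k t : ℚ) / D.P k) c ∧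
      (t.val < k → (weightA D K k t : ℚ) / D.P k = K.u (K.idx t) ∧ c.natDegree = 0) ∧
      (t.val = k → c.natDegree = 1) := by
    intro t
    obtain ⟨V, hV, c, hc, htop, h1, h2⟩ := K.exists_top_ess hk1 hk (Nat.lt_succ_iff.1 t.2)
    have hs := K.semidegree_ess hk1 hk (Nat.lt_succ_iff.1 t.2) (hpos t (Nat.lt_succ_iff.1 t.2))
    rw [D.semidegree_eq_of_isTop htop hc, WithBot.coe_inj] at hs
    have hVe : (weightA D K k t : ℚ) / D.P k = V := by
      rw [weightA, ← hs, mul_div_cancel_left₀ _ (D.P_pos_rat hk).ne']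
    rw [hVe]
    exact ⟨c, hc, htop, h1, h2⟩
  choose c hc htop h1 h2 using h
  refine ⟨⟨c, hc, htop, fun t ht => (h1 t ht).1, fun t ht => (h1 t ht).2, h2 _ rfl, fun t => ?_⟩⟩
  have hp := hpos t (Nat.lt_succ_iff.1 t.2)
  rw [K.semidegree_ess hk1 hk (Nat.lt_succ_iff.1 t.2) hp] at hp
  exact_mod_cast hp

end TopData

/-! ### Nonnegativity of the exponents of `x` -/

lemma incl_coeff (h : PolyXY) (N : ℕ) : (incl h).coeff N = toLaurent (h.coeff N) := by
  simp [incl, coeff_map]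

lemma toLaurent_coeff_of_neg (p : ℂ[X]) {a : ℤ} (ha : a < 0) : (toLaurent p).coeff a = 0 := by
  rw [← Finsupp.notMem_support_iff, LaurentPolynomial.support_coeff_toLaurent]
  intro h
  obtain ⟨b, -, hb⟩ := Finset.mem_map.1 h
  have : (b : ℤ) = a := hb
  lia

lemma incl_injective : Function.Injective incl := by
  intro f g h
  refine Polynomial.map_injective (toLaurentAlg : ℂ[X] →ₐ[ℂ] _).toRingHom ?_ h
  exact toLaurent_injective

namespace KeyForms

variable {D : GenericPuiseux} (K : KeyForms D.fullSemidegree)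

/-- Steps with a negative power of `x` must add up to a polynomial, because `f_j`, `f_{j+1}` and the
remaining terms are polynomials. Among them, the leading `y`-coefficient of one with largest
`y`-degree cannot cancel. -/
lemma β₀_nonneg {k j : ℕ} (hk : k ≤ D.l + 1) (hpoly : ∀ j ≤ k, K.ess j ∈ Set.range incl)
    (hj1 : 1 ≤ j) (hj : j < k) : ∀ i ∈ K.steps j, 0 ≤ K.β₀ i := by
  classical
  have hn := K.idx_le (k := j + 1) (by lia)
  have hidx1 := K.one_le_idx hj1 (by lia)
  set M : ℕ → LaurentXY := fun i => ∏ t ∈ Finset.Ico 1 (j + 1), K.ess t ^ K.digit i t with hM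
  have hess : ∀ t ≤ k, K.ess t ∈ incl.range := fun t ht => hpoly t ht
  have hMrange : ∀ i, M i ∈ incl.range := fun i =>
    prod_mem fun t ht => pow_mem (hess t (by rw [Finset.mem_Ico] at ht; lia)) _
  have hterm : ∀ i ∈ K.steps j,
      K.stepTerm i = K.θ i • (C (LaurentPolynomial.T (K.β₀ i)) * M i) := by
    intro i hi
    rw [K.mem_steps (by lia)] at hi
    exact K.stepTerm_eq (by lia) hi.2
  have hMmonic : ∀ i, (M i).Monic := fun i => monic_prod_of_monic _ _ fun t ht => by
    rw [Finset.mem_Ico] at ht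
    exact (K.ess_monic_natDegree ht.1 (by lia)).1.pow _
  have hMdeg : ∀ i, (M i).natDegree = ∑ t ∈ Finset.Ico 1 (j + 1), K.digit i t * radix D.p t := by
    intro i
    rw [hM, natDegree_prod_of_monic]
    · refine Finset.sum_congr rfl fun t ht => ?_
      rw [Finset.mem_Ico] at ht
      obtain ⟨h1, h2⟩ := K.ess_monic_natDegree ht.1 (by lia : t ≤ D.l + 1)
      rw [h1.natDegree_pow, h2]
    · intro t ht
      rw [Finset.mem_Ico] at ht
      exact (K.ess_monic_natDegree ht.1 (by lia)).1.pow _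
  have hsum : ∑ i ∈ K.steps j, K.stepTerm i ∈ incl.range := by
    have h := K.ess_succ hj1 (by lia)
    rw [eq_sub_iff_add_eq, ← eq_sub_iff_add_eq'] at h
    rw [h]
    exact sub_mem (pow_mem (hess j (by lia)) _) (hess (j + 1) (by lia))
  by_contra hneg
  push Not at hneg
  set bad := (K.steps j).filter fun i => K.β₀ i < 0 with hbad
  have hbadne : bad.Nonempty := by
    obtain ⟨i, hi, hi'⟩ := hneg
    exact ⟨i, Finset.mem_filter.2 ⟨hi, hi'⟩⟩
  have hbadsum : ∑ i ∈ bad, K.stepTerm i ∈ incl.range := by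
    have h := Finset.sum_filter_add_sum_filter_not (K.steps j) (fun i => K.β₀ i < 0) K.stepTerm
    rw [← eq_sub_iff_add_eq] at h
    rw [hbad, h]
    refine sub_mem hsum (sum_mem fun i hi => ?_)
    rw [Finset.mem_filter, not_lt] at hi
    rw [hterm i hi.1]
    refine Subalgebra.smul_mem _ (mul_mem ?_ (hMrange i)) _
    refine ⟨C (X ^ (K.β₀ i).toNat), ?_⟩
    change Polynomial.map (toLaurentAlg : ℂ[X] →ₐ[ℂ] LaurentPolynomial ℂ).toRingHom _ = _
    rw [map_C]
    change C (toLaurent (X ^ _ : ℂ[X])) = _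
    rw [toLaurent_X_pow, Int.toNat_of_nonneg hi.2]
  obtain ⟨i₀, hi₀, hmax⟩ := bad.exists_max_image (fun i => (M i).natDegree) hbadne
  obtain ⟨h, hh⟩ := hbadsum
  have hi₀' := Finset.mem_filter.1 hi₀
  have hzero : ((∑ i ∈ bad, K.stepTerm i).coeff (M i₀).natDegree).coeff (K.β₀ i₀) = 0 := by
    rw [← hh]
    change ((incl h).coeff _).coeff _ = 0
    rw [incl_coeff, toLaurent_coeff_of_neg _ hi₀'.2]
  have hone : ∀ i ∈ bad, i ≠ i₀ →
      ((K.stepTerm i).coeff (M i₀).natDegree).coeff (K.β₀ i₀) = 0 := by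
    intro i hi hne
    have hi' := Finset.mem_filter.1 hi
    rw [hterm i hi'.1, coeff_smul, coeff_C_mul]
    rcases (hmax i hi).lt_or_eq with hlt | heq
    · rw [coeff_eq_zero_of_natDegree_lt hlt]
      simp
    · rw [← heq, (hMmonic i).coeff_natDegree, mul_one, AddMonoidAlgebra.coeff_smul_apply,
        LaurentPolynomial.T_apply, if_neg, smul_zero]
      intro hβ
      have h1 := (K.mem_steps (by lia)).1 hi'.1
      have h2 := (K.mem_steps (by lia)).1 hi₀'.1
      -- The `y`-degree has mixed radix digits `digit i t`, so equal `y`-degrees and equal powers of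
      -- `x` mean equal monomials. That contradicts the strict decrease of the degrees along the
      -- steps.
      have hdig : ∀ t, 1 ≤ t → t < j + 1 → K.digit i t = K.digit i₀ t := by
        refine sum_mul_radix_injective (a := D.p)
          (fun t ht1 ht => K.digit_lt (by lia) h1.2 ht1 (by lia))
          (fun t ht1 ht => K.digit_lt (by lia) h2.2 ht1 (by lia)) ?_
        rw [← hMdeg, ← hMdeg, heq]
      have hMeq : M i = M i₀ := Finset.prod_congr rfl fun t ht => by
        rw [Finset.mem_Ico] at ht
        rw [hdig t ht.1 ht.2]
      have hct : ∀ m ∈ K.steps j, D.ConstTop (D.l + 1) (C (LaurentPolynomial.T (K.β₀ m)) * M m)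
          (K.α m * K.u m) := by
        intro m hm
        have h3 := (K.mem_steps (by lia)).1 hm
        have h4 := (K.constTop_stepTerm (k := D.l + 1) (j := m) (by lia) (by lia)
          fun i hi => K.constTop_last (by lia)).smul (inv_ne_zero (K.θ_ne m (by lia) (by lia)))
        rwa [hterm m hm, smul_smul, inv_mul_cancel₀ (K.θ_ne m (by lia) (by lia)), one_smul] at h4
      have h5 := hct i hi'.1
      rw [hβ, hMeq] at h5
      obtain ⟨a, ha, h6⟩ := hct i₀ hi₀'.1
      have h7 := h5.unique h6 (by simpa using ha)
      rcases lt_or_gt_of_ne hne with hlt | hlt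
      · exact (K.α_mul_u_strictAnti hj1 (by lia) h1.1 hlt h2.2).ne h7.symm
      · exact (K.α_mul_u_strictAnti hj1 (by lia) h2.1 hlt h1.2).ne h7
  rw [finsetSum_coeff, AddMonoidAlgebra.coeff_sum, Finsupp.finsetSum_apply,
    Finset.sum_eq_single_of_mem i₀ hi₀ hone, hterm i₀ hi₀'.1, coeff_smul, coeff_C_mul,
    (hMmonic i₀).coeff_natDegree, mul_one, AddMonoidAlgebra.coeff_smul_apply,
    LaurentPolynomial.T_apply, if_pos rfl, smul_eq_mul, mul_one] at hzero
  have h2 := (K.mem_steps (by lia)).1 hi₀'.1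
  exact K.θ_ne i₀ (by lia) (by lia) hzero

lemma expoA_apply {k : ℕ} (hk : k ≤ D.l + 1) (i : ℕ) (t : Fin (k + 1)) :
    K.expoA k i t = if t.val = 0 then (K.β₀ i).toNat else K.digit i t := by
  have ht : t.val ≤ D.l + 1 := (Nat.lt_succ_iff.1 t.2).trans hk
  change (if t.val = 0 then (K.β₀ i).toNat
    else if K.essIdx t.val < i then K.β i (K.essIdx t.val) else 0) = _
  rw [K.essIdx_eq_idx ht]
  rfl

lemma digit_eq_zero {j i t : ℕ} (hi : i < K.idx (j + 1)) (ht : j < t) (htl : t ≤ D.l + 1) :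
    K.digit i t = 0 := by
  rw [digit, if_neg]
  rcases (show j + 1 ≤ t from ht).lt_or_eq with h | rfl
  · have := K.idx_lt_idx h htl
    lia
  · lia

lemma piA_monomial {k : ℕ} (m : Fin (k + 1) →₀ ℕ) (a : ℂ) :
    piA D K k (MvPolynomial.monomial m a) = a • ∏ t, K.ess t.val ^ m t := by
  rw [piA, MvPolynomial.aeval_monomial, Algebra.smul_def, Finsupp.prod_fintype]
  simp

lemma piA_stepMonomial {k j i : ℕ} (hk : k ≤ D.l + 1)
    (hpoly : ∀ j ≤ k, K.ess j ∈ Set.range incl) (hj1 : 1 ≤ j) (hj : j < k) (hi : i ∈ K.steps j) :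
    piA D K k (MvPolynomial.monomial (K.expoA k i) (K.θ i)) = K.stepTerm i := by
  have hi' := (K.mem_steps (by lia)).1 hi
  have hβ := K.β₀_nonneg hk hpoly hj1 hj i hi
  rw [piA_monomial, K.stepTerm_eq (by lia) hi'.2, Fin.prod_univ_succ]
  congr 2
  · rw [K.expoA_apply hk, if_pos (Fin.val_zero _), Fin.val_zero, K.ess_zero, ← C_pow,
      LaurentPolynomial.T_pow, Int.toNat_of_nonneg hβ, mul_one]
  · have h1 : ∏ t : Fin k, K.ess t.succ.val ^ K.expoA k i t.succ =
        ∏ t ∈ Finset.Ico 1 (k + 1), K.ess t ^ K.digit i t := by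
      rw [Finset.prod_Ico_eq_prod_range, Nat.add_sub_cancel, Finset.prod_range]
      refine Finset.prod_congr rfl fun t _ => ?_
      rw [K.expoA_apply hk, if_neg (by simp), Fin.val_succ, add_comm]
    rw [h1]
    symm
    apply Finset.prod_subset (Finset.Ico_subset_Ico_right (by lia))
    intro t ht hnot
    rw [Finset.mem_Ico] at ht hnot
    rw [K.digit_eq_zero hi'.2 (by lia) (by lia), pow_zero]

end KeyForms

end

section


/-! ### Semidegree inequalities read off from top coefficients -/

namespace GenericPuiseux

variable (D : GenericPuiseux)

lemma semidegree_lt_of_isTop_zero {k : ℕ} (hk : k ≤ D.l + 1) {f : LaurentXY} {v : ℚ}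
    (h : IsTop (D.subst k f) v 0) : D.semidegree k f < ((D.P k * v : ℚ) : WithBot ℚ) := by
  by_cases h0 : D.subst k f = 0
  · have : D.semidegree k f = ⊥ := by simp [semidegree, degX, h0]
    rw [this]
    exact WithBot.bot_lt_coe _
  · obtain ⟨V, c, hc, htop⟩ := exists_isTop h0
    rw [D.semidegree_eq_of_isTop htop hc, WithBot.coe_lt_coe]
    refine mul_lt_mul_of_pos_left (lt_of_le_of_ne (htop.le_of_ne_zero h hc) ?_) (D.P_pos_rat hk)
    rintro rfl
    exact hc (htop.2.symm.trans h.2)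

lemma coeff_eq_zero_of_semidegree_lt {k : ℕ} {f : LaurentXY} {v : ℚ}
    (h : D.semidegree k f < ((D.P k * v : ℚ) : WithBot ℚ)) : (D.subst k f).coeff v = 0 := by
  by_contra hne
  by_cases h0 : D.subst k f = 0
  · simp [h0] at hne
  · obtain ⟨V, c, hc, htop⟩ := exists_isTop h0
    rw [D.semidegree_eq_of_isTop htop hc, WithBot.coe_lt_coe] at h
    refine hne (htop.1 v ?_)
    exact lt_of_mul_lt_mul_left h (Nat.cast_nonneg _)

end GenericPuiseux

/-! ### Leading forms -/

section Leading

variable {D : GenericPuiseux} {K : KeyForms D.fullSemidegree} {k : ℕ}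

lemma weight_eq_sum (w : Fin (k + 1) → ℕ) (m : Fin (k + 1) →₀ ℕ) :
    Finsupp.weight w m = ∑ t, m t * w t := by
  rw [Finsupp.weight_apply, Finsupp.sum_fintype]
  · simp
  · simp

namespace TopData

/-- The top coefficient of a monomial in the essential key forms. -/
def coef (T : TopData D K k) (m : Fin (k + 1) →₀ ℕ) : ℂ[X] := ∏ t, T.c t ^ m t

lemma coef_ne_zero (T : TopData D K k) (m : Fin (k + 1) →₀ ℕ) : T.coef m ≠ 0 :=
  Finset.prod_ne_zero_iff.2 fun t _ => pow_ne_zero _ (T.c_ne t)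

/-- Only `f_k` has a top coefficient involving `ξ`, and it is linear. -/
lemma natDegree_coef (T : TopData D K k) (m : Fin (k + 1) →₀ ℕ) :
    (T.coef m).natDegree = m (Fin.last k) := by
  rw [coef, natDegree_prod _ _ fun t _ => pow_ne_zero _ (T.c_ne t),
    Finset.sum_eq_single (Fin.last k)]
  · rw [natDegree_pow, T.natDegree_last, mul_one]
  · intro t _ ht
    rw [natDegree_pow, T.natDegree_of_lt t (Fin.val_lt_last ht), mul_zero]
  · simp

/-- The leading form of `π_k(F)`, graded by the weight: `x ↦ c_0 T ^ ω_0`, `y_j ↦ c_j T ^ ω_j`. -/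
def grHom (T : TopData D K k) : A k →ₐ[ℂ] ℂ[X][X] :=
  MvPolynomial.aeval fun t => monomial (weightA D K k t) (T.c t)

lemma grHom_monomial (T : TopData D K k) (m : Fin (k + 1) →₀ ℕ) (a : ℂ) :
    T.grHom (MvPolynomial.monomial m a) =
      monomial (Finsupp.weight (weightA D K k) m) (C a * T.coef m) := by
  have hprod : ∀ s : Finset (Fin (k + 1)),
      ∏ t ∈ s, (monomial (weightA D K k t) (T.c t)) ^ m t =
        monomial (∑ t ∈ s, m t * weightA D K k t) (∏ t ∈ s, T.c t ^ m t) := by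
    classical
    intro s
    induction s using Finset.induction_on with
    | empty => simp
    | insert t s ht ih =>
      rw [Finset.prod_insert ht, Finset.sum_insert ht, Finset.prod_insert ht, ih, monomial_pow,
        monomial_mul_monomial, mul_comm (weightA D K k t)]
  rw [grHom, MvPolynomial.aeval_monomial, Finsupp.prod_fintype _ _ (by simp), hprod,
    weight_eq_sum, coef]
  change C (C a) * _ = _
  rw [C_mul_monomial]

lemma isTop_monomial (T : TopData D K k) (m : Fin (k + 1) →₀ ℕ) (a : ℂ) :
    IsTop (D.subst k (piA D K k (MvPolynomial.monomial m a)))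
      ((Finsupp.weight (weightA D K k) m : ℕ) / D.P k) (C a * T.coef m) := by
  rw [K.piA_monomial]
  apply D.isTop_smul
  have h := IsTop.prod Finset.univ fun t _ => (T.top t).pow (m t)
  rw [map_prod]
  simp only [map_pow]
  have hw : ((Finsupp.weight (weightA D K k) m : ℕ) : ℚ) / D.P k =
      ∑ t, (m t : ℚ) * ((weightA D K k t : ℚ) / D.P k) := by
    rw [weight_eq_sum]
    push_cast
    rw [Finset.sum_div]
    exact Finset.sum_congr rfl fun t _ => by ring
  rw [hw]
  exact h

/-- The link between `grHom` and the semidegree: for `F` of weight at most `d`, `δ_k` drops below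
`d` exactly when this coefficient vanishes. -/
lemma isTop_piA (T : TopData D K k) (hk : k ≤ D.l + 1) {F : A k} {d : ℕ}
    (hF : ∀ m ∈ F.support, Finsupp.weight (weightA D K k) m ≤ d) :
    IsTop (D.subst k (piA D K k F)) ((d : ℚ) / D.P k) ((T.grHom F).coeff d) := by
  have hP := D.P_pos_rat hk
  have h : ∀ m ∈ F.support,
      IsTop (D.subst k (piA D K k (MvPolynomial.monomial m (F.coeff m)))) ((d : ℚ) / D.P k)
        ((T.grHom (MvPolynomial.monomial m (F.coeff m))).coeff d) := by
    intro m hm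
    have h1 := T.isTop_monomial m (F.coeff m)
    rw [T.grHom_monomial, coeff_monomial]
    rcases (hF m hm).lt_or_eq with hlt | heq
    · rw [if_neg hlt.ne]
      refine h1.raise ?_
      have : ((Finsupp.weight (weightA D K k) m : ℕ) : ℚ) < d := by exact_mod_cast hlt
      gcongr
    · rw [if_pos heq]
      rwa [heq] at h1
  have hsum := IsTop.sum _ h
  rwa [← finsetSum_coeff, ← map_sum, ← map_sum, ← map_sum, ← MvPolynomial.as_sum] at hsum

end TopData

/-- The exponent vectors with `m t < p t` for `1 ≤ t < k`. -/
def IsStd (D : GenericPuiseux) (k : ℕ) (m : Fin (k + 1) →₀ ℕ) : Prop :=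
  ∀ t : Fin (k + 1), 1 ≤ t.val → t.val < k → m t < D.p t

namespace TopData

/-- At the right-most difference `t`, equality of weights puts `(m t - m' t) * u (idx t)` into the
group of the earlier degrees. For `t ≥ 1` this makes `p t` divide a difference smaller than `p t`;
for `t = 0` that group is trivial. -/
lemma std_injective (T : TopData D K k) (hk : k ≤ D.l + 1) {m m' : Fin (k + 1) →₀ ℕ}
    (hm : IsStd D k m) (hm' : IsStd D k m')
    (hw : Finsupp.weight (weightA D K k) m = Finsupp.weight (weightA D K k) m')
    (hlast : m (Fin.last k) = m' (Fin.last k)) : m = m' := by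
  classical
  by_contra hne
  have hs : (Finset.univ.filter fun t => m t ≠ m' t).Nonempty := by
    by_contra hemp
    rw [Finset.not_nonempty_iff_eq_empty, Finset.filter_eq_empty_iff] at hemp
    exact hne (Finsupp.ext fun t => not_not.1 (hemp (Finset.mem_univ t)))
  obtain ⟨t, ht, hmax⟩ := Finset.exists_max_image _ id hs
  have ht' := (Finset.mem_filter.1 ht).2
  have hgt : ∀ s, t < s → m s = m' s := by
    intro s hs
    by_contra h
    exact absurd (hmax s (Finset.mem_filter.2 ⟨Finset.mem_univ s, h⟩)) (not_le.2 hs)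
  have htk : t.val < k := by
    rcases Nat.lt_or_ge t.val k with h | h
    · exact h
    · exact absurd ((Fin.last_le_iff.1 h) ▸ hlast) ht'
  have hP := D.P_pos_rat hk
  have hsum : ∑ s, ((m s : ℚ) - m' s) * ((weightA D K k s : ℚ) / D.P k) = 0 := by
    rw [weight_eq_sum, weight_eq_sum] at hw
    have hw' : ∑ s, (m s : ℚ) * weightA D K k s = ∑ s, (m' s : ℚ) * weightA D K k s := by
      exact_mod_cast hw
    rw [← sub_eq_zero, ← Finset.sum_sub_distrib] at hw'
    calc _ = (∑ s, ((m s : ℚ) * weightA D K k s - m' s * weightA D K k s)) / D.P k := by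
          rw [Finset.sum_div]
          exact Finset.sum_congr rfl fun s _ => by ring
      _ = 0 := by rw [hw', zero_div]
  have hrest : ((m t : ℚ) - m' t) * K.u (K.idx t) ∈ K.valueGroup (K.idx t) := by
    rw [← T.weight_eq t htk]
    rw [← Finset.add_sum_erase _ _ (Finset.mem_univ t), add_eq_zero_iff_eq_neg] at hsum
    rw [hsum]
    refine neg_mem (sum_mem fun s hs => ?_)
    rcases lt_or_gt_of_ne (Finset.ne_of_mem_erase hs) with h | h
    · rw [T.weight_eq s (lt_trans h htk)]
      have hmem := K.u_mem_valueGroup (K.idx_lt_idx (k' := t.val) h (by lia))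
      have := zsmul_mem hmem ((m s : ℤ) - m' s)
      rw [zsmul_eq_mul] at this
      exact_mod_cast this
    · rw [hgt s h, sub_self, zero_mul]
      exact zero_mem _
  rcases Nat.eq_zero_or_pos t.val with h0 | h1
  · rw [h0, K.idx_zero, K.u_zero, KeyForms.valueGroup] at hrest
    simp only [Set.Iio_zero_eq_empty, Set.image_empty, AddSubgroup.closure_empty,
      AddSubgroup.mem_bot, mul_one] at hrest
    exact ht' (by exact_mod_cast sub_eq_zero.1 hrest)
  · obtain ⟨j, hj⟩ : ∃ j, t.val = j + 1 := ⟨t.val - 1, by lia⟩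
    rw [hj, K.valueGroup_idx (by lia)] at hrest
    have hdvd := (K.natCast_mul_u_idx_mem_iff (k := j) (by lia) ((m t : ℤ) - m' t)).1
      (by push_cast; exact hrest)
    have h2 := hm t h1 htk
    have h3 := hm' t h1 htk
    rw [hj] at h2 h3
    apply ht'
    have := Int.eq_zero_of_abs_lt_dvd hdvd (by rw [abs_lt]; lia)
    lia

/-- Take a monomial with the largest `y_k`-exponent. No other standard monomial contributes to its
weight and its power of `ξ`. -/
lemma eq_zero_of_std (T : TopData D K k) (hk : k ≤ D.l + 1) {N : A k}
    (hN : ∀ m ∈ N.support, IsStd D k m)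
    (h0 : T.grHom N = 0) : N = 0 := by
  classical
  by_contra hne
  obtain ⟨m₀, hm₀, hmax⟩ := N.support.exists_max_image (fun m => m (Fin.last k))
    (MvPolynomial.support_nonempty.2 hne)
  have hcoeff : ((T.grHom N).coeff (Finsupp.weight (weightA D K k) m₀)).coeff
      (m₀ (Fin.last k)) = 0 := by
    simp [h0]
  rw [N.as_sum, map_sum, finsetSum_coeff, finsetSum_coeff,
    Finset.sum_eq_single_of_mem m₀ hm₀] at hcoeff
  · rw [T.grHom_monomial, coeff_monomial, if_pos rfl, coeff_C_mul, ← T.natDegree_coef m₀] at hcoeff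
    rcases mul_eq_zero.1 hcoeff with h | h
    · exact MvPolynomial.mem_support_iff.1 hm₀ h
    · exact T.coef_ne_zero m₀ (leadingCoeff_eq_zero.1 h)
  · intro m hm hmne
    rw [T.grHom_monomial, coeff_monomial]
    split_ifs with hw
    · rw [coeff_C_mul, coeff_eq_zero_of_natDegree_lt, mul_zero]
      rw [T.natDegree_coef]
      refine lt_of_le_of_ne (hmax m hm) fun heq => hmne ?_
      exact T.std_injective hk (hN m hm) (hN m₀ hm₀) hw heq
    · simp

/-! ### The terms of the recursion -/

/-- Both sides are the exponent of the top term of the same step monomial, once through the weights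
of `δ_k` and once through the recursion. -/
lemma weight_expoA (T : TopData D K k) (hk1 : 1 ≤ k) (hk : k ≤ D.l + 1)
    (hpoly : ∀ j ≤ k, K.ess j ∈ Set.range incl)
    {j i : ℕ} (hj1 : 1 ≤ j) (hj : j < k) (hi : i ∈ K.steps j) :
    ((Finsupp.weight (weightA D K k) (K.expoA k i) : ℕ) : ℚ) / D.P k = K.α i * K.u i := by
  have hi' := (K.mem_steps (by lia)).1 hi
  have hn := K.idx_le (k := j + 1) (by lia)
  have h1 := K.one_le_idx hj1 (by lia)
  have htop := T.isTop_monomial (K.expoA k i) (K.θ i)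
  rw [K.piA_stepMonomial hk hpoly hj1 hj hi] at htop
  have hlt : i < K.idx k := by
    rcases (show j + 1 ≤ k from hj).lt_or_eq with h | h
    · exact hi'.2.trans (K.idx_lt_idx h hk)
    · rw [← h]
      exact hi'.2
  refine ((K.constTop_stepTerm (k := k) (by lia) (by lia) fun m hm =>
    K.constTop_of_lt_idx hk1 (by lia)).unique htop ?_).symm
  exact mul_ne_zero (by simpa using K.θ_ne i (by lia) (by lia)) (T.coef_ne_zero _)

lemma weight_div (T : TopData D K k) (j : ℕ) (hj : j < k) :
    (weight D K k j : ℚ) / D.P k = K.u (K.idx j) :=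
  T.weight_eq ⟨j, by lia⟩ hj

lemma weight_expoA_le (T : TopData D K k) (hk1 : 1 ≤ k) (hk : k ≤ D.l + 1)
    (hpoly : ∀ j ≤ k, K.ess j ∈ Set.range incl)
    {j i : ℕ} (hj1 : 1 ≤ j) (hj : j < k) (hi : i ∈ K.steps j) :
    Finsupp.weight (weightA D K k) (K.expoA k i) ≤ D.p j * weight D K k j := by
  have hi' := (K.mem_steps (by lia)).1 hi
  have hP := D.P_pos_rat hk
  have h1 := K.α_mul_u_le hj1 (by lia) hi'.1 hi'.2
  rw [← T.weight_expoA hk1 hk hpoly hj1 hj hi, ← T.weight_div j hj, ← mul_div_assoc,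
    div_le_div_iff_of_pos_right hP] at h1
  exact_mod_cast h1

lemma weight_expoA_lt (T : TopData D K k) (hk1 : 1 ≤ k) (hk : k ≤ D.l + 1)
    (hpoly : ∀ j ≤ k, K.ess j ∈ Set.range incl)
    {j i : ℕ} (hj1 : 1 ≤ j) (hj : j < k) (hi : i ∈ K.steps j) (hne : i ≠ K.idx j) :
    Finsupp.weight (weightA D K k) (K.expoA k i) < D.p j * weight D K k j := by
  have hi' := (K.mem_steps (by lia)).1 hi
  have hP := D.P_pos_rat hk
  have h1 := K.α_mul_u_strictAnti hj1 (by lia) le_rfl (lt_of_le_of_ne hi'.1 hne.symm) hi'.2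
  rw [← T.weight_expoA hk1 hk hpoly hj1 hj hi, K.α_idx hj1 (by lia), ← T.weight_div j hj,
    ← mul_div_assoc, div_lt_div_iff_of_pos_right hP] at h1
  exact_mod_cast h1

lemma idx_mem_steps {j : ℕ} (hj : j ≤ D.l) : K.idx j ∈ K.steps j :=
  (K.mem_steps hj).2 ⟨le_rfl, K.idx_lt_idx_succ hj⟩

lemma weight_expoA_idx (T : TopData D K k) (hk1 : 1 ≤ k) (hk : k ≤ D.l + 1)
    (hpoly : ∀ j ≤ k, K.ess j ∈ Set.range incl) {j : ℕ} (hj1 : 1 ≤ j) (hj : j < k) :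
    Finsupp.weight (weightA D K k) (K.expoA k (K.idx j)) = D.p j * weight D K k j := by
  have hP := D.P_pos_rat hk
  have h1 := T.weight_expoA hk1 hk hpoly hj1 hj (idx_mem_steps (by lia))
  rw [K.α_idx hj1 (by lia), ← T.weight_div j hj, ← mul_div_assoc, div_left_inj' hP.ne'] at h1
  exact_mod_cast h1

/-- The last step leading to `f_{j+1}` cancels its top terms for `δ_k`, even when `j + 1 = k`, and
the degree of this step is at most that of `f_j ^ p_j`. -/
lemma weight_succ_lt (T : TopData D K k) (hk1 : 1 ≤ k) (hk : k ≤ D.l + 1) {j : ℕ}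
    (hj1 : 1 ≤ j) (hj : j < k) :
    weight D K k (j + 1) < D.p j * weight D K k j := by
  have hP := D.P_pos_rat hk
  have hlt := K.idx_lt_idx_succ (k := j) (by lia)
  have hle : K.idx (j + 1) ≤ K.idx k := by
    rcases (show j + 1 ≤ k from hj).lt_or_eq with h | h
    · exact (K.idx_lt_idx h hk).le
    · rw [h]
  obtain ⟨i, hi⟩ : ∃ i, K.idx (j + 1) = i + 1 := ⟨K.idx (j + 1) - 1, by lia⟩
  have h1 := K.one_le_idx hj1 (by lia)
  have h2 := K.isTop_g_succ (i := i) hk1 hk (by lia) (by lia)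
  rw [← hi, ← K.ess_eq (by lia)] at h2
  have h3 := T.top ⟨j + 1, by lia⟩
  have h4 := h3.le_of_ne_zero h2 (T.c_ne _)
  have h5 : (weightA D K k ⟨j + 1, by lia⟩ : ℚ) / D.P k < K.α i * K.u i := by
    refine lt_of_le_of_ne h4 fun heq => T.c_ne ⟨j + 1, by lia⟩ ?_
    rw [← h3.2, heq, h2.2]
  have h6 := h5.trans_le (K.α_mul_u_le hj1 (by lia) (by lia) (by lia : i < K.idx (j + 1)))
  rw [← T.weight_div j hj, ← mul_div_assoc, div_lt_div_iff_of_pos_right hP] at h6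
  exact_mod_cast h6

lemma yIdx_val {j : ℕ} (hj : j ≤ k) : (yIdx k j).val = j := Nat.mod_eq_of_lt (by lia)

/-- The form `H_{j+1}` is the first step of the recursion after `f_j`, so the drop of degree there
puts it into `J_k`. -/
lemma piA_leadH (hk : k ≤ D.l + 1) (hpoly : ∀ j ≤ k, K.ess j ∈ Set.range incl)
    {j : ℕ} (hj1 : 1 ≤ j) (hj : j < k) :
    piA D K k (leadH D K k j) = K.g (K.idx j + 1) := by
  rw [leadH, map_sub, K.essIdx_eq_idx (by lia),
    K.piA_stepMonomial hk hpoly hj1 hj (idx_mem_steps (by lia)),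
    K.g_succ' (K.one_le_idx hj1 (by lia)) (K.idx_le_n (by lia)), K.α_idx hj1 (by lia), map_pow,
    ← K.ess_eq (by lia)]
  congr 2
  rw [piA, MvPolynomial.aeval_X, yIdx_val hj.le]

lemma isWeightedHomogeneous_leadH (T : TopData D K k) (hk1 : 1 ≤ k) (hk : k ≤ D.l + 1)
    (hpoly : ∀ j ≤ k, K.ess j ∈ Set.range incl) {j : ℕ} (hj1 : 1 ≤ j) (hj : j < k) :
    MvPolynomial.IsWeightedHomogeneous (weightA D K k) (leadH D K k j)
      (D.p j * weight D K k j) := by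
  refine MvPolynomial.IsWeightedHomogeneous.sub ?_ ?_
  · have := (MvPolynomial.isWeightedHomogeneous_X ℂ (weightA D K k) (yIdx k j)).pow (D.p j)
    rwa [smul_eq_mul, weightA, yIdx_val hj.le] at this
  · refine MvPolynomial.isWeightedHomogeneous_monomial _ _ _ ?_
    rw [K.essIdx_eq_idx (by lia)]
    exact T.weight_expoA_idx hk1 hk hpoly hj1 hj

lemma isTop_leadH (T : TopData D K k) (hk1 : 1 ≤ k) (hk : k ≤ D.l + 1)
    (hpoly : ∀ j ≤ k, K.ess j ∈ Set.range incl) {j : ℕ} (hj1 : 1 ≤ j) (hj : j < k) :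
    IsTop (D.subst k (piA D K k (leadH D K k j)))
      (((D.p j * weight D K k j : ℕ) : ℚ) / D.P k) 0 := by
  rw [piA_leadH hk hpoly hj1 hj]
  have := K.isTop_g_succ hk1 hk (K.one_le_idx hj1 (by lia)) (K.idx_lt_idx hj hk)
  rw [K.α_idx hj1 (by lia), ← T.weight_div j hj, ← mul_div_assoc] at this
  exact_mod_cast this

lemma grHom_component (T : TopData D K k) (F : A k) (d : ℕ) :
    T.grHom (MvPolynomial.weightedHomogeneousComponent (weightA D K k) d F) =
      monomial d ((T.grHom F).coeff d) := by
  classical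
  conv_rhs => rw [F.as_sum]
  rw [MvPolynomial.weightedHomogeneousComponent_apply, map_sum, map_sum, finsetSum_coeff, map_sum,
    Finset.sum_filter]
  refine Finset.sum_congr rfl fun m _ => ?_
  rw [T.grHom_monomial, coeff_monomial]
  split_ifs with h
  · rw [h]
  · rw [monomial_zero_right]

/-! ### The Gröbner basis -/

/-- On a leading form `grHom` retains only the coefficient in degree `ω(F)`, which vanishes when the
semidegree is smaller. -/
lemma idealJ_le_ker (T : TopData D K k) (hk : k ≤ D.l + 1) :
    idealJ D K k ≤ RingHom.ker T.grHom := by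
  rw [idealJ, Ideal.span_le]
  rintro L ⟨F, hF, rfl⟩
  set d := MvPolynomial.weightedTotalDegree (weightA D K k) F with hd
  have hP := D.P_pos_rat hk
  have htop := T.isTop_piA hk (F := F) (d := d) fun m hm =>
    MvPolynomial.le_weightedTotalDegree _ hm
  have h0 : (T.grHom F).coeff d = 0 := by
    rw [← htop.2]
    apply D.coeff_eq_zero_of_semidegree_lt
    rwa [mul_div_cancel₀ _ hP.ne']
  rw [SetLike.mem_coe, RingHom.mem_ker]
  change T.grHom _ = 0
  rw [T.grHom_component, h0, monomial_zero_right]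

lemma leadH_mem_idealJ (T : TopData D K k) (hk1 : 1 ≤ k) (hk : k ≤ D.l + 1)
    (hpoly : ∀ j ≤ k, K.ess j ∈ Set.range incl) {j : ℕ} (hj1 : 1 ≤ j) (hj : j < k)
    (hne : leadH D K k j ≠ 0) : leadH D K k j ∈ idealJ D K k := by
  have hhom := T.isWeightedHomogeneous_leadH hk1 hk hpoly hj1 hj
  have hP := D.P_pos_rat hk
  have hdeg : MvPolynomial.weightedTotalDegree (weightA D K k) (leadH D K k j) =
      D.p j * weight D K k j := by
    have h1 := hhom.weighted_total_degree hne
    rw [MvPolynomial.weightedTotalDegree_coe _ _ hne] at h1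
    exact_mod_cast h1
  refine Ideal.subset_span ⟨leadH D K k j, ?_, ?_⟩
  · have := D.semidegree_lt_of_isTop_zero hk (T.isTop_leadH hk1 hk hpoly hj1 hj)
    rw [mul_div_cancel₀ _ hP.ne'] at this
    rwa [hdeg]
  · rw [hdeg, hhom.weightedHomogeneousComponent_same]

lemma expoA_idx_apply (hk : k ≤ D.l + 1) {j : ℕ} (hj : j < k) {t : Fin (k + 1)} (ht : j ≤ t.val)
    (hj1 : 1 ≤ j) : K.expoA k (K.idx j) t = 0 := by
  rw [K.expoA_apply hk, if_neg (by lia)]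
  rcases ht.lt_or_eq with h | h
  · exact K.digit_eq_zero (K.idx_lt_idx_succ (by lia)) h (by lia)
  · rw [KeyForms.digit, ← h, if_neg (lt_irrefl _)]

/-- The two monomials have equal weight, so the tie-break decides: the subtracted one involves no
`y_t` with `t ≥ j`. -/
lemma degree_leadH (T : TopData D K k) (hk1 : 1 ≤ k) (hk : k ≤ D.l + 1)
    (hpoly : ∀ j ≤ k, K.ess j ∈ Set.range incl) {j : ℕ} (hj1 : 1 ≤ j) (hj : j < k) :
    (weightOrder (weightA D K k)).degree (leadH D K k j) = Finsupp.single (yIdx k j) (D.p j) ∧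
      (weightOrder (weightA D K k)).leadingCoeff (leadH D K k j) = 1 := by
  classical
  set mo := weightOrder (weightA D K k) with hmo
  have hX : (MvPolynomial.X (yIdx k j) : A k) ^ D.p j =
      MvPolynomial.monomial (Finsupp.single (yIdx k j) (D.p j)) 1 := by
    rw [MvPolynomial.X_pow_eq_monomial]
  have hppos := D.p_pos hj1 (by lia)
  have hdX : mo.degree ((MvPolynomial.X (yIdx k j) : A k) ^ D.p j) =
      Finsupp.single (yIdx k j) (D.p j) := by
    rw [hX, MonomialOrder.degree_monomial, if_neg one_ne_zero]
  have hθ : K.θ (K.idx j) ≠ 0 := K.θ_ne _ (K.one_le_idx hj1 (by lia)) (K.idx_le_n (by lia))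
  have hlt : mo.toSyn (mo.degree (MvPolynomial.monomial (K.expoA k (K.idx j)) (K.θ (K.idx j)))) <
      mo.toSyn (mo.degree ((MvPolynomial.X (yIdx k j) : A k) ^ D.p j)) := by
    rw [hdX, MonomialOrder.degree_monomial, if_neg hθ, hmo, weightOrder_lt_iff]
    right
    refine ⟨?_, yIdx k j, fun t ht => ?_, ?_⟩
    · rw [T.weight_expoA_idx hk1 hk hpoly hj1 hj, Finsupp.weight_single, smul_eq_mul, weightA,
        yIdx_val hj.le]
    · have ht' : j < t.val := by
        have : (yIdx k j).val < t.val := ht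
        rwa [yIdx_val hj.le] at this
      rw [expoA_idx_apply hk hj ht'.le hj1, Finsupp.single_apply, if_neg ht.ne]
    · rw [expoA_idx_apply hk hj (yIdx_val hj.le).ge hj1, Finsupp.single_eq_same]
      exact hppos
  rw [leadH, K.essIdx_eq_idx (by lia)]
  refine ⟨by rw [MonomialOrder.degree_sub_of_lt hlt, hdX], ?_⟩
  rw [MonomialOrder.leadingCoeff_sub_of_lt hlt, hX, MonomialOrder.leadingCoeff_monomial]

/-- The remainder of `f ∈ J_k` on division by the `H_{j+1}` is standard and killed by `grHom`, hence
zero. -/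
theorem isGroebnerBasis (T : TopData D K k) (hk1 : 1 ≤ k) (hk : k ≤ D.l + 1)
    (hpoly : ∀ j ≤ k, K.ess j ∈ Set.range incl) :
    IsGroebnerBasis (weightOrder (weightA D K k))
      {H | ∃ j, 1 ≤ j ∧ j < k ∧ H = leadH D K k j} (idealJ D K k) := by
  classical
  set mo := weightOrder (weightA D K k) with hmo
  set G : Set (A k) := {H | ∃ j, 1 ≤ j ∧ j < k ∧ H = leadH D K k j} with hG
  have hGJ : G ⊆ idealJ D K k := by
    rintro _ ⟨j, hj1, hj, rfl⟩
    refine T.leadH_mem_idealJ hk1 hk hpoly hj1 hj fun h0 => ?_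
    have := (T.degree_leadH hk1 hk hpoly hj1 hj).2
    simp [h0] at this
  refine ⟨?_, hGJ, le_antisymm (Ideal.span_mono (Set.image_mono hGJ)) ?_⟩
  · refine ((Finset.range k).finite_toSet.image (leadH D K k)).subset ?_
    rintro _ ⟨j, hj1, hj, rfl⟩
    exact ⟨j, by simpa using hj, rfl⟩
  rw [Ideal.span_le]
  rintro _ ⟨f, hf, rfl⟩
  by_cases hf0 : f = 0
  · simp [hf0]
  have hunit : ∀ b ∈ G, IsUnit (mo.leadingCoeff b) := by
    rintro _ ⟨j, hj1, hj, rfl⟩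
    rw [(T.degree_leadH hk1 hk hpoly hj1 hj).2]
    exact isUnit_one
  obtain ⟨g, r, hfr, hdeg, hr⟩ := MonomialOrder.div_set hunit f
  have hlin : Finsupp.linearCombination (A k) (fun b : G => (b : A k)) g ∈ idealJ D K k := by
    rw [Finsupp.linearCombination_apply]
    exact sum_mem fun b _ => Ideal.mul_mem_left _ _ (hGJ b.2)
  have hr0 : r = 0 := by
    refine T.eq_zero_of_std hk (fun m hm t ht1 ht => ?_) ?_
    · by_contra hge
      refine hr m hm _ ⟨t.val, ht1, ht, rfl⟩ ?_
      rw [(T.degree_leadH hk1 hk hpoly ht1 ht).1]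
      have hty : yIdx k t.val = t := Fin.ext (yIdx_val ht.le)
      rw [hty, Finsupp.single_le_iff]
      exact not_lt.1 hge
    · have h1 : r = f - Finsupp.linearCombination (A k) (fun b : G => (b : A k)) g := by
        rw [eq_sub_iff_add_eq', ← hfr]
      have h2 : r ∈ idealJ D K k := h1 ▸ sub_mem hf hlin
      exact T.idealJ_le_ker hk h2
  rw [hr0, add_zero] at hfr
  -- No summand of the division exceeds the degree of `f`, and there is no remainder, so some
  -- summand attains it.
  obtain ⟨b, hb⟩ : ∃ b : G, mo.degree ((b : A k) * g b) = mo.degree f ∧ (b : A k) * g b ≠ 0 := by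
    have hcoeff : f.coeff (mo.degree f) ≠ 0 := by
      rw [← MonomialOrder.leadingCoeff]
      simpa using hf0
    have hsum : f.coeff (mo.degree f) =
        ∑ b ∈ g.support, (g b • (b : A k)).coeff (mo.degree f) := by
      rw [← MvPolynomial.coeff_sum]
      exact congrArg (MvPolynomial.coeff (mo.degree f)) hfr
    rw [hsum] at hcoeff
    obtain ⟨b, -, hb⟩ := Finset.exists_ne_zero_of_sum_ne_zero hcoeff
    rw [smul_eq_mul, mul_comm] at hb
    refine ⟨b, ?_, ?_⟩
    · apply mo.toSyn.injective
      exact le_antisymm (hdeg b) (MonomialOrder.le_degree (MvPolynomial.mem_support_iff.2 hb))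
    · rintro h0
      simp [h0] at hb
  have hbne : (b : A k) ≠ 0 := left_ne_zero_of_mul hb.2
  have hgne : g b ≠ 0 := right_ne_zero_of_mul hb.2
  have hle : mo.degree (b : A k) ≤ mo.degree f := by
    rw [← hb.1, MonomialOrder.degree_mul hbne hgne]
    exact le_self_add
  obtain ⟨j, hj1, hj, hbj⟩ := b.2
  have hlc := (T.degree_leadH hk1 hk hpoly hj1 hj).2
  have hmem : mo.leadingTerm (b : A k) ∈ Ideal.span (mo.leadingTerm '' G) :=
    Ideal.subset_span ⟨b, b.2, rfl⟩
  rw [SetLike.mem_coe]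
  have hfac : mo.leadingTerm f =
      MvPolynomial.monomial (mo.degree f - mo.degree (b : A k)) (mo.leadingCoeff f) *
        mo.leadingTerm (b : A k) := by
    rw [MonomialOrder.leadingTerm, MonomialOrder.leadingTerm, MvPolynomial.monomial_mul,
      tsub_add_cancel_of_le hle, hbj, hlc, mul_one]
  rw [hfac]
  exact Ideal.mul_mem_left _ _ hmem

end TopData

end Leading

end

section


/-! ### Krull dimension of integral extensions -/

/-- Incomparability gives one inequality; lying over and going up lift chains of primes for the
other. -/
lemma ringKrullDim_eq_of_isIntegral {R S : Type*} [CommRing R] [CommRing S] [Algebra R S]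
    [Algebra.IsIntegral R S] (hinj : Function.Injective (algebraMap R S)) :
    ringKrullDim S = ringKrullDim R := by
  refine le_antisymm ?_ ?_
  · refine Order.krullDim_le_of_strictMono (PrimeSpectrum.comap (algebraMap R S)) fun I J h => ?_
    exact Ideal.IsIntegral.comap_lt_comap (I := I.asIdeal) (J := J.asIdeal) h
  · refine iSup_le fun s => ?_
    -- The chain is continued constantly beyond its end, so that the lifting is a plain recursion on
    -- `ℕ`.
    let f : ℕ → PrimeSpectrum R := fun i => s ⟨min i s.length, by lia⟩
    have hf : Monotone f := fun i j hij => s.monotone (by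
      change min i s.length ≤ min j s.length
      lia)
    have hbase : ∃ Q : PrimeSpectrum S, Q.comap (algebraMap R S) = f 0 := by
      obtain ⟨Q, -, hQ, hQP⟩ := Ideal.exists_ideal_over_prime_of_isIntegral (S := S)
        (f 0).asIdeal ⊥ (by
          rw [Ideal.comap_bot_of_injective _ hinj]
          exact bot_le)
      exact ⟨⟨Q, hQ⟩, PrimeSpectrum.ext hQP⟩
    have hstep : ∀ (i : ℕ) (Q : {Q : PrimeSpectrum S // Q.comap (algebraMap R S) = f i}),
        ∃ Q' : {Q : PrimeSpectrum S // Q.comap (algebraMap R S) = f (i + 1)}, Q.1 ≤ Q'.1 := by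
      rintro i ⟨Q, hQ⟩
      obtain ⟨Q', hle, hQ', hQP⟩ := Ideal.exists_ideal_over_prime_of_isIntegral (S := S)
        (f (i + 1)).asIdeal Q.asIdeal (by
          have h1 : (Q.comap (algebraMap R S)).asIdeal ≤ (f (i + 1)).asIdeal := by
            rw [hQ]
            exact hf (Nat.le_succ i)
          exact h1)
      exact ⟨⟨⟨Q', hQ'⟩, PrimeSpectrum.ext hQP⟩, hle⟩
    choose next hnext using hstep
    let g : (i : ℕ) → {Q : PrimeSpectrum S // Q.comap (algebraMap R S) = f i} := fun i =>
      Nat.rec ⟨hbase.choose, hbase.choose_spec⟩ (fun i Q => next i Q) i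
    have hg : Monotone fun i => (g i).1 := monotone_nat_of_le_succ fun i => hnext i (g i)
    let t : LTSeries (PrimeSpectrum S) := LTSeries.mk s.length (fun i => (g i.val).1) (by
      intro i j hij
      refine lt_of_le_of_ne (hg (Nat.le_of_lt hij)) fun heq => ?_
      have h1 : f i.val = f j.val := by
        rw [← (g i.val).2, ← (g j.val).2]
        exact congrArg _ heq
      have h2 : s i = s j := by
        have hi : (⟨min i.val s.length, by lia⟩ : Fin (s.length + 1)) = i := Fin.ext (by
          change min i.val s.length = i.val
          lia)
        have hj : (⟨min j.val s.length, by lia⟩ : Fin (s.length + 1)) = j := Fin.ext (by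
          change min j.val s.length = j.val
          lia)
        have h3 : s ⟨min i.val s.length, by lia⟩ = s ⟨min j.val s.length, by lia⟩ := h1
        rwa [hi, hj] at h3
      exact hij.ne (s.strictMono.injective h2))
    exact Order.LTSeries.length_le_krullDim t

lemma ringKrullDim_eq_of_finite {R S : Type*} [CommRing R] [CommRing S]
    (f : R →+* S) (hinj : Function.Injective f) {s : Set S} (hs : s.Finite)
    (hspan : ∀ M : AddSubmonoid S, (∀ r, ∀ x ∈ s, f r * x ∈ M) → M = ⊤) :
    ringKrullDim S = ringKrullDim R := by
  let : Algebra R S := f.toAlgebra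
  have : Module.Finite R S := by
    refine ⟨Submodule.fg_def.2 ⟨s, hs, ?_⟩⟩
    rw [← Submodule.toAddSubmonoid_inj]
    exact hspan _ fun r x hx => (Submodule.span R s).smul_mem r (Submodule.subset_span hx)
  exact ringKrullDim_eq_of_isIntegral hinj

/-! ### Standard polynomials and their semidegree -/

namespace TopData

variable {D : GenericPuiseux} {K : KeyForms D.fullSemidegree} {k : ℕ}

/-- The leading weighted form is again standard and nonzero, so `grHom` does not kill it. Hence
`δ_k(π_k(F)) = ω(F)` for standard `F`. -/
lemma coeff_ne_zero_of_std (T : TopData D K k) (hk : k ≤ D.l + 1) {F : A k} (hF0 : F ≠ 0)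
    (hF : ∀ m ∈ F.support, IsStd D k m) :
    (D.subst k (piA D K k F)).coeff
      ((MvPolynomial.weightedTotalDegree (weightA D K k) F : ℕ) / D.P k) ≠ 0 := by
  classical
  set d := MvPolynomial.weightedTotalDegree (weightA D K k) F with hd
  intro h0
  have htop := T.isTop_piA hk (F := F) (d := d) fun m hm =>
    MvPolynomial.le_weightedTotalDegree _ hm
  rw [htop.2] at h0
  have hcomp := T.grHom_component F d
  rw [h0, monomial_zero_right] at hcomp
  have hzero := T.eq_zero_of_std hk (fun m hm => hF m ?_) hcomp
  · obtain ⟨m, hm, hmd⟩ := Finset.exists_mem_eq_sup F.support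
      (MvPolynomial.support_nonempty.2 hF0) (Finsupp.weight (weightA D K k))
    have h1 := MvPolynomial.coeff_weightedHomogeneousComponent (w := weightA D K k) d F m
    rw [hzero, if_pos (show _ = d from hmd.symm)] at h1
    exact MvPolynomial.mem_support_iff.1 hm (by simpa using h1.symm)
  · rw [MvPolynomial.support_weightedHomogeneousComponent] at hm
    exact (Finset.mem_filter.1 hm).1

lemma eq_zero_of_piA_eq_zero (T : TopData D K k) (hk : k ≤ D.l + 1) {F : A k}
    (hF : ∀ m ∈ F.support, IsStd D k m) (h0 : piA D K k F = 0) : F = 0 := by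
  by_contra hne
  exact T.coeff_ne_zero_of_std hk hne hF (by simp [h0])

lemma weight_le_of_semidegree_le (T : TopData D K k) (hk : k ≤ D.l + 1) {F : A k}
    (hF : ∀ m ∈ F.support, IsStd D k m) {d : ℕ}
    (hd : D.semidegree k (piA D K k F) ≤ ((d : ℚ) : WithBot ℚ)) :
    ∀ m ∈ F.support, Finsupp.weight (weightA D K k) m ≤ d := by
  intro m hm
  have hne : F ≠ 0 := by
    rintro rfl
    simp at hm
  refine (MvPolynomial.le_weightedTotalDegree _ hm).trans ?_
  rw [D.semidegree_le_coe_iff] at hd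
  have h := hd _ (Finsupp.mem_support_iff.2 (T.coeff_ne_zero_of_std hk hne hF))
  rw [mul_div_cancel₀ _ (D.P_pos_rat hk).ne'] at h
  exact_mod_cast h

end TopData

end

section


/-! ### Monomials of `A_k[z]` -/

section Dehomogenization

variable {k : ℕ}

/-- The monomial `c x ^ m₀ y_1 ^ m₁ ⋯ y_k ^ m_k z ^ a`. -/
def zMonomial (m : Fin (k + 1) →₀ ℕ) (a : ℕ) (c : ℂ) : Az k :=
  MvPolynomial.monomial (m.optionElim a) c

lemma monomial_eq_zMonomial (n : Option (Fin (k + 1)) →₀ ℕ) (c : ℂ) :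
    (MvPolynomial.monomial n c : Az k) = zMonomial n.some (n none) c := by
  rw [zMonomial, Finsupp.optionElim_some]

lemma optionElim_add (m m' : Fin (k + 1) →₀ ℕ) (a a' : ℕ) :
    m.optionElim a + m'.optionElim a' = (m + m').optionElim (a + a') := by
  ext v
  cases v <;> simp [Finsupp.optionElim_apply_eq_elim]

lemma zMonomial_mul (m m' : Fin (k + 1) →₀ ℕ) (a a' : ℕ) (c c' : ℂ) :
    zMonomial m a c * zMonomial m' a' c' = zMonomial (m + m') (a + a') (c * c') := by
  rw [zMonomial, zMonomial, MvPolynomial.monomial_mul, optionElim_add, zMonomial]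

lemma rename_mul_X_pow (m : Fin (k + 1) →₀ ℕ) (a : ℕ) (c : ℂ) :
    (MvPolynomial.rename some (MvPolynomial.monomial m c) * MvPolynomial.X none ^ a : Az k) =
      zMonomial m a c := by
  rw [MvPolynomial.rename_monomial, MvPolynomial.X_pow_eq_monomial, MvPolynomial.monomial_mul,
    mul_one, zMonomial]
  have h : Finsupp.mapDomain some m + Finsupp.single none a = m.optionElim a := by
    ext v
    cases v with
    | none =>
      rw [Finsupp.add_apply, Finsupp.mapDomain_of_notMem_range _ _ (by simp)]
      simp [Finsupp.optionElim_apply_eq_elim]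
    | some t =>
      rw [Finsupp.add_apply, Finsupp.mapDomain_apply (Option.some_injective _)]
      simp [Finsupp.optionElim_apply_eq_elim]
  rw [h]

/-- The specialization `z = 1`. -/
def dehom : Az k →ₐ[ℂ] A k :=
  MvPolynomial.aeval fun v : Option (Fin (k + 1)) =>
    match v with
    | none => 1
    | some t => MvPolynomial.X t

lemma dehom_zMonomial (m : Fin (k + 1) →₀ ℕ) (a : ℕ) (c : ℂ) :
    dehom (zMonomial m a c) = MvPolynomial.monomial m c := by
  rw [← rename_mul_X_pow, map_mul, map_pow, dehom, MvPolynomial.aeval_rename,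
    MvPolynomial.aeval_X, one_pow, mul_one]
  exact MvPolynomial.aeval_X_left_apply _

lemma dehom_monomial (n : Option (Fin (k + 1)) →₀ ℕ) (c : ℂ) :
    dehom (MvPolynomial.monomial n c : Az k) = MvPolynomial.monomial n.some c := by
  rw [monomial_eq_zMonomial, dehom_zMonomial]

lemma exists_of_mem_support_dehom {F : Az k} {m : Fin (k + 1) →₀ ℕ}
    (hm : m ∈ (dehom F).support) : ∃ n ∈ F.support, n.some = m := by
  classical
  rw [F.as_sum, map_sum] at hm
  obtain ⟨n, hn, hmn⟩ := Finset.mem_biUnion.1 (MvPolynomial.support_sum hm)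
  rw [dehom_monomial] at hmn
  exact ⟨n, hn, (Finset.mem_singleton.1 (MvPolynomial.support_monomial_subset hmn)).symm⟩

variable {D : GenericPuiseux} {K : KeyForms D.fullSemidegree}

lemma piAz_eq (F : Az k) : piAz D K k F = piA D K k (dehom F) := by
  have : piAz D K k = (piA D K k).comp dehom := by
    apply MvPolynomial.algHom_ext
    rintro (_ | t)
    · simp [piAz, piA, dehom]
    · simp [piAz, piA, dehom]
  rw [this]
  rfl

lemma weight_optionElim (m : Fin (k + 1) →₀ ℕ) (a : ℕ) :
    Finsupp.weight (weightAz D K k) (m.optionElim a) = a + Finsupp.weight (weightA D K k) m := by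
  rw [Finsupp.weight_apply, Finsupp.sum_option_index_smul, Finsupp.some_optionElim,
    Finsupp.weight_apply, Finsupp.optionElim_apply_eq_elim]
  simp [weightAz]

lemma isWeightedHomogeneous_zMonomial (m : Fin (k + 1) →₀ ℕ) (a : ℕ) (c : ℂ) {d : ℕ}
    (h : a + Finsupp.weight (weightA D K k) m = d) :
    MvPolynomial.IsWeightedHomogeneous (weightAz D K k) (zMonomial m a c) d :=
  MvPolynomial.isWeightedHomogeneous_monomial _ _ _ ((weight_optionElim m a).trans h)

/-- In a homogeneous polynomial the other exponents determine that of `z`, which has weight `1`;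
setting `z = 1` merges no monomials. -/
lemma eq_zero_of_dehom_eq_zero {F : Az k} {d : ℕ}
    (hF : MvPolynomial.IsWeightedHomogeneous (weightAz D K k) F d) (h0 : dehom F = 0) : F = 0 := by
  classical
  by_contra hne
  obtain ⟨n, hn⟩ := MvPolynomial.ne_zero_iff.1 hne
  have hw : ∀ n', F.coeff n' ≠ 0 → n' none + Finsupp.weight (weightA D K k) n'.some = d := by
    intro n' hn'
    rw [← weight_optionElim, Finsupp.optionElim_some]
    exact hF hn'
  have h1 : (dehom F).coeff n.some = F.coeff n := by
    conv_lhs => rw [F.as_sum]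
    rw [map_sum, MvPolynomial.coeff_sum,
      Finset.sum_eq_single_of_mem n (MvPolynomial.mem_support_iff.2 hn)]
    · rw [dehom_monomial, MvPolynomial.coeff_monomial, if_pos rfl]
    · intro n' hn' hnn
      rw [dehom_monomial, MvPolynomial.coeff_monomial, if_neg]
      intro heq
      apply hnn
      have e1 := hw n hn
      have e2 := hw n' (MvPolynomial.mem_support_iff.1 hn')
      rw [heq] at e2
      rw [← Finsupp.optionElim_some n, ← Finsupp.optionElim_some n', heq,
        show n' none = n none by lia]
  rw [h0] at h1
  exact hn (by simpa using h1.symm)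

end Dehomogenization

/-! ### The graded homomorphism -/

section GradedHom

variable {D : GenericPuiseux} {K : KeyForms D.fullSemidegree} {k : ℕ}

/-- The element `y` of the graded ring is the copy in degree `d` of the polynomial `a`. -/
def IsCopy (D : GenericPuiseux) (k d : ℕ) (y : D.gradedRing k) (a : LaurentXY) : Prop :=
  ∃ h : D.filtration k d, y = DirectSum.of (fun d => D.filtration k d) d h ∧
    incl (h : PolyXY) = a

lemma IsCopy.mul {d d' : ℕ} {y y' : D.gradedRing k} {a a' : LaurentXY} (h : IsCopy D k d y a)
    (h' : IsCopy D k d' y' a') : IsCopy D k (d + d') (y * y') (a * a') := by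
  obtain ⟨h, rfl, rfl⟩ := h
  obtain ⟨h', rfl, rfl⟩ := h'
  let h'' : D.filtration k (d + d') := ⟨h * h', SetLike.mul_mem_graded h.2 h'.2⟩
  exact ⟨h'', DirectSum.of_mul_of (A := fun d => D.filtration k d) h h', map_mul incl _ _⟩

lemma IsCopy.add {d : ℕ} {y y' : D.gradedRing k} {a a' : LaurentXY} (h : IsCopy D k d y a)
    (h' : IsCopy D k d y' a') : IsCopy D k d (y + y') (a + a') := by
  obtain ⟨h, rfl, rfl⟩ := h
  obtain ⟨h', rfl, rfl⟩ := h'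
  exact ⟨h + h', (map_add _ _ _).symm, map_add incl _ _⟩

lemma isCopy_zero (d : ℕ) : IsCopy D k d 0 0 := ⟨0, (map_zero _).symm, map_zero incl⟩

lemma isCopy_algebraMap (c : ℂ) :
    IsCopy D k 0 (algebraMap ℂ (D.gradedRing k) c) (algebraMap ℂ LaurentXY c) :=
  ⟨_, DirectSum.algebraMap_apply _ _ c, by
    rw [← AlgHom.commutes incl]
    rfl⟩

lemma IsCopy.sum {ι : Type*} (s : Finset ι) {d : ℕ} {y : ι → D.gradedRing k} {a : ι → LaurentXY}
    (h : ∀ i ∈ s, IsCopy D k d (y i) (a i)) : IsCopy D k d (∑ i ∈ s, y i) (∑ i ∈ s, a i) := by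
  classical
  induction s using Finset.induction_on with
  | empty => simpa using isCopy_zero d
  | insert i s hi ih =>
    rw [Finset.sum_insert hi, Finset.sum_insert hi]
    exact (h i (by simp)).add (ih fun j hj => h j (by simp [hj]))

lemma exists_gradedHom (hpoly : ∀ j ≤ k, K.ess j ∈ Set.range incl)
    (hw : ∀ j ≤ k, D.semidegree k (K.ess j) = ((weight D K k j : ℚ) : WithBot ℚ)) :
    ∃ Ψ : Az k →ₐ[ℂ] D.gradedRing k, ∀ (d : ℕ) (F : Az k),
      MvPolynomial.IsWeightedHomogeneous (weightAz D K k) F d →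
        IsCopy D k d (Ψ F) (piAz D K k F) := by
  have hgen : ∀ v : Option (Fin (k + 1)), ∃ y : D.gradedRing k,
      IsCopy D k (weightAz D K k v) y (piAz D K k (MvPolynomial.X v)) := by
    rintro (_ | t)
    · refine ⟨_, ⟨1, ?_⟩, rfl, by simp [piAz]⟩
      change D.semidegree k (incl 1) ≤ _
      have := D.semidegree_algebraMap_le k 1
      rw [map_one] at this
      refine this.trans (WithBot.coe_le_coe.2 ?_)
      simp [weightAz]
    · have ht : t.val ≤ k := Nat.lt_succ_iff.1 t.2
      obtain ⟨f, hf⟩ := hpoly t ht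
      refine ⟨_, ⟨f, ?_⟩, rfl, by simp [piAz, hf]⟩
      change D.semidegree k (incl f) ≤ _
      rw [hf, hw t ht]
      exact le_rfl
  choose y hy using hgen
  refine ⟨MvPolynomial.aeval y, fun d F hF => ?_⟩
  have hmon : ∀ (n : Option (Fin (k + 1)) →₀ ℕ) (c : ℂ), c ≠ 0 →
      IsCopy D k (Finsupp.weight (weightAz D K k) n)
        (MvPolynomial.aeval y (MvPolynomial.monomial n c))
        (piAz D K k (MvPolynomial.monomial n c)) := by
    intro n c hc
    have h : ∃ d, MvPolynomial.IsWeightedHomogeneous (weightAz D K k)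
        (MvPolynomial.monomial n c) d ∧
        IsCopy D k d (MvPolynomial.aeval y (MvPolynomial.monomial n c))
          (piAz D K k (MvPolynomial.monomial n c)) := by
      refine MvPolynomial.induction_on_monomial (motive := fun F : Az k =>
        ∃ d, MvPolynomial.IsWeightedHomogeneous (weightAz D K k) F d ∧
          IsCopy D k d (MvPolynomial.aeval y F) (piAz D K k F)) ?_ ?_ n c
      · intro a
        refine ⟨0, MvPolynomial.isWeightedHomogeneous_C _ _, ?_⟩
        have h1 : piAz D K k (MvPolynomial.C a) = algebraMap ℂ LaurentXY a :=
          (piAz D K k).commutes a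
        rw [MvPolynomial.aeval_C, h1]
        exact isCopy_algebraMap a
      · rintro p v ⟨d, hp, hcopy⟩
        refine ⟨d + weightAz D K k v, hp.mul (MvPolynomial.isWeightedHomogeneous_X ℂ _ v), ?_⟩
        rw [map_mul, map_mul, MvPolynomial.aeval_X]
        exact hcopy.mul (hy v)
    obtain ⟨d, hd, hcopy⟩ := h
    rwa [hd.inj_right (by simpa using hc)
      (MvPolynomial.isWeightedHomogeneous_monomial _ _ _ rfl)] at hcopy
  have hsum := IsCopy.sum F.support (d := d) fun n hn => by
    have h1 := hmon n (F.coeff n) (MvPolynomial.mem_support_iff.1 hn)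
    rwa [hF (MvPolynomial.mem_support_iff.1 hn)] at h1
  rwa [← map_sum, ← map_sum, ← MvPolynomial.as_sum] at hsum

/-- The homogeneous components of the image of `F` are the images of those of `F`. -/
lemma incl_apply_eq {Ψ : Az k →ₐ[ℂ] D.gradedRing k} (hΨ : ∀ (d : ℕ) (F : Az k),
      MvPolynomial.IsWeightedHomogeneous (weightAz D K k) F d →
        IsCopy D k d (Ψ F) (piAz D K k F)) (F : Az k) (d : ℕ) :
    incl ((Ψ F d : D.filtration k d) : PolyXY) =
      piAz D K k (MvPolynomial.weightedHomogeneousComponent (weightAz D K k) d F) := by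
  classical
  induction F using MvPolynomial.induction_on' with
  | monomial n c =>
    have hn : MvPolynomial.IsWeightedHomogeneous (weightAz D K k) (MvPolynomial.monomial n c)
        (Finsupp.weight (weightAz D K k) n) :=
      MvPolynomial.isWeightedHomogeneous_monomial _ _ _ rfl
    obtain ⟨h, h1, h2⟩ := hΨ _ _ hn
    rw [h1]
    by_cases hd : Finsupp.weight (weightAz D K k) n = d
    · subst hd
      rw [DirectSum.of_eq_same, h2, hn.weightedHomogeneousComponent_same]
    · rw [DirectSum.of_eq_of_ne _ _ _ (Ne.symm hd),
        hn.weightedHomogeneousComponent_ne d (Ne.symm hd), map_zero]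
      exact map_zero incl
  | add F G hF hG =>
    rw [map_add Ψ, map_add (MvPolynomial.weightedHomogeneousComponent _ _),
      map_add (piAz D K k), ← hF, ← hG, ← map_add incl]
    rfl

end GradedHom

end

section


namespace TopData

variable {D : GenericPuiseux} {K : KeyForms D.fullSemidegree} {k : ℕ}

/-! ### The relations -/

lemma X_pow_eq_zMonomial (t : Fin (k + 1)) (a : ℕ) :
    (MvPolynomial.X (some t) ^ a : Az k) = zMonomial (Finsupp.single t a) 0 1 := by
  rw [← rename_mul_X_pow, pow_zero, mul_one, ← MvPolynomial.X_pow_eq_monomial, map_pow,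
    MvPolynomial.rename_X]

lemma relGen_eq (j : ℕ) :
    relGen D K k j = zMonomial (Finsupp.single (yIdx k (j + 1)) 1)
        (D.p j * weight D K k j - weight D K k (j + 1)) 1 -
      (zMonomial (Finsupp.single (yIdx k j) (D.p j)) 0 1 -
        ∑ i ∈ K.steps j, zMonomial (K.expoA k i)
          (D.p j * weight D K k j - Finsupp.weight (weightA D K k) (K.expoA k i)) (K.θ i)) := by
  rw [relGen, homF, X_pow_eq_zMonomial]
  congr 1
  · rw [← rename_mul_X_pow]
    congr 1
    rw [← MvPolynomial.rename_X]
    rfl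
  · congr 1
    exact Finset.sum_congr rfl fun i _ => rename_mul_X_pow _ _ _

lemma isWeightedHomogeneous_relGen (T : TopData D K k) (hk1 : 1 ≤ k) (hk : k ≤ D.l + 1)
    (hpoly : ∀ j ≤ k, K.ess j ∈ Set.range incl) {j : ℕ} (hj1 : 1 ≤ j) (hj : j < k) :
    MvPolynomial.IsWeightedHomogeneous (weightAz D K k) (relGen D K k j)
      (D.p j * weight D K k j) := by
  rw [relGen_eq]
  refine .sub (isWeightedHomogeneous_zMonomial _ _ _ ?_)
    (.sub (isWeightedHomogeneous_zMonomial _ _ _ ?_)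
      (.sum _ _ _ fun i hi => isWeightedHomogeneous_zMonomial _ _ _ ?_))
  · have := T.weight_succ_lt hk1 hk hj1 hj
    rw [Finsupp.weight_single, weightA, yIdx_val (by lia), one_smul]
    lia
  · rw [Finsupp.weight_single, weightA, yIdx_val hj.le, smul_eq_mul, zero_add]
  · have := T.weight_expoA_le hk1 hk hpoly hj1 hj hi
    lia

lemma piAz_relGen (hk : k ≤ D.l + 1) (hpoly : ∀ j ≤ k, K.ess j ∈ Set.range incl)
    {j : ℕ} (hj1 : 1 ≤ j) (hj : j < k) : piAz D K k (relGen D K k j) = 0 := by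
  have h : ∀ (t : ℕ) (a : ℕ), t ≤ k → piA D K k (MvPolynomial.monomial
      (Finsupp.single (yIdx k t) a) 1) = K.ess t ^ a := by
    intro t a ht
    rw [← MvPolynomial.X_pow_eq_monomial, map_pow, piA, MvPolynomial.aeval_X, yIdx_val ht]
  rw [piAz_eq, relGen_eq]
  simp only [map_sub, map_sum, dehom_zMonomial]
  rw [h _ _ hj.le, h _ _ hj, pow_one, K.ess_succ hj1 (by lia),
    Finset.sum_congr rfl fun i hi => K.piA_stepMonomial hk hpoly hj1 hj hi]
  exact sub_self _

lemma relGen_mem {j : ℕ} (hj1 : 1 ≤ j) (hj : j < k) : relGen D K k j ∈ idealJz D K k :=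
  Ideal.subset_span ⟨⟨j - 1, by lia⟩, by rw [relFamily, Nat.sub_add_cancel hj1]⟩

lemma idealJz_le_ker (T : TopData D K k) (hk1 : 1 ≤ k) (hk : k ≤ D.l + 1)
    (hpoly : ∀ j ≤ k, K.ess j ∈ Set.range incl) {Ψ : Az k →ₐ[ℂ] D.gradedRing k}
    (hΨ : ∀ (d : ℕ) (F : Az k), MvPolynomial.IsWeightedHomogeneous (weightAz D K k) F d →
      IsCopy D k d (Ψ F) (piAz D K k F)) : idealJz D K k ≤ RingHom.ker Ψ := by
  rw [idealJz, Ideal.span_le]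
  rintro _ ⟨i, rfl⟩
  have hi := i.2
  obtain ⟨h, h1, h2⟩ :=
    hΨ _ _ (T.isWeightedHomogeneous_relGen hk1 hk hpoly (j := i.val + 1) (by lia) (by lia))
  rw [piAz_relGen hk hpoly (by lia) (by lia)] at h2
  have h3 : h = 0 := Subtype.ext (incl_injective (h2.trans (map_zero incl).symm))
  rw [h3, map_zero] at h1
  exact h1

/-! ### Reduction to standard monomials -/

lemma single_succ_lt (T : TopData D K k) (hk1 : 1 ≤ k) (hk : k ≤ D.l + 1) {j : ℕ} (hj1 : 1 ≤ j)
    (hj : j < k) :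
    (weightOrder (weightA D K k)).toSyn (Finsupp.single (yIdx k (j + 1)) 1) <
      (weightOrder (weightA D K k)).toSyn (Finsupp.single (yIdx k j) (D.p j)) := by
  rw [weightOrder_lt_iff]
  left
  rw [Finsupp.weight_single, Finsupp.weight_single, weightA, weightA, yIdx_val hj, yIdx_val hj.le,
    one_smul]
  exact T.weight_succ_lt hk1 hk hj1 hj

lemma expoA_lt_single (T : TopData D K k) (hk1 : 1 ≤ k) (hk : k ≤ D.l + 1)
    (hpoly : ∀ j ≤ k, K.ess j ∈ Set.range incl) {j i : ℕ} (hj1 : 1 ≤ j) (hj : j < k)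
    (hi : i ∈ K.steps j) :
    (weightOrder (weightA D K k)).toSyn (K.expoA k i) <
      (weightOrder (weightA D K k)).toSyn (Finsupp.single (yIdx k j) (D.p j)) := by
  have hv := yIdx_val (k := k) hj.le
  rw [weightOrder_lt_iff, Finsupp.weight_single, weightA, hv, smul_eq_mul]
  by_cases hne : i = K.idx j
  · right
    subst hne
    refine ⟨T.weight_expoA_idx hk1 hk hpoly hj1 hj, yIdx k j, fun t ht => ?_, ?_⟩
    · have hlt : j < t.val := by
        rw [← hv]
        exact ht
      rw [expoA_idx_apply hk hj hlt.le hj1, Finsupp.single_eq_of_ne ht.ne']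
    · rw [expoA_idx_apply hk hj hv.ge hj1, Finsupp.single_eq_same]
      exact D.p_pos hj1 (by lia)
  · exact Or.inl (T.weight_expoA_lt hk1 hk hpoly hj1 hj hi hne)

/-- The span of the monomials of `A_k[z]` whose `y_t`-exponents, `1 ≤ t < k`, are less
than `p_t`. -/
def stdSub (D : GenericPuiseux) (k : ℕ) : Submodule ℂ (Az k) :=
  MvPolynomial.restrictSupport ℂ {n | IsStd D k n.some}

lemma mem_stdSub {F : Az k} : F ∈ stdSub D k ↔ ∀ n ∈ F.support, IsStd D k n.some :=
  MvPolynomial.mem_restrictSupport_iff ℂ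

lemma zMonomial_mem_stdSub {m : Fin (k + 1) →₀ ℕ} (hm : IsStd D k m) (a : ℕ) (c : ℂ) :
    zMonomial m a c ∈ stdSub D k := by
  rw [mem_stdSub]
  intro n hn
  rw [Finset.mem_singleton.1 (MvPolynomial.support_monomial_subset hn), Finsupp.some_optionElim]
  exact hm

/-- Each relation rewrites `y_t ^ p_t` in terms of monomials that are smaller for `≺` once `z` is
ignored; as `≺` is a well-order, the rewriting terminates. -/
lemma zMonomial_mem_sup (T : TopData D K k) (hk1 : 1 ≤ k) (hk : k ≤ D.l + 1)
    (hpoly : ∀ j ≤ k, K.ess j ∈ Set.range incl) (m : Fin (k + 1) →₀ ℕ) (a : ℕ) (c : ℂ) :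
    zMonomial m a c ∈ (idealJz D K k).restrictScalars ℂ ⊔ stdSub D k := by
  induction h : (weightOrder (weightA D K k)).toSyn m using WellFoundedLT.induction
    generalizing m a c with
  | _ s ih =>
    subst h
    by_cases hm : IsStd D k m
    · exact Submodule.mem_sup_right (zMonomial_mem_stdSub hm a c)
    obtain ⟨t, ht1, htk, hpt⟩ : ∃ t : Fin (k + 1), 1 ≤ t.val ∧ t.val < k ∧ D.p t ≤ m t := by
      simpa [IsStd] using hm
    have hy : yIdx k t.val = t := Fin.ext (yIdx_val htk.le)
    obtain ⟨m', rfl⟩ : ∃ m', m = m' + Finsupp.single (yIdx k t) (D.p t) :=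
      ⟨m - Finsupp.single t (D.p t), by
        rw [hy, tsub_add_cancel_of_le (Finsupp.single_le_iff.2 hpt)]⟩
    have hlt : ∀ {e : Fin (k + 1) →₀ ℕ}, (weightOrder (weightA D K k)).toSyn e <
        (weightOrder (weightA D K k)).toSyn (Finsupp.single (yIdx k t) (D.p t)) →
        ∀ (a' : ℕ) (c' : ℂ), zMonomial m' a c * zMonomial e a' c' ∈
          (idealJz D K k).restrictScalars ℂ ⊔ stdSub D k := by
      intro e he a' c'
      rw [zMonomial_mul]
      refine ih _ ?_ _ _ _ rfl
      rw [map_add, map_add]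
      exact add_lt_add_right he _
    have hsplit : zMonomial (m' + Finsupp.single (yIdx k t) (D.p t)) a c =
        -(zMonomial m' a c * relGen D K k t) +
        (zMonomial m' a c * zMonomial (Finsupp.single (yIdx k (t + 1)) 1)
          (D.p t * weight D K k t - weight D K k (t + 1)) 1 +
        ∑ i ∈ K.steps t, zMonomial m' a c * zMonomial (K.expoA k i)
          (D.p t * weight D K k t - Finsupp.weight (weightA D K k) (K.expoA k i)) (K.θ i)) := by
      rw [relGen_eq, ← Finset.mul_sum]
      have h0 : zMonomial (m' + Finsupp.single (yIdx k t) (D.p t)) a c =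
          zMonomial m' a c * zMonomial (Finsupp.single (yIdx k t) (D.p t)) 0 1 := by
        rw [zMonomial_mul, add_zero, mul_one]
      rw [h0]
      ring
    rw [hsplit]
    refine add_mem (Submodule.mem_sup_left ?_) (add_mem ?_ (sum_mem fun i hi => ?_))
    · exact neg_mem (Ideal.mul_mem_left _ _ (relGen_mem ht1 htk))
    · exact hlt (T.single_succ_lt hk1 hk ht1 htk) _ _
    · exact hlt (T.expoA_lt_single hk1 hk hpoly ht1 htk hi) _ _

lemma exists_add_of_stdSub (T : TopData D K k) (hk1 : 1 ≤ k) (hk : k ≤ D.l + 1)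
    (hpoly : ∀ j ≤ k, K.ess j ∈ Set.range incl) (F : Az k) :
    ∃ G ∈ idealJz D K k, ∃ N ∈ stdSub D k, G + N = F := by
  have h : F ∈ (idealJz D K k).restrictScalars ℂ ⊔ stdSub D k := by
    rw [F.as_sum]
    refine sum_mem fun n _ => ?_
    rw [monomial_eq_zMonomial]
    exact T.zMonomial_mem_sup hk1 hk hpoly _ _ _
  exact Submodule.mem_sup.1 h

/-- Homogeneous components can be treated separately; setting `z = 1` is harmless on each, and `π_k`
is injective on standard polynomials. -/
lemma eq_zero_of_stdSub (T : TopData D K k) (hk : k ≤ D.l + 1) {Ψ : Az k →ₐ[ℂ] D.gradedRing k}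
    (hΨ : ∀ (d : ℕ) (F : Az k), MvPolynomial.IsWeightedHomogeneous (weightAz D K k) F d →
      IsCopy D k d (Ψ F) (piAz D K k F)) {N : Az k} (hN : N ∈ stdSub D k) (h0 : Ψ N = 0) :
    N = 0 := by
  classical
  rw [← MvPolynomial.sum_weightedHomogeneousComponent (weightAz D K k) N]
  refine finsum_eq_zero_of_forall_eq_zero fun d => ?_
  refine eq_zero_of_dehom_eq_zero
    (MvPolynomial.weightedHomogeneousComponent_isWeightedHomogeneous d N) ?_
  refine T.eq_zero_of_piA_eq_zero hk (fun m hm => ?_) ?_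
  · obtain ⟨n, hn, rfl⟩ := exists_of_mem_support_dehom hm
    refine mem_stdSub.1 hN n (MvPolynomial.mem_support_iff.2 fun h => ?_)
    rw [MvPolynomial.mem_support_iff, MvPolynomial.coeff_weightedHomogeneousComponent, h,
      ite_self] at hn
    exact hn rfl
  · rw [← piAz_eq, ← incl_apply_eq hΨ, h0]
    exact map_zero incl

lemma ker_eq_idealJz (T : TopData D K k) (hk1 : 1 ≤ k) (hk : k ≤ D.l + 1)
    (hpoly : ∀ j ≤ k, K.ess j ∈ Set.range incl) {Ψ : Az k →ₐ[ℂ] D.gradedRing k}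
    (hΨ : ∀ (d : ℕ) (F : Az k), MvPolynomial.IsWeightedHomogeneous (weightAz D K k) F d →
      IsCopy D k d (Ψ F) (piAz D K k F)) : idealJz D K k = RingHom.ker Ψ := by
  have hle := T.idealJz_le_ker hk1 hk hpoly hΨ
  refine le_antisymm hle fun F hF => ?_
  obtain ⟨G, hG, N, hN, rfl⟩ := T.exists_add_of_stdSub hk1 hk hpoly F
  have hG0 : Ψ G = 0 := hle hG
  have hF0 : Ψ (G + N) = 0 := hF
  rw [map_add, hG0, zero_add] at hF0
  rwa [T.eq_zero_of_stdSub hk hΨ hN hF0, add_zero]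

end TopData

end

section


variable {D : GenericPuiseux} {K : KeyForms D.fullSemidegree} {k : ℕ}

/-! ### Surjectivity -/

/-- The first essential key form need not be `y`, but it is monic of degree `1` in `y`, so `y` is
`f_1` minus a polynomial in `x`. -/
lemma exists_piA_eq (hk1 : 1 ≤ k) (hpoly : ∀ j ≤ k, K.ess j ∈ Set.range incl) (h : PolyXY) :
    ∃ F : A k, piA D K k F = incl h := by
  change incl h ∈ (piA D K k).range
  have hess : ∀ t ≤ k, K.ess t ∈ (piA D K k).range := fun t ht =>
    ⟨MvPolynomial.X ⟨t, by lia⟩, by simp [piA]⟩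
  have hC : ∀ q : Polynomial ℂ, (C (toLaurent q) : LaurentXY) ∈ (piA D K k).range := by
    intro q
    induction q using Polynomial.induction_on' with
    | add q q' hq hq' =>
      rw [map_add, C_add]
      exact add_mem hq hq'
    | monomial n c =>
      have h0 := hess 0 (by lia)
      rw [K.ess_zero] at h0
      have h1 : (C (toLaurent (monomial n c)) : LaurentXY) =
          c • C (LaurentPolynomial.T 1 : LaurentPolynomial ℂ) ^ n := by
        rw [← C_mul_X_pow_eq_monomial, Polynomial.toLaurent_C_mul_X_pow, ← C_pow,
          LaurentPolynomial.T_pow, mul_one, Polynomial.smul_C, LaurentPolynomial.smul_eq_C_mul]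
      rw [h1]
      exact Subalgebra.smul_mem _ (pow_mem h0 n) c
  have hX : (X : LaurentXY) ∈ (piA D K k).range := by
    obtain ⟨hm, hd⟩ := K.ess_monic_natDegree le_rfl (by lia : 1 ≤ D.l + 1)
    have h1 := hess 1 hk1
    obtain ⟨f, hf⟩ := hpoly 1 hk1
    have h2 : K.ess 1 = X + C (toLaurent (f.coeff 0)) := by
      rw [← incl_coeff, hf]
      exact hm.eq_X_add_C (by simpa [radix] using hd)
    rw [h2] at h1
    simpa using sub_mem h1 (hC (f.coeff 0))
  induction h using Polynomial.induction_on' with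
  | add f f' hf hf' =>
    rw [map_add]
    exact add_mem hf hf'
  | monomial n q =>
    have h1 : incl (monomial n q) = C (toLaurent q) * X ^ n := by
      rw [← C_mul_X_pow_eq_monomial]
      simp [incl]
    rw [h1]
    exact mul_mem (hC q) (pow_mem hX n)

namespace TopData

lemma gradedHom_surjective (T : TopData D K k) (hk1 : 1 ≤ k) (hk : k ≤ D.l + 1)
    (hpoly : ∀ j ≤ k, K.ess j ∈ Set.range incl) {Ψ : Az k →ₐ[ℂ] D.gradedRing k}
    (hΨ : ∀ (d : ℕ) (F : Az k), MvPolynomial.IsWeightedHomogeneous (weightAz D K k) F d →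
      IsCopy D k d (Ψ F) (piAz D K k F)) : Function.Surjective Ψ := by
  classical
  intro y
  induction y using DirectSum.induction_on with
  | zero => exact ⟨0, map_zero Ψ⟩
  | add y y' hy hy' =>
    obtain ⟨F, rfl⟩ := hy
    obtain ⟨F', rfl⟩ := hy'
    exact ⟨F + F', map_add Ψ _ _⟩
  | of d h =>
    obtain ⟨F, hF⟩ := exists_piA_eq (D := D) (K := K) hk1 hpoly (h : PolyXY)
    obtain ⟨G, hG, N, hN, hGN⟩ := T.exists_add_of_stdSub hk1 hk hpoly (MvPolynomial.rename some F)
    have hG0 : piAz D K k G = 0 := by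
      have hle : idealJz D K k ≤ RingHom.ker (piAz D K k) := by
        rw [idealJz, Ideal.span_le]
        rintro _ ⟨i, rfl⟩
        have hi := i.2
        exact piAz_relGen hk hpoly (by lia) (by lia)
      exact hle hG
    have hM : piA D K k (dehom N) = incl h := by
      rw [← piAz_eq, ← zero_add (piAz D K k N), ← hG0, ← map_add, hGN, ← hF, piAz,
        MvPolynomial.aeval_rename]
      rfl
    have hstd : ∀ m ∈ (dehom N).support, IsStd D k m := by
      intro m hm
      obtain ⟨n, hn, rfl⟩ := exists_of_mem_support_dehom hm
      exact mem_stdSub.1 hN n hn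
    have hw := T.weight_le_of_semidegree_le hk hstd (d := d) (by
      rw [hM]
      exact h.2)
    -- Homogenize the standard representative to degree `d`; since its weights are at most `d`, the
    -- subtraction in the exponent of `z` is exact.
    let H : Az k := ∑ m ∈ (dehom N).support,
      zMonomial m (d - Finsupp.weight (weightA D K k) m) ((dehom N).coeff m)
    have hH : MvPolynomial.IsWeightedHomogeneous (weightAz D K k) H d :=
      .sum _ _ _ fun m hm => isWeightedHomogeneous_zMonomial _ _ _ (by
        have := hw m hm
        lia)
    have hHN : dehom H = dehom N := by
      rw [map_sum]
      simp only [dehom_zMonomial]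
      exact ((dehom N).as_sum).symm
    obtain ⟨h', h1, h2⟩ := hΨ d H hH
    refine ⟨H, ?_⟩
    rw [piAz_eq, hHN, hM] at h2
    rw [h1, Subtype.ext (incl_injective h2)]

lemma exists_algEquiv (T : TopData D K k) (hk1 : 1 ≤ k) (hk : k ≤ D.l + 1)
    (hpoly : ∀ j ≤ k, K.ess j ∈ Set.range incl) {Ψ : Az k →ₐ[ℂ] D.gradedRing k}
    (hΨ : ∀ (d : ℕ) (F : Az k), MvPolynomial.IsWeightedHomogeneous (weightAz D K k) F d →
      IsCopy D k d (Ψ F) (piAz D K k F)) :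
    ∃ e : (Az k ⧸ idealJz D K k) ≃ₐ[ℂ] D.gradedRing k,
      ∀ F, e (Ideal.Quotient.mk (idealJz D K k) F) = Ψ F :=
  ⟨(Ideal.quotientEquivAlgOfEq ℂ (T.ker_eq_idealJz hk1 hk hpoly hΨ)).trans
    (Ideal.quotientKerAlgEquivOfSurjective (T.gradedHom_surjective hk1 hk hpoly hΨ)),
    fun _ => rfl⟩

/-! ### The dimension -/

/-- The indices of the variables `z`, `x`, `y_k`. -/
def paramIdx (k : ℕ) : Fin 3 → Option (Fin (k + 1)) := ![none, some 0, some (Fin.last k)]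

lemma paramIdx_injective (hk1 : 1 ≤ k) : Function.Injective (paramIdx k) := by
  have h : (0 : Fin (k + 1)) ≠ Fin.last k := fun h => by
    have := congrArg Fin.val h
    simp at this
    lia
  intro a b
  fin_cases a <;> fin_cases b <;> simp [paramIdx, h, h.symm]

lemma rename_paramIdx_mem_stdSub (hk1 : 1 ≤ k) (hk : k ≤ D.l + 1) (F : MvPolynomial (Fin 3) ℂ) :
    MvPolynomial.rename (paramIdx k) F ∈ stdSub D k := by
  classical
  rw [mem_stdSub]
  intro n hn t ht1 htk
  rw [MvPolynomial.support_rename_of_injective (paramIdx_injective hk1)] at hn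
  obtain ⟨u, -, rfl⟩ := Finset.mem_image.1 hn
  rw [Finsupp.some_apply, Finsupp.mapDomain_of_notMem_range]
  · exact D.p_pos ht1 (by lia)
  · rintro ⟨a, ha⟩
    fin_cases a
    · simp [paramIdx] at ha
    · simp only [paramIdx, Fin.mk_one, Matrix.cons_val_one, Matrix.cons_val_zero] at ha
      rw [← Option.some_injective _ ha] at ht1
      simp at ht1
    · simp only [paramIdx, Fin.reduceFinMk, Matrix.cons_val] at ha
      rw [← Option.some_injective _ ha] at htk
      simp at htk

lemma rename_paramIdx_monomial (a b e : ℕ) (c : ℂ) :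
    MvPolynomial.rename (paramIdx k) (MvPolynomial.C c * MvPolynomial.X 0 ^ a *
      MvPolynomial.X 1 ^ b * MvPolynomial.X 2 ^ e) =
      zMonomial (Finsupp.single 0 b + Finsupp.single (Fin.last k) e) a c := by
  have h0 : (MvPolynomial.C c * MvPolynomial.X none ^ a : Az k) = zMonomial 0 a c := by
    rw [← rename_mul_X_pow, MvPolynomial.monomial_zero', MvPolynomial.rename_C]
  simp only [map_mul, map_pow, MvPolynomial.rename_X, MvPolynomial.rename_C]
  change MvPolynomial.C c * MvPolynomial.X none ^ a * MvPolynomial.X (some 0) ^ b *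
    MvPolynomial.X (some (Fin.last k)) ^ e = _
  rw [h0, X_pow_eq_zMonomial, X_pow_eq_zMonomial, zMonomial_mul, zMonomial_mul]
  simp

/-- Monomials in `z`, `x`, `y_k` are standard, so `ℂ[z, x, y_k]` embeds; the other exponents of a
standard monomial are bounded, so the quotient is a finite module over it. -/
lemma ringKrullDim_quotient (T : TopData D K k) (hk1 : 1 ≤ k) (hk : k ≤ D.l + 1)
    (hpoly : ∀ j ≤ k, K.ess j ∈ Set.range incl) {Ψ : Az k →ₐ[ℂ] D.gradedRing k}
    (hΨ : ∀ (d : ℕ) (F : Az k), MvPolynomial.IsWeightedHomogeneous (weightAz D K k) F d →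
      IsCopy D k d (Ψ F) (piAz D K k F)) :
    ringKrullDim (Az k ⧸ idealJz D K k) = ringKrullDim (MvPolynomial (Fin 3) ℂ) := by
  classical
  let f : MvPolynomial (Fin 3) ℂ →+* Az k ⧸ idealJz D K k :=
    (Ideal.Quotient.mk (idealJz D K k)).comp (MvPolynomial.rename (paramIdx k)).toRingHom
  have hinj : Function.Injective f := by
    rw [injective_iff_map_eq_zero]
    intro F hF
    have h1 : MvPolynomial.rename (paramIdx k) F ∈ idealJz D K k :=
      Ideal.Quotient.eq_zero_iff_mem.1 hF
    have h2 := T.eq_zero_of_stdSub hk hΨ (rename_paramIdx_mem_stdSub hk1 hk F)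
      (T.idealJz_le_ker hk1 hk hpoly hΨ h1)
    exact MvPolynomial.rename_injective _ (paramIdx_injective hk1) (h2.trans (map_zero _).symm)
  -- Only the entries with `0 < t < k` matter: the exponents `e` below vanish at `0` and at `k`.
  let b : Fin (k + 1) →₀ ℕ := Finsupp.equivFunOnFinite.symm fun t => D.p t
  refine ringKrullDim_eq_of_finite f hinj (s := (fun m => Ideal.Quotient.mk (idealJz D K k)
    (zMonomial m 0 1)) '' Set.Iic b) ((Set.finite_Iic b).image _) fun M hM => ?_
  rw [eq_top_iff]
  rintro q -
  obtain ⟨F, rfl⟩ := Ideal.Quotient.mk_surjective q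
  obtain ⟨G, hG, N, hN, rfl⟩ := T.exists_add_of_stdSub hk1 hk hpoly F
  rw [map_add, Ideal.Quotient.eq_zero_iff_mem.2 hG, zero_add, N.as_sum, map_sum]
  refine sum_mem fun n hn => ?_
  rw [monomial_eq_zMonomial]
  have hstd := mem_stdSub.1 hN n hn
  set m := n.some
  let e : Fin (k + 1) →₀ ℕ := (m.erase 0).erase (Fin.last k)
  have he : e ∈ Set.Iic b := by
    intro t
    change e t ≤ D.p t
    rw [Finsupp.erase_apply, Finsupp.erase_apply]
    split_ifs with h1 h2
    · exact Nat.zero_le _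
    · exact Nat.zero_le _
    · have h3 : t.val ≠ 0 := fun h => h2 (Fin.ext h)
      have h4 : t.val ≠ k := fun h => h1 (Fin.ext h)
      exact (hstd t (by lia) (by lia)).le
  have hne : Fin.last k ≠ 0 := fun h => by
    have := congrArg Fin.val h
    simp at this
    lia
  have hsplit : Finsupp.single 0 (m 0) + Finsupp.single (Fin.last k) (m (Fin.last k)) + e = m := by
    have h1 := Finsupp.single_add_erase (Fin.last k) (m.erase 0)
    rw [Finsupp.erase_ne hne] at h1
    rw [add_assoc, h1, Finsupp.single_add_erase]
  have hmul : Ideal.Quotient.mk (idealJz D K k) (zMonomial m (n none) (N.coeff n)) =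
      f (MvPolynomial.C (N.coeff n) * MvPolynomial.X 0 ^ n none * MvPolynomial.X 1 ^ m 0 *
        MvPolynomial.X 2 ^ m (Fin.last k)) *
        Ideal.Quotient.mk (idealJz D K k) (zMonomial e 0 1) := by
    change _ = Ideal.Quotient.mk (idealJz D K k) (MvPolynomial.rename (paramIdx k) _) * _
    rw [rename_paramIdx_monomial, ← map_mul, zMonomial_mul, hsplit, add_zero, mul_one]
  rw [hmul]
  exact hM _ _ ⟨e, he, rfl⟩

lemma isWeightedCompleteIntersection (T : TopData D K k) (hk1 : 1 ≤ k) (hk : k ≤ D.l + 1)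
    (hpoly : ∀ j ≤ k, K.ess j ∈ Set.range incl) {Ψ : Az k →ₐ[ℂ] D.gradedRing k}
    (hΨ : ∀ (d : ℕ) (F : Az k), MvPolynomial.IsWeightedHomogeneous (weightAz D K k) F d →
      IsCopy D k d (Ψ F) (piAz D K k F)) :
    IsWeightedCompleteIntersection (weightAz D K k) (relFamily D K k) := by
  refine ⟨?_, fun i => ?_, ?_⟩
  · rintro (_ | t)
    · exact Nat.one_pos
    · exact T.weight_pos t
  · have hi := i.2
    exact ⟨_, (Nat.zero_le _).trans_lt (T.weight_succ_lt hk1 hk (j := i.val + 1) (by lia) (by lia)),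
      T.isWeightedHomogeneous_relGen hk1 hk hpoly (by lia) (by lia)⟩
  · change ringKrullDim (Az k ⧸ idealJz D K k) + _ = _
    rw [T.ringKrullDim_quotient hk1 hk hpoly hΨ, MvPolynomial.ringKrullDim_of_isNoetherianRing,
      MvPolynomial.ringKrullDim_of_isNoetherianRing, ringKrullDim_eq_zero_of_field]
    have h : 3 + (k - 1) = k + 2 := by lia
    simp only [Nat.card_eq_fintype_card, Fintype.card_option, Fintype.card_fin, zero_add]
    exact_mod_cast h

end TopData

end

end KeyFormsAtInfinity

end

open KeyFormsAtInfinity in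
theorem lemma4p6 (D : GenericPuiseux) (K : KeyForms D.fullSemidegree) (k : ℕ)
    (hk1 : 1 ≤ k) (hk : k ≤ D.l + 1)
    (hpos : ∀ j ≤ k, 0 < D.semidegree k (K.ess j))
    (hpoly : ∀ j ≤ k, K.ess j ∈ Set.range incl) :
    -- the weights and exponents that occur are exact: no rounding or truncation takes place
    ((∀ j ≤ k, D.semidegree k (K.ess j) = ((weight D K k j : ℚ) : WithBot ℚ)) ∧
      ∀ j, 1 ≤ j → j < k →
        weight D K k (j + 1) < D.p j * weight D K k j ∧
        ∀ i ∈ K.steps j, 0 ≤ K.β₀ i ∧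
          Finsupp.weight (weightA D K k) (K.expoA k i) ≤ D.p j * weight D K k j) ∧
    -- the graded isomorphism, given by `z ↦ (1)_1`, `x ↦ (x)_{ω_0}`, `y_j ↦ (f_j)_{ω_j}`
    (∃ e : (Az k ⧸ idealJz D K k) ≃ₐ[ℂ] D.gradedRing k,
      ∀ (d : ℕ) (F : Az k), MvPolynomial.IsWeightedHomogeneous (weightAz D K k) F d →
        ∃ h : D.filtration k d,
          e (Ideal.Quotient.mk (idealJz D K k) F) =
            DirectSum.of (fun d => D.filtration k d) d h ∧
          incl (h : PolyXY) = piAz D K k F) ∧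
    IsWeightedCompleteIntersection (weightAz D K k) (relFamily D K k) ∧
    IsGroebnerBasis (weightOrder (weightA D K k))
      {H | ∃ j, 1 ≤ j ∧ j < k ∧ H = leadH D K k j} (idealJ D K k) := by
  obtain ⟨T⟩ := nonempty_topData hk1 hk hpos
  have hw : ∀ j ≤ k, D.semidegree k (K.ess j) = ((weight D K k j : ℚ) : WithBot ℚ) :=
    fun j hj => K.semidegree_ess hk1 hk hj (hpos j hj)
  obtain ⟨Ψ, hΨ⟩ := exists_gradedHom hpoly hw
  obtain ⟨e, he⟩ := T.exists_algEquiv hk1 hk hpoly hΨ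
  refine ⟨⟨hw, fun j hj1 hj => ⟨T.weight_succ_lt hk1 hk hj1 hj, fun i hi =>
    ⟨K.β₀_nonneg hk hpoly hj1 hj i hi, T.weight_expoA_le hk1 hk hpoly hj1 hj hi⟩⟩⟩,
    ⟨e, fun d F hF => ?_⟩, T.isWeightedCompleteIntersection hk1 hk hpoly hΨ,
    T.isGroebnerBasis hk1 hk hpoly⟩
  rw [he]
  exact hΨ d F hF
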